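/- Let $d\in\{1,2,3\}$, and let $W:[0,\infty)\to\mathbb R$ be such that $x\mapsto W(|x|)$ lies in $L^p(\mathbb R^d)+L^\infty_\varepsilon(\mathbb R^d)$ with $p=1$ if $d=1$ and $p=3/2$ if $d=2,3$; that is, for every $\varepsilon>0$ it is the sum of a function of $L^p$ and a function of $L^\infty$ of norm at most $\varepsilon$. Functions are real valued, and $\langle\cdot,\cdot\rangle$, $\|\cdot\|$ are the scalar product and norm of $L^2(\mathbb R^d)$. Let $R_1,\dots,R_K\in\mathbb R^d$, $V_k(x)=W(|x-R_k|)$, $V_{K+1}=0$, and let $$A=-\tfrac12\Delta+\sum_{k=1}^K V_k+\varsigma ,\qquad \varsigma\in\mathbb R,$$ be the self-adjoint operator on $L^2(\mathbb R^d)$ defined by the form $\langle u,Av\rangle=\frac12\int\nabla u\cdot\nabla v+\int(\sum_kV_k+\varsigma)uv$ with form domain $H^1(\mathbb R^d)$. Assume that $A$ is coercive ($\langle u,Au\rangle\ge\alpha\|u\|^2$ for some $\alpha>0$), write $\|v\|_A=\langle v,Av\rangle^{1/2}$, and let $c_A>0$ satisfy $\|v\|\le c_A\|v\|_A$ for all $v\in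 H^1(\mathbb R^d)$. Let $\Omega_k=\overline B(R_k,\varrho_k)$ with $\varrho_k>0$ for $k\le K$, let $\Omega_{K+1}\subset\mathbb R^d$ be such that $\bigcup_{k=1}^{K+1}\Omega_k=\mathbb R^d$, and let $p_1,\dots,p_{K+1}\in C^\infty(\mathbb R^d)$ satisfy $0\le p_k\le1$, $\operatorname{supp}p_k\subset\Omega_k$, $\sum_{k=1}^{K+1} p_k=1$, and $\sqrt{p_k}\,v\in H^1(\mathbb R^d)$ for all $v\in H^1(\mathbb R^d)$. Let $\varsigma_1,\dots,\varsigma_{K+1}\in\mathbb R$ be such that the operators $A_k=-\frac12\Delta+V_k+\varsigma_k$ on $L^2(\Omega_k)$ with form domain $H^1_0(\Omega_k)$ ($k\le K$) and $A_{K+1}=-\frac12\Delta+\varsigma_{K+1}$ on $L^2(\mathbb R^d)$ with form domain $H^1(\mathbb R^d)$ are coercive. Put $\|\ell\|_{A_k^{-1}}=\langle \ell,A_k^{-1}\ell\rangle^{1/2}$ for $\ell$ in the dual of the form domain of $A_k$ (in particular for $\ell\in L^2$). Assume that $$C:=1+c_A^2\,\sup_{\mathbb R^d}\Big(\sum_{k=1}^{K+1}\Big[-\tfrac14\Delta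 p_k+\tfrac{|\nabla p_k|^2}{8p_k}+V_k(p_k-1)+(\varsigma_k-\varsigma)p_k\Big]\Big)^+$$ is finite, where $\sup$ is the essential supremum and the quotient is $0$ where $p_k=0$. Let $\lambda_1\le\lambda_2\le\cdots$ be the eigenvalues of $A$ below its essential spectrum, counted with multiplicity, where $\lambda_j:=\inf\sigma_{\rm ess}(A)$ if there are fewer than $j$ of them. Let $\chi_1,\dots,\chi_N\in H^1(\mathbb R^d)$ be linearly independent, and let $\lambda_{1N}\le\dots\le\lambda_{NN}$ be the eigenvalues, counted with multiplicity, of $A^\chi c=\lambda S^\chi c$, where $A^\chi=(\langle\chi_\mu,A\chi_\nu\rangle)_{\mu,\nu}$ and $S^\chi=(\langle\chi_\mu,\chi_\nu\rangle)_{\mu,\nu}$. Let $1\le i\le N$, let $c\in\mathbb R^N$ satisfy $A^\chi c=\lambda_{iN}S^\chi c$, and let $\varphi_{iN}=\sum_\mu c_\mu\chi_\mu$ with $\|\varphi_{iN}\|=1$. Suppose that $\lambda_i$ is an eigenvalue of $A$ and that $A\varphi_i=\lambda_i\varphi_i$ with $\|\varphi_i\|=1$ and $\langle\varphi_i,\varphi_{iN}\rangle\ge0$.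 Finally let $\underline\lambda_{i+1}$ and, if $i>1$, $\overline\lambda_{i-1}$ be real numbers (for instance $\overline\lambda_{i-1}=\lambda_{(i-1)N}$) satisfying the gap condition $$\lambda_{i-1}\le\overline\lambda_{i-1}<\lambda_{iN}\ \text{ if } i>1,\qquad \lambda_{iN}<\underline\lambda_{i+1}\le\lambda_{i+1},$$ and put $$\gamma_i=\min\Big(\big(1-\tfrac{\lambda_{iN}}{\overline\lambda_{i-1}}\big)^2,\big(1-\tfrac{\lambda_{iN}}{\underline\lambda_{i+1}}\big)^2\Big),\qquad \widehat\gamma_i=\min\Big(\big(1-\tfrac{\lambda_{iN}}{\overline\lambda_{i-1}}\big)^2\overline\lambda_{i-1},\big(1-\tfrac{\lambda_{iN}}{\underline\lambda_{i+1}}\big)^2\underline\lambda_{i+1}\Big),$$ the terms with $\overline\lambda_{i-1}$ being discarded for $i=1$. With $r_i^2=\sum_{k=1}^{K+1}\|\sqrt{p_k}\,(\lambda_{iN}\varphi_{iN}-A\varphi_{iN})\|_{A_k^{-1}}^2$ one has $$\|\varphi_i-\varphi_{iN}\|_A^2\le C\gamma_i^{-1}r_i^2+\lambda_iC^2\widehat\gamma_i^{-2}r_i^4\qquad\text{and}\qquad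 0\le\lambda_{iN}-\lambda_i\le C\gamma_i^{-1}r_i^2 .$$ -/

import Mathlib

open MeasureTheory
open scoped ENNReal ContDiff

noncomputable section

namespace LCAO

/-- The space `ℝ^d` with its Euclidean norm. -/
abbrev Space (d : ℕ) := EuclideanSpace ℝ (Fin d)

/-- The real Hilbert space `L²(ℝ^d)`. -/
abbrev L2 (d : ℕ) := Lp ℝ 2 (volume : Measure (Space d))

/-! ### Sobolev spaces -/

/-- `g` is the weak gradient of `f`: `∫ f ∇θ = - ∫ θ g` for all test functions `θ ∈ C_c^∞(ℝ^d)`. -/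
def IsWeakGrad {d : ℕ} (f : Space d → ℝ) (g : Space d → Space d) : Prop :=
  ∀ θ : Space d → ℝ, ContDiff ℝ ∞ θ → HasCompactSupport θ →
    ∫ x, f x • gradient θ x = -∫ x, θ x • g x

/-- `f ∈ H¹(ℝ^d)`: `f ∈ L²` and `f` has a weak gradient in `L²`. -/
def MemH1 {d : ℕ} (f : Space d → ℝ) : Prop :=
  MemLp f 2 volume ∧ ∃ g : Space d → Space d, MemLp g 2 volume ∧ IsWeakGrad f g

open Classical in
/-- The weak gradient of a function of `H¹(ℝ^d)` (unique up to a null set). -/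
def weakGrad {d : ℕ} (f : Space d → ℝ) : Space d → Space d :=
  if h : MemH1 f then h.2.choose else 0

/-- `f ∈ H¹₀(Ω)` for an open set `Ω`, where functions on `Ω` are extended by zero to `ℝ^d`:
`f` lies in the closure of `C_c^∞(Ω)` for the `H¹` norm. -/
def MemH10 {d : ℕ} (Ω : Set (Space d)) (f : Space d → ℝ) : Prop :=
  MemH1 f ∧ ∀ ε : ℝ≥0∞, 0 < ε → ∃ θ : Space d → ℝ,
    ContDiff ℝ ∞ θ ∧ HasCompactSupport θ ∧ tsupport θ ⊆ Ω ∧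
    eLpNorm (fun x => f x - θ x) 2 volume < ε ∧
    eLpNorm (fun x => weakGrad f x - gradient θ x) 2 volume < ε

/-! ### Potentials, quadratic forms, energy norms -/

/-- The integrability exponent required of the potential: `1` if `d = 1` and `3/2` otherwise. -/
def potExponent (d : ℕ) : ℝ≥0∞ := if d = 1 then 1 else 3 / 2

/-- `V ∈ L^p(ℝ^d) + L^∞_ε(ℝ^d)`: for every `ε > 0`, `V = V_p + V_∞` almost everywhere with
`V_p ∈ L^p` and `‖V_∞‖_{L^∞} ≤ ε`. -/
def MemLpAddLinftyEps {d : ℕ} (p : ℝ≥0∞) (V : Space d → ℝ) : Prop :=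
  ∀ ε : ℝ≥0∞, 0 < ε → ∃ Vp Vinf : Space d → ℝ,
    MemLp Vp p volume ∧ MemLp Vinf ∞ volume ∧ eLpNorm Vinf ∞ volume ≤ ε ∧
    V =ᵐ[volume] fun x => Vp x + Vinf x

/-- The closed bilinear form `(u, v) ↦ ⟨u, (-½Δ + U) v⟩` of the operator `-½Δ + U`, that is
`½ ∫ ∇u·∇v + ∫ U u v`. -/
def form {d : ℕ} (U : Space d → ℝ) (u v : Space d → ℝ) : ℝ :=
  (1 / 2) * (∫ x, inner ℝ (weakGrad u x) (weakGrad v x)) + ∫ x, U x * u x * v x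

/-- The energy norm `‖u‖_A = ⟨u, A u⟩^{1/2}` of `A = -½Δ + U`. -/
def energyNorm {d : ℕ} (U : Space d → ℝ) (u : Space d → ℝ) : ℝ := Real.sqrt (form U u u)

/-- `-½Δ + U` with form domain `D` is coercive: `⟨u, (-½Δ + U) u⟩ ≥ α ‖u‖²` for some `α > 0`. -/
def Coercive {d : ℕ} (D : (Space d → ℝ) → Prop) (U : Space d → ℝ) : Prop :=
  ∃ α : ℝ, 0 < α ∧ ∀ u : L2 d, D u → α * ‖u‖ ^ 2 ≤ form U u u

open Classical in
/-- The square `⟨ℓ, A⁻¹ ℓ⟩` of the dual norm `‖ℓ‖_{A⁻¹}`, where `A = -½Δ + U` has form domain `D`,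
and `ℓ` (a function of `L²`, or more generally an element of the dual of `D`) is given by the
pairing `w ↦ ⟨ℓ, w⟩`. Here `A⁻¹ ℓ` is the unique `u ∈ D` such that `⟨u, A w⟩ = ⟨ℓ, w⟩` for all
`w ∈ D`; it exists when `A` is coercive and `ℓ` is continuous on `D`. -/
def dualNormSq {d : ℕ} (D : (Space d → ℝ) → Prop) (U : Space d → ℝ)
    (ℓ : (Space d → ℝ) → ℝ) : ℝ :=
  if h : ∃ u : L2 d, D u ∧ ∀ w : L2 d, D w → form U u w = ℓ w then ℓ h.choose else 0

/-! ### Spectrum of the self-adjoint operator `A = -½Δ + U` on `L²(ℝ^d)`, with form domain `H¹` -/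

/-- `u` belongs to the domain of `A - μ` and `(A - μ) u = f`. -/
def Solves {d : ℕ} (U : Space d → ℝ) (μ : ℝ) (f u : L2 d) : Prop :=
  MemH1 u ∧ ∀ w : L2 d, MemH1 w → form U u w - μ * inner ℝ u w = inner ℝ f w

/-- The (real) spectrum of `A`: those `μ` for which `A - μ` is not a bijection from the domain of
`A` onto `L²(ℝ^d)` (the inverse of a bijective `A - μ` is bounded by the closed graph theorem). -/
def spec {d : ℕ} (U : Space d → ℝ) : Set ℝ :=
  {μ | ¬ ∀ f : L2 d, ∃! u : L2 d, Solves U μ f u}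

/-- The span of the eigenfunctions of `A` whose eigenvalue lies in `S`. -/
def eigenSpan {d : ℕ} (U : Space d → ℝ) (S : Set ℝ) : Submodule ℝ (L2 d) :=
  Submodule.span ℝ {u | ∃ ν ∈ S, Solves U ν 0 u}

/-- The essential spectrum of `A`: the points of the spectrum that are not isolated eigenvalues of
finite multiplicity (an isolated point of the spectrum of `A` is always an eigenvalue). -/
def essSpec {d : ℕ} (U : Space d → ℝ) : Set ℝ :=
  {μ | μ ∈ spec U ∧
    ¬ ((∃ ε : ℝ, 0 < ε ∧ ∀ ν ∈ spec U, |ν - μ| < ε → ν = μ) ∧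
      FiniteDimensional ℝ (eigenSpan U {μ}))}

open Classical in
/-- The number of eigenvalues of `A` in `(-∞, μ]`, counted with multiplicity, where `∞` is the value
as soon as the essential spectrum meets `(-∞, μ]`. -/
def specCount {d : ℕ} (U : Space d → ℝ) (μ : ℝ) : ℕ∞ :=
  if (essSpec U ∩ Set.Iic μ).Nonempty then ⊤
  else Cardinal.toENat (Module.rank ℝ (eigenSpan U (Set.Iic μ)))

/-- For `j ≥ 1`, the `j`-th eigenvalue `λ_j` of `A` below its essential spectrum, in increasing
order and counted with multiplicity; it is the bottom of the essential spectrum if there are fewer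
than `j` such eigenvalues. -/
def orderedEigenvalue {d : ℕ} (U : Space d → ℝ) (j : ℕ) : ℝ :=
  sInf {μ : ℝ | (j : ℕ∞) ≤ specCount U μ}

/-! ### Galerkin approximation -/

/-- The Hamiltonian matrix `(⟨χ_μ, A χ_ν⟩)`. -/
def hamiltonianMatrix {d N : ℕ} (U : Space d → ℝ) (χ : Fin N → L2 d) :
    Matrix (Fin N) (Fin N) ℝ :=
  Matrix.of fun a b => form U (χ a) (χ b)

/-- The overlap matrix `(⟨χ_μ, χ_ν⟩)`. -/
def overlapMatrix {d N : ℕ} (χ : Fin N → L2 d) : Matrix (Fin N) (Fin N) ℝ :=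
  Matrix.of fun a b => inner ℝ (χ a) (χ b)

/-- `(lam, c)` solves the generalized eigenvalue equation `A^χ c = lam S^χ c`. -/
def IsGalerkinPair {d N : ℕ} (U : Space d → ℝ) (χ : Fin N → L2 d) (lam : ℝ)
    (c : Fin N → ℝ) : Prop :=
  (hamiltonianMatrix U χ).mulVec c = lam • (overlapMatrix χ).mulVec c

/-- `lamN` lists all Galerkin eigenvalues in increasing order, counted with multiplicity. -/
def IsGalerkinSpectrum {d N : ℕ} (U : Space d → ℝ) (χ : Fin N → L2 d)
    (lamN : Fin N → ℝ) : Prop :=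
  Monotone lamN ∧ ∃ c : Fin N → (Fin N → ℝ), LinearIndependent ℝ c ∧
    ∀ j, IsGalerkinPair U χ (lamN j) (c j)

/-! ### The molecular Hamiltonian, partition of unity, localized residuals -/

/-- The atomic potential `V_k(x) = W(|x - R_k|)`. -/
def atomPot {d K : ℕ} (W : ℝ → ℝ) (R : Fin K → Space d) (k : Fin K) (x : Space d) : ℝ :=
  W ‖x - R k‖

/-- The potential part `∑ V_k + ς` of the Hamiltonian `A = -½Δ + ∑ V_k + ς`. -/
def molPot {d K : ℕ} (W : ℝ → ℝ) (R : Fin K → Space d) (s : ℝ) (x : Space d) : ℝ :=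
  (∑ k, atomPot W R k x) + s

/-- The cover of `ℝ^d` by the closed balls `Ω_k = B(R_k, r_k)` and `Ω_{K+1}`, together with a
subordinate smooth partition of unity `p_1, …, p_{K+1}`, such that `√p_k v ∈ H¹(ℝ^d)` for all
`v ∈ H¹(ℝ^d)`. The index `Fin.last K` stands for `K+1`. -/
structure IsAdaptedPartition {d K : ℕ} (R : Fin K → Space d) (r : Fin K → ℝ)
    (Ωlast : Set (Space d)) (p : Fin (K + 1) → Space d → ℝ) : Prop where
  radius_pos : ∀ k, 0 < r k
  cover : (⋃ k, Metric.closedBall (R k) (r k)) ∪ Ωlast = Set.univ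
  smooth : ∀ k, ContDiff ℝ ∞ (p k)
  support_ball : ∀ k : Fin K, tsupport (p k.castSucc) ⊆ Metric.closedBall (R k) (r k)
  support_last : tsupport (p (Fin.last K)) ⊆ Ωlast
  nonneg : ∀ k x, 0 ≤ p k x
  le_one : ∀ k x, p k x ≤ 1
  sum_eq_one : ∀ x, ∑ k, p k x = 1
  sqrt_mul_memH1 : ∀ k, ∀ v : L2 d, MemH1 v → MemH1 fun x => Real.sqrt (p k x) * v x

/-- The function `∑_{k=1}^{K+1} (-¼ Δp_k + |∇p_k|²/(8 p_k) + V_k (p_k - 1) + (ς_k - ς) p_k)` with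
`V_{K+1} = 0`. Where `p_k` vanishes, so does `∇p_k`, and the quotient is taken to be `0`. -/
def localizationFun {d K : ℕ} (W : ℝ → ℝ) (R : Fin K → Space d) (s : ℝ) (sk : Fin (K + 1) → ℝ)
    (p : Fin (K + 1) → Space d → ℝ) (x : Space d) : ℝ :=
  (∑ k, (-(1 / 4) * Laplacian.laplacian (p k) x + ‖gradient (p k) x‖ ^ 2 / (8 * p k x)
      + (sk k - s) * p k x))
    + ∑ k : Fin K, atomPot W R k x * (p k.castSucc x - 1)

/-- The (essential) supremum over `ℝ^d` of the positive part of `localizationFun`. -/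
def localizationSup {d K : ℕ} (W : ℝ → ℝ) (R : Fin K → Space d) (s : ℝ) (sk : Fin (K + 1) → ℝ)
    (p : Fin (K + 1) → Space d → ℝ) : ℝ≥0∞ :=
  essSup (fun x => ENNReal.ofReal (localizationFun W R s sk p x)) volume

/-- The constant `C = 1 + c_A² sup (…)⁺`. -/
def constC {d K : ℕ} (W : ℝ → ℝ) (R : Fin K → Space d) (s : ℝ) (sk : Fin (K + 1) → ℝ)
    (p : Fin (K + 1) → Space d → ℝ) (cA : ℝ) : ℝ :=
  1 + cA ^ 2 * (localizationSup W R s sk p).toReal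

/-- The pairing `⟨q Res(lam, φ), w⟩ = ⟨lam φ - A φ, q w⟩` of the residual, multiplied by the
function `q`, with a function `w`. -/
def residualPairing {d : ℕ} (U : Space d → ℝ) (lam : ℝ) (φ q w : Space d → ℝ) : ℝ :=
  lam * (∫ x, φ x * (q x * w x)) - form U φ fun x => q x * w x

/-- `r_i² = ∑_{k=1}^{K+1} ‖√p_k Res(lam, φ)‖²_{A_k⁻¹}`, where `A_k = -½Δ + V_k + ς_k` on
`Ω_k = B(R_k, r_k)` has form domain `H¹₀(Ω_k)` for `k ≤ K`, and `A_{K+1} = -½Δ + ς_{K+1}` has form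
domain `H¹(ℝ^d)`. -/
def localizedResidualSq {d K : ℕ} (W : ℝ → ℝ) (R : Fin K → Space d) (r : Fin K → ℝ) (s : ℝ)
    (sk : Fin (K + 1) → ℝ) (p : Fin (K + 1) → Space d → ℝ) (lam : ℝ) (φ : Space d → ℝ) : ℝ :=
  (∑ k : Fin K, dualNormSq (MemH10 (Metric.ball (R k) (r k)))
      (fun x => atomPot W R k x + sk k.castSucc)
      (residualPairing (molPot W R s) lam φ fun x => Real.sqrt (p k.castSucc x)))
    + dualNormSq MemH1 (fun _ => sk (Fin.last K))
      (residualPairing (molPot W R s) lam φ fun x => Real.sqrt (p (Fin.last K) x))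

/-- The gap constant `γ_i`; the term with `low` is discarded for the first eigenvalue. -/
def gapGamma (isFirst : Prop) [Decidable isFirst] (lam low up : ℝ) : ℝ :=
  if isFirst then (1 - lam / up) ^ 2 else min ((1 - lam / low) ^ 2) ((1 - lam / up) ^ 2)

/-- The gap constant `γ̂_i`; the term with `low` is discarded for the first eigenvalue. -/
def gapGammaHat (isFirst : Prop) [Decidable isFirst] (lam low up : ℝ) : ℝ :=
  if isFirst then (1 - lam / up) ^ 2 * up
  else min ((1 - lam / low) ^ 2 * low) ((1 - lam / up) ^ 2 * up)

end LCAO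

end

namespace LCAO

/-! ### Symmetric operators on Hilbert spaces -/

section Hilbert

variable {E : Type*} [NormedAddCommGroup E] [InnerProductSpace ℝ E]

/-! Let `V` be the form domain `H¹` with the energy scalar product `⟨u, A v⟩`, and `J : V → L²` the
inclusion. On `V` the operator `T = J* J` (`energyInv`) is bounded and symmetric and represents
`A⁻¹`; the operator `A - ν` becomes `1 - ν T`. If `x` is the normalized Galerkin function and `n =
‖x‖_A²` its Galerkin eigenvalue, then `h = n T x - x` is the Riesz representer of the residual, so
`‖h‖_A` is the `A⁻¹`-norm of the residual. Two independent estimates are combined.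

Gap estimate (`gap_estimate`, `error_bounds_of_gap`). Write `x = a v + w` with `v` the exact
eigenvector and `w` orthogonal to `v`, in `V` and in `L²` alike. Pythagoras gives `‖v - x‖_A² = (1 -
a)² λ + ‖w‖_A²`, `1 = a² + ‖w‖²` and `n = a² λ + ‖w‖_A²`. As `0 ≤ a ≤ 1`, one has `1 - a ≤ ‖w‖²`, so
it remains to bound `‖w‖_A²` and `‖w‖²` by the residual. On a spectral component with eigenvalue `ν`
the operator `n T - 1` is multiplication by `n/ν - 1`, and the gap condition keeps `ν` away from `n`
on the complement of `v`. No spectral theorem is used. The span `F` of the eigenvectors with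
eigenvalue at most `μ` is finite dimensional when `μ < λ_{i+1}` (counting from one), and `A ≥ μ` on
its complement (`IsEnergyEmbedding.mul_norm_sq_le`), because a supremum of the form that is an
isolated point of the spectrum, with eigenvectors orthogonal to the subspace, could be improved
(`inner_le_of_isolated`). On the part of `F` orthogonal to `v`, a dimension count gives `A ≤ low`
(`norm_sq_le_of_gap`). The inequality `λ_i ≤ n` is the min-max principle.

Localization (`form_le_constC_mul_localizedResidualSq`). Since `∑ p_k = 1`, `‖h‖_A² = ∑ ⟨√p_k Res,
√p_k h⟩`, and each term is at most the local dual norm of `√p_k Res` times the local energy norm of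
`√p_k h`. The IMS formula bounds the sum of the local energies by `C ‖h‖_A²`
(`sum_form_localized_le`), so Cauchy–Schwarz over `k` gives `‖h‖_A² ≤ C r_i²`.

The analytic base is that the potentials are form bounded with relative bound zero
(`MemLpAddLinftyEps.isFormBounded`, from Sobolev inequalities), which makes the energy norm
equivalent to the `H¹` norm, and that `√p_k v` lies in `H¹₀` of the open ball (`memH10_sqrt_mul`).
-/

theorem exists_bound_below_of_bijective [CompleteSpace E] (A : E →L[ℝ] E)
    (hA : Function.Bijective A) : ∃ δ : ℝ, 0 < δ ∧ ∀ x, δ * ‖x‖ ≤ ‖A x‖ := by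
  let e := ContinuousLinearEquiv.ofBijective A (LinearMap.ker_eq_bot.2 hA.1)
    (LinearMap.range_eq_top.2 hA.2)
  refine ⟨(‖(e.symm : E →L[ℝ] E)‖ + 1)⁻¹, by positivity, fun x => ?_⟩
  rw [inv_mul_le_iff₀ (by positivity)]
  have h := (e.symm : E →L[ℝ] E).le_opNorm (A x)
  have h2 : e.symm (A x) = x := e.symm_apply_apply x
  simp only [ContinuousLinearEquiv.coe_coe, h2] at h
  nlinarith [norm_nonneg (A x)]

/-- A symmetric operator that is nonnegative and bounded below on an invariant subspace is
coercive there. -/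
theorem exists_coercive_of_bound_below (B : E →L[ℝ] E)
    (hB : ∀ x y, inner ℝ (B x) y = inner ℝ x (B y)) (G : Submodule ℝ E)
    (hG : ∀ g ∈ G, B g ∈ G) (hpos : ∀ g ∈ G, 0 ≤ inner ℝ (B g) g) {δ : ℝ} (hδ : 0 < δ)
    (hbd : ∀ g ∈ G, δ * ‖g‖ ≤ ‖B g‖) :
    ∃ κ : ℝ, 0 < κ ∧ ∀ g ∈ G, κ * ‖g‖ ^ 2 ≤ inner ℝ (B g) g := by
  set t : ℝ := (‖B‖ + 1)⁻¹ with ht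
  have htpos : 0 < t := by positivity
  have ht1 : t * (‖B‖ + 1) = 1 := inv_mul_cancel₀ (by positivity)
  refine ⟨t * δ ^ 2, by positivity, fun g hg => ?_⟩
  -- Positivity is tested at `g - t B g`, one gradient step. With `t ‖B‖ ≤ 1` it yields `⟨B g, g⟩ ≥
  -- t ‖B g‖²`. The subspace `G` need not be closed for this.
  have h0 := hpos (g - t • B g) (G.sub_mem hg (G.smul_mem _ (hG g hg)))
  have h1 : inner ℝ (B (g - t • B g)) (g - t • B g)
      = inner ℝ (B g) g - 2 * t * ‖B g‖ ^ 2 + t ^ 2 * inner ℝ (B (B g)) (B g) := by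
    simp only [map_sub, map_smul, inner_sub_left, inner_sub_right, inner_smul_left,
      inner_smul_right, hB (B g) g, real_inner_self_eq_norm_sq]
    simp
    ring
  have h2 : inner ℝ (B (B g)) (B g) ≤ ‖B‖ * ‖B g‖ ^ 2 := by
    refine (real_inner_le_norm _ _).trans ?_
    have := B.le_opNorm (B g)
    nlinarith [norm_nonneg (B g)]
  have h3 : (δ * ‖g‖) ^ 2 ≤ ‖B g‖ ^ 2 := by
    have := hbd g hg
    gcongr
  have h5 : t ^ 2 * inner ℝ (B (B g)) (B g) ≤ t ^ 2 * (‖B‖ * ‖B g‖ ^ 2) := by gcongr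
  have h6 : t ^ 2 * (‖B‖ * ‖B g‖ ^ 2) ≤ t * ‖B g‖ ^ 2 := by
    have : t * ‖B‖ ≤ 1 := by nlinarith
    calc t ^ 2 * (‖B‖ * ‖B g‖ ^ 2) = (t * ‖B‖) * (t * ‖B g‖ ^ 2) := by ring
      _ ≤ 1 * (t * ‖B g‖ ^ 2) := by gcongr
      _ = _ := one_mul _
  have h7 : t * (δ * ‖g‖) ^ 2 ≤ t * ‖B g‖ ^ 2 := by gcongr
  nlinarith

/-- A symmetric operator without spectrum in `(-ρ, ρ)` is bounded below by `ρ`. -/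
theorem norm_ge_of_forall_bijective [CompleteSpace E] (Q : E →L[ℝ] E)
    (hQ : ∀ x y, inner ℝ (Q x) y = inner ℝ x (Q y)) {ρ : ℝ}
    (h : ∀ s : ℝ, |s| < ρ → Function.Bijective fun x => Q x - s • x) (x : E) :
    ρ * ‖x‖ ≤ ‖Q x‖ := by
  by_contra! hx
  have hx0 : 0 < ‖x‖ := by
    rw [norm_pos_iff]; rintro rfl; simp at hx
  -- Let `m` be the best lower bound of `Q`. If `m < ρ`, both `Q - m` and `Q + m` are bijective, so
  -- `Q² - m² ≥ 0` is bounded below, hence coercive, and `m` can be raised to `√(m² + κ)`.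
  set S : Set ℝ := {a | 0 ≤ a ∧ ∀ y, a * ‖y‖ ≤ ‖Q y‖} with hS
  have hbdd : BddAbove S := ⟨ρ, fun a ha => by
    by_contra! hc
    have := ha.2 x
    nlinarith⟩
  have h0S : (0 : ℝ) ∈ S := ⟨le_rfl, fun y => by simp⟩
  set m := sSup S with hm
  have hm0 : 0 ≤ m := le_csSup hbdd h0S
  have hmS : ∀ y, m * ‖y‖ ≤ ‖Q y‖ := fun y => by
    rcases eq_or_ne y 0 with rfl | hy
    · simp
    · have hy0 := norm_pos_iff.2 hy
      rw [← le_div_iff₀ hy0]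
      exact csSup_le ⟨0, h0S⟩ fun a ha => (le_div_iff₀ hy0).2 (ha.2 y)
  have hmρ : m < ρ := by
    have := hmS x
    by_contra! hc
    nlinarith
  obtain ⟨δ₁, hδ₁, hb₁⟩ := exists_bound_below_of_bijective (Q - m • ContinuousLinearMap.id ℝ E)
    (h m (by rwa [abs_of_nonneg hm0]))
  obtain ⟨δ₂, hδ₂, hb₂⟩ := exists_bound_below_of_bijective (Q + m • ContinuousLinearMap.id ℝ E)
    (by
      convert h (-m) (by rwa [abs_neg, abs_of_nonneg hm0]) using 1
      ext x
      simp)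
  set B : E →L[ℝ] E := Q.comp Q - (m ^ 2) • ContinuousLinearMap.id ℝ E with hB
  have hBeq : ∀ y, B y = (Q - m • ContinuousLinearMap.id ℝ E)
      ((Q + m • ContinuousLinearMap.id ℝ E) y) := fun y => by
    simp [hB, sq, mul_smul]
    abel
  have hBin : ∀ y, inner ℝ (B y) y = ‖Q y‖ ^ 2 - m ^ 2 * ‖y‖ ^ 2 := fun y => by
    simp [hB, inner_sub_left, inner_smul_left, hQ (Q y) y]
  obtain ⟨κ, hκ, hκB⟩ := exists_coercive_of_bound_below B
    (fun x y => by simp [hB, inner_sub_left, inner_sub_right, inner_smul_left, inner_smul_right, hQ])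
    ⊤ (fun _ _ => trivial)
    (fun y _ => by
      rw [hBin]
      have := hmS y
      have : (m * ‖y‖) ^ 2 ≤ ‖Q y‖ ^ 2 := by gcongr
      linarith [mul_pow m ‖y‖ 2])
    (mul_pos hδ₁ hδ₂) (fun y _ => by
      rw [hBeq, mul_assoc]
      exact (mul_le_mul_of_nonneg_left (hb₂ y) hδ₁.le).trans (hb₁ _))
  have hnew : √(m ^ 2 + κ) ∈ S := by
    refine ⟨Real.sqrt_nonneg _, fun y => ?_⟩
    refine abs_le_of_sq_le_sq' ?_ (norm_nonneg _) |>.2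
    rw [mul_pow, Real.sq_sqrt (by positivity)]
    have := hκB y trivial
    rw [hBin] at this
    linarith
  have h1 := le_csSup hbdd hnew
  have h2 : m < √(m ^ 2 + κ) := Real.lt_sqrt_of_sq_lt (by linarith)
  linarith

/-- If `0` is an isolated point of the spectrum of a symmetric operator `S`, then `S` is bounded
below on the orthogonal complement of its kernel. -/
theorem norm_ge_of_isolated [CompleteSpace E] (S : E →L[ℝ] E)
    (hS : ∀ x y, inner ℝ (S x) y = inner ℝ x (S y)) {δ : ℝ} (hδ : 0 < δ)
    (h : ∀ s : ℝ, s ≠ 0 → |s| < δ → Function.Bijective fun x => S x - s • x)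
    (y : E) (hy : ∀ x, S x = 0 → inner ℝ x y = 0) : δ * ‖y‖ ≤ ‖S y‖ := by
  -- The shift `δ²/2` is the midpoint of `(0, δ²)`. For `|s| < δ²/2` the factorization `Q - s = (S -
  -- r)(S + r)` with `r = √(δ²/2 + s)` in `(0, δ)` shows that `Q - s` is bijective. Expanding `‖Q
  -- x‖²` then gives the bound on the range of `S`, which is dense in the complement of the kernel.
  set Q : E →L[ℝ] E := S.comp S - (δ ^ 2 / 2) • ContinuousLinearMap.id ℝ E with hQ
  have hQx : ∀ x, δ ^ 2 / 2 * ‖x‖ ≤ ‖Q x‖ := by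
    refine norm_ge_of_forall_bijective Q
      (fun x y => by simp [hQ, inner_sub_left, inner_sub_right, inner_smul_left, inner_smul_right, hS])
      fun s hs => ?_
    rw [abs_lt] at hs
    set r := √(δ ^ 2 / 2 + s) with hr
    have hr2 : r ^ 2 = δ ^ 2 / 2 + s := Real.sq_sqrt (by linarith)
    have hr0 : 0 < r := Real.sqrt_pos.2 (by linarith)
    have hrδ : r < δ := lt_of_pow_lt_pow_left₀ 2 hδ.le (by linarith)
    have h1 := h r hr0.ne' (by rwa [abs_of_pos hr0])
    have h2 := h (-r) (neg_ne_zero.2 hr0.ne') (by rwa [abs_neg, abs_of_pos hr0])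
    convert h1.comp h2 using 1
    ext x
    have : s = r * r - δ ^ 2 / 2 := by linarith [sq r]
    simp only [hQ, this, Function.comp, map_sub, map_smul]
    simp only [sub_apply, smul_apply,
      ContinuousLinearMap.comp_apply, ContinuousLinearMap.id_apply]
    module
  have hSS : ∀ x, δ * ‖S x‖ ≤ ‖S (S x)‖ := fun x => by
    refine abs_le_of_sq_le_sq' ?_ (norm_nonneg _) |>.2
    have h1 : (δ ^ 2 / 2 * ‖x‖) ^ 2 ≤ ‖Q x‖ ^ 2 := by
      have := hQx x
      gcongr
    have h2 : ‖Q x‖ ^ 2 = ‖S (S x)‖ ^ 2 - δ ^ 2 * ‖S x‖ ^ 2 + (δ ^ 2 / 2 * ‖x‖) ^ 2 := by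
      have : Q x = S (S x) - (δ ^ 2 / 2) • x := by simp [hQ]
      rw [this, norm_sub_sq_real, inner_smul_right, hS, real_inner_self_eq_norm_sq, norm_smul,
        Real.norm_of_nonneg (by positivity)]
      ring
    rw [mul_pow]
    linarith
  have hcl : y ∈ closure (Set.range S) := by
    have h1 : y ∈ (LinearMap.range (S : E →ₗ[ℝ] E)).topologicalClosure := by
      rw [← Submodule.orthogonal_orthogonal_eq_closure, Submodule.mem_orthogonal]
      intro x hx
      rw [Submodule.mem_orthogonal] at hx
      refine hy x (ext_inner_left ℝ fun z => ?_)
      rw [← hS, inner_zero_right]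
      exact hx _ ⟨z, rfl⟩
    exact h1
  refine closure_minimal ?_ (isClosed_le (by fun_prop) (by fun_prop) :
    IsClosed {z : E | δ * ‖z‖ ≤ ‖S z‖}) hcl
  rintro _ ⟨x, rfl⟩
  exact hSS x

/-- A symmetric operator `T` whose spectrum in `(a, ∞)` consists of isolated points is bounded above
by `a` on a subspace orthogonal to the corresponding eigenspaces. -/
theorem inner_le_of_isolated [CompleteSpace E] (T : E →L[ℝ] E)
    (hT : ∀ x y, inner ℝ (T x) y = inner ℝ x (T y)) (G : Submodule ℝ E)
    (hG : ∀ g ∈ G, T g ∈ G) (a : ℝ)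
    (h : ∀ t, a < t → (Function.Bijective fun x => T x - t • x) ∨
      ((∃ δ : ℝ, 0 < δ ∧ ∀ s, s ≠ t → |s - t| < δ → Function.Bijective fun x => T x - s • x) ∧
        ∀ x, T x = t • x → ∀ g ∈ G, inner ℝ x g = 0)) (g : E) (hg : g ∈ G) :
    inner ℝ (T g) g ≤ a * ‖g‖ ^ 2 := by
  by_contra! hga
  have hg0 : 0 < ‖g‖ := by
    rw [norm_pos_iff]; rintro rfl; simp at hga
  -- Let `M` be the best upper bound that is at least `a`. If `M > a`, then `M - T` is nonnegative
  -- and bounded below on `G`, either because `M` is not in the spectrum or because it is isolated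
  -- with kernel orthogonal to `G`. So `M - T` is coercive on `G` and `M` can be lowered.
  set S : Set ℝ := {b | a ≤ b ∧ ∀ y ∈ G, inner ℝ (T y) y ≤ b * ‖y‖ ^ 2} with hS
  have hbdd : BddBelow S := ⟨a, fun b hb => hb.1⟩
  have hne : max a ‖T‖ ∈ S := ⟨le_max_left _ _, fun y _ => by
    refine (real_inner_le_norm _ _).trans ?_
    have h1 := T.le_opNorm y
    have h2 := le_max_right a ‖T‖
    calc ‖T y‖ * ‖y‖ ≤ ‖T‖ * ‖y‖ * ‖y‖ := by gcongr
      _ = ‖T‖ * ‖y‖ ^ 2 := by ring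
      _ ≤ _ := by gcongr⟩
  set M := sInf S with hM
  have hMS : ∀ y ∈ G, inner ℝ (T y) y ≤ M * ‖y‖ ^ 2 := fun y hy => by
    rcases eq_or_ne y 0 with rfl | hy'
    · simp
    · have hy0 : 0 < ‖y‖ ^ 2 := by have := norm_pos_iff.2 hy'; positivity
      rw [← div_le_iff₀ hy0]
      exact le_csInf ⟨_, hne⟩ fun b hb => (div_le_iff₀ hy0).2 (hb.2 y hy)
  have haM : a < M := by
    have := hMS g hg
    by_contra! hc
    nlinarith [mul_le_mul_of_nonneg_right hc (sq_nonneg ‖g‖)]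
  set B : E →L[ℝ] E := M • ContinuousLinearMap.id ℝ E - T with hB
  have hBapp : ∀ y, B y = M • y - T y := fun y => by simp [hB]
  have hbelow : ∃ δ : ℝ, 0 < δ ∧ ∀ y ∈ G, δ * ‖y‖ ≤ ‖B y‖ := by
    rcases h M haM with hbij | ⟨⟨δ, hδ, hiso⟩, hker⟩
    · obtain ⟨δ, hδ, hb⟩ := exists_bound_below_of_bijective
        (T - M • ContinuousLinearMap.id ℝ E) hbij
      refine ⟨δ, hδ, fun y _ => ?_⟩
      rw [hBapp, norm_sub_rev]
      exact hb y
    · refine ⟨δ, hδ, fun y hy => ?_⟩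
      rw [hBapp, norm_sub_rev]
      refine norm_ge_of_isolated (T - M • ContinuousLinearMap.id ℝ E)
        (fun x y => by simp [inner_sub_left, inner_sub_right, inner_smul_left, inner_smul_right, hT])
        hδ (fun s hs0 hs => ?_) y fun x hx => hker x ?_ y hy
      · convert hiso (M + s) (by simpa using hs0) (by simpa using hs) using 1
        ext x
        simp only [sub_apply, smul_apply,
          ContinuousLinearMap.id_apply]
        module
      · simpa [sub_eq_zero] using hx
  obtain ⟨δ, hδ, hbd⟩ := hbelow
  have hBin : ∀ y, inner ℝ (B y) y = M * ‖y‖ ^ 2 - inner ℝ (T y) y := fun y => by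
    simp [hBapp, inner_sub_left, inner_smul_left]
  obtain ⟨κ, hκ, hκB⟩ := exists_coercive_of_bound_below B
    (fun x y => by simp [hB, inner_sub_left, inner_sub_right, inner_smul_left, inner_smul_right, hT])
    G (fun y hy => by rw [hBapp]; exact G.sub_mem (G.smul_mem _ hy) (hG y hy))
    (fun y hy => by rw [hBin]; linarith [hMS y hy]) hδ hbd
  have hnew : max a (M - κ) ∈ S := ⟨le_max_left _ _, fun y hy => by
    have h1 := hκB y hy
    rw [hBin] at h1
    calc inner ℝ (T y) y ≤ (M - κ) * ‖y‖ ^ 2 := by linarith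
      _ ≤ _ := by gcongr; exact le_max_right _ _⟩
  have h1 := csInf_le hbdd hnew
  rcases le_max_iff.1 h1 with h2 | h2 <;> linarith

/-- The sum equals `‖∑ √t_j f_j‖²`: the terms with `t_j ≠ t_l` vanish, and `√t_j √t_l = t_j` in the
others. Vectors of equal weight need not be orthogonal, so the lemma applies to any family of
eigenvectors without orthogonalizing inside eigenspaces. -/
theorem sum_mul_inner_nonneg {n : Type*} [Fintype n] (f : n → E) (t : n → ℝ)
    (hf : ∀ j l, t j ≠ t l → inner ℝ (f j) (f l) = 0) (ht : ∀ j, 0 ≤ t j) :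
    0 ≤ ∑ j, ∑ l, t j * inner ℝ (f j) (f l) := by
  have h : ∑ j, ∑ l, t j * inner ℝ (f j) (f l) = ‖∑ j, √(t j) • f j‖ ^ 2 := by
    rw [← real_inner_self_eq_norm_sq, sum_inner]
    refine Finset.sum_congr rfl fun j _ => ?_
    rw [inner_sum]
    refine Finset.sum_congr rfl fun l _ => ?_
    rw [inner_smul_left, inner_smul_right]
    by_cases hjl : t j = t l
    · rw [← hjl, ← mul_assoc]
      simp [Real.mul_self_sqrt (ht j)]
    · simp [hf j l hjl]
  rw [h]
  positivity

end Hilbert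

end LCAO

namespace LCAO

/-! ### The spectrum in terms of the energy space -/

section Spectral

variable {d : ℕ} {U : Space d → ℝ} {V : Type*} [NormedAddCommGroup V] [InnerProductSpace ℝ V]
  [CompleteSpace V]

/-- `J` embeds the form domain of `A = -½Δ + U`, equipped with the energy scalar product, into
`L²`. -/
structure IsEnergyEmbedding (U : Space d → ℝ) (J : V →L[ℝ] L2 d) : Prop where
  injective : Function.Injective J
  solves_iff : ∀ (μ : ℝ) (f u : L2 d), Solves U μ f u ↔
    ∃ v, J v = u ∧ ∀ w, inner ℝ v w - μ * inner ℝ (J v) (J w) = inner ℝ f (J w)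

/-- The inverse of `A` as an operator on the energy space. -/
noncomputable def energyInv (J : V →L[ℝ] L2 d) : V →L[ℝ] V :=
  (ContinuousLinearMap.adjoint J).comp J

/-- The span of the eigenvectors with eigenvalues in `S`, as a subspace of the energy space. -/
noncomputable def energyEigenSpan (J : V →L[ℝ] L2 d) (S : Set ℝ) : Submodule ℝ V :=
  Submodule.span ℝ {v | ∃ ν ∈ S, v = ν • energyInv J v}

variable (J : V →L[ℝ] L2 d)

theorem inner_energyInv (v w : V) : inner ℝ (energyInv J v) w = inner ℝ (J v) (J w) := by
  simp [energyInv, ContinuousLinearMap.adjoint_inner_left]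

theorem energyInv_symm (v w : V) : inner ℝ (energyInv J v) w = inner ℝ v (energyInv J w) := by
  rw [inner_energyInv, real_inner_comm, ← inner_energyInv, real_inner_comm]

theorem inner_energyInv_self (v : V) : inner ℝ (energyInv J v) v = ‖J v‖ ^ 2 := by
  rw [inner_energyInv, real_inner_self_eq_norm_sq]

theorem energyInv_mem_energyEigenSpan {S : Set ℝ} {v : V} (hv : v ∈ energyEigenSpan J S) :
    energyInv J v ∈ energyEigenSpan J S := by
  have h : energyEigenSpan J S ≤ (energyEigenSpan J S).comap (energyInv J : V →ₗ[ℝ] V) := by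
    refine Submodule.span_le.2 ?_
    rintro w ⟨ν, hν, hw⟩
    refine Submodule.subset_span ⟨ν, hν, ?_⟩
    conv_lhs => rw [ContinuousLinearMap.coe_coe, hw, map_smul]
    rfl
  exact h hv

theorem energyEigenSpan_mono {S S' : Set ℝ} (h : S ⊆ S') :
    energyEigenSpan J S ≤ energyEigenSpan J S' :=
  Submodule.span_mono fun _ ⟨ν, hν, hv⟩ => ⟨ν, h hν, hv⟩

theorem inner_eq_zero_of_eigen {v w : V} {a b : ℝ} (hv : v = a • energyInv J v)
    (hw : w = b • energyInv J w) (hab : a ≠ b) : inner ℝ v w = 0 := by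
  have h1 : inner ℝ v w = a * inner ℝ (J v) (J w) := by
    conv_lhs => rw [hv, inner_smul_left, inner_energyInv]
    simp
  have h2 : inner ℝ v w = b * inner ℝ (J v) (J w) := by
    conv_lhs => rw [hw, inner_smul_right, ← energyInv_symm, inner_energyInv]
  have h3 : (a - b) * inner ℝ (J v) (J w) = 0 := by linarith
  rcases mul_eq_zero.1 h3 with h | h
  · exact absurd (sub_eq_zero.1 h) hab
  · rw [h1, h, mul_zero]

/-- On the eigenvectors with eigenvalues at most `μ`, one has `A⁻¹ ≥ μ⁻¹`. -/
theorem norm_sq_le_of_mem_energyEigenSpan {μ : ℝ} (hμ : 0 < μ) {v : V}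
    (hv : v ∈ energyEigenSpan J (Set.Iic μ)) : ‖v‖ ^ 2 ≤ μ * ‖J v‖ ^ 2 := by
  obtain ⟨n, c, g, rfl⟩ := (Submodule.mem_span_set' ).1 hv
  -- The weights are `t = ν⁻¹ - μ⁻¹`. A zero generator may carry any `ν ≤ μ`, even a nonpositive
  -- one, and gets weight `0`; a nonzero one has `ν > 0`.
  have hex : ∀ j : Fin n, ∃ t : ℝ, 0 ≤ t ∧
      energyInv J (c j • (g j : V)) = (t + μ⁻¹) • (c j • (g j : V)) := by
    intro j
    obtain ⟨ν, hν, hg⟩ := (g j).2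
    rcases eq_or_ne (g j : V) 0 with h0 | h0
    · exact ⟨0, le_rfl, by simp [h0]⟩
    · have hνpos : 0 < ν := by
        have h1 : ‖(g j : V)‖ ^ 2 = ν * ‖J (g j)‖ ^ 2 := by
          rw [← inner_energyInv_self, ← real_inner_self_eq_norm_sq]
          conv_lhs => rw [hg]
          rw [inner_smul_left, ← hg]; simp
        have h2 : 0 < ‖(g j : V)‖ ^ 2 := by have := norm_pos_iff.2 h0; positivity
        by_contra! hc
        nlinarith [mul_nonneg (neg_nonneg.2 hc) (sq_nonneg ‖J (g j)‖)]
      refine ⟨ν⁻¹ - μ⁻¹, sub_nonneg.2 (inv_anti₀ hνpos hν), ?_⟩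
      rw [sub_add_cancel, map_smul, smul_comm]
      congr 1
      conv_rhs => rw [hg, smul_smul, inv_mul_cancel₀ hνpos.ne', one_smul]
  choose t ht0 ht using hex
  obtain ⟨f, hf⟩ : ∃ f : Fin n → V, f = fun j => c j • (g j : V) := ⟨_, rfl⟩
  have ht : ∀ j, energyInv J (f j) = (t j + μ⁻¹) • f j := by rw [hf]; exact ht
  rw [← hf]
  have hort : ∀ j l, t j ≠ t l → inner ℝ (f j) (f l) = 0 := by
    intro j l hjl
    have h := energyInv_symm J (f j) (f l)
    rw [ht, ht, inner_smul_left, inner_smul_right] at h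
    have h3 : (t j - t l) * inner ℝ (f j) (f l) = 0 := by
      simp only [conj_trivial] at h
      rw [sub_mul]
      linarith
    exact (mul_eq_zero.1 h3).resolve_left (sub_ne_zero.2 hjl)
  have key := sum_mul_inner_nonneg f t hort ht0
  have h1 : ∑ j, ∑ l, t j * inner ℝ (f j) (f l)
      = ‖J (∑ j, f j)‖ ^ 2 - μ⁻¹ * ‖∑ j, f j‖ ^ 2 := by
    have h2 : ∀ j, t j • f j = energyInv J (f j) - μ⁻¹ • f j := fun j => by
      rw [ht]; module
    have h3 : ∑ j, ∑ l, t j * inner ℝ (f j) (f l) = inner ℝ (∑ j, t j • f j) (∑ l, f l) := by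
      rw [sum_inner]
      refine Finset.sum_congr rfl fun j _ => ?_
      rw [inner_sum]
      refine Finset.sum_congr rfl fun l _ => ?_
      rw [inner_smul_left]; simp
    rw [h3, Finset.sum_congr rfl fun j _ => h2 j, Finset.sum_sub_distrib, ← map_sum,
      ← Finset.smul_sum, inner_sub_left, inner_energyInv_self, inner_smul_left,
      real_inner_self_eq_norm_sq]
    simp
  rw [h1, sub_nonneg, inv_mul_le_iff₀ hμ] at key
  exact key

variable {J}

theorem IsEnergyEmbedding.solves_iff' (hJ : IsEnergyEmbedding U J) (μ : ℝ) (f u : L2 d) :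
    Solves U μ f u ↔
      ∃ v, J v = u ∧ v - μ • energyInv J v = ContinuousLinearMap.adjoint J f := by
  rw [hJ.solves_iff]
  refine exists_congr fun v => and_congr_right fun _ => ?_
  constructor
  · intro h
    refine ext_inner_right ℝ fun w => ?_
    rw [ContinuousLinearMap.adjoint_inner_left, ← h w, inner_sub_left, inner_smul_left,
      inner_energyInv]
    simp
  · intro h w
    rw [← ContinuousLinearMap.adjoint_inner_left J w f, ← h, inner_sub_left, inner_smul_left,
      inner_energyInv]
    simp

theorem IsEnergyEmbedding.solves_zero_iff (hJ : IsEnergyEmbedding U J) (μ : ℝ) (u : L2 d) :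
    Solves U μ 0 u ↔ ∃ v, J v = u ∧ v = μ • energyInv J v := by
  rw [hJ.solves_iff']
  simp [sub_eq_zero]

/-- Transfers the spectrum of the unbounded operator to the bounded operator `T` on `V`, where open
mapping arguments are available. -/
theorem IsEnergyEmbedding.notMem_spec_iff (hJ : IsEnergyEmbedding U J) (ν : ℝ) :
    ν ∉ spec U ↔ Function.Bijective fun v => v - ν • energyInv J v := by
  have hlin : ∀ v w : V, v - ν • energyInv J v = w ↔
      (ContinuousLinearMap.id ℝ V - ν • energyInv J) v = w := fun v w => by simp
  rw [spec, Set.mem_ofPred_eq, not_not]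
  constructor
  · intro h
    constructor
    · refine (injective_iff_map_eq_zero (ContinuousLinearMap.id ℝ V - ν • energyInv J)).2 ?_
      intro v hv
      obtain ⟨u, -, hu⟩ := h 0
      have h1 : J v = u := hu _ ((hJ.solves_iff' _ _ _).2 ⟨v, rfl, by simpa using hv⟩)
      have h2 : J 0 = u := hu _ ((hJ.solves_iff' _ _ _).2 ⟨0, rfl, by simp⟩)
      exact hJ.injective (h1.trans h2.symm)
    · intro g
      -- The equation in `L²` only provides right-hand sides `J* f`. With `f = ν J g` it gives `(1 -
      -- ν T) v = ν T g`, and then `(1 - ν T)(g + v) = g`.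
      obtain ⟨u, hu, -⟩ := h (ν • J g)
      obtain ⟨v, -, hv⟩ := (hJ.solves_iff' _ _ _).1 hu
      refine ⟨g + v, ?_⟩
      have : ContinuousLinearMap.adjoint J (ν • J g) = ν • energyInv J g := by simp [energyInv]
      rw [this] at hv
      simp only [map_add, smul_add]
      rw [← hv]
      abel
  · intro h f
    obtain ⟨v, hv⟩ := h.2 (ContinuousLinearMap.adjoint J f)
    refine ⟨J v, (hJ.solves_iff' _ _ _).2 ⟨v, rfl, hv⟩, fun u hu => ?_⟩
    obtain ⟨v', rfl, hv'⟩ := (hJ.solves_iff' _ _ _).1 hu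
    rw [h.1 (hv'.trans hv.symm)]

theorem IsEnergyEmbedding.bijective_of_notMem_spec (hJ : IsEnergyEmbedding U J) {t : ℝ}
    (ht : t ≠ 0) (h : t⁻¹ ∉ spec U) : Function.Bijective fun v => energyInv J v - t • v := by
  have h1 := (hJ.notMem_spec_iff _).1 h
  have h2 : Function.Bijective fun v : V => (-t) • v :=
    (LinearEquiv.smulOfNeZero ℝ V (-t) (neg_ne_zero.2 ht)).bijective
  convert h2.comp h1 using 1
  ext v
  simp only [Function.comp, smul_sub, smul_smul, neg_mul, mul_inv_cancel₀ ht]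
  module

theorem IsEnergyEmbedding.map_energyEigenSpan (hJ : IsEnergyEmbedding U J) (S : Set ℝ) :
    (energyEigenSpan J S).map (J : V →ₗ[ℝ] L2 d) = eigenSpan U S := by
  rw [energyEigenSpan, Submodule.map_span, eigenSpan]
  congr 1
  ext u
  simp only [Set.mem_image, Set.mem_ofPred_eq, hJ.solves_zero_iff]
  constructor
  · rintro ⟨v, ⟨ν, hν, hv⟩, rfl⟩
    exact ⟨ν, hν, v, rfl, hv⟩
  · rintro ⟨ν, hν, v, rfl, hv⟩
    exact ⟨v, ⟨ν, hν, hv⟩, rfl⟩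

noncomputable def IsEnergyEmbedding.eigenSpanEquiv (hJ : IsEnergyEmbedding U J) (S : Set ℝ) :
    energyEigenSpan J S ≃ₗ[ℝ] eigenSpan U S :=
  (Submodule.equivMapOfInjective (J : V →ₗ[ℝ] L2 d) hJ.injective _).trans
    (LinearEquiv.ofEq _ _ (hJ.map_energyEigenSpan S))

/-- Below the essential spectrum, `A⁻¹ ≤ μ⁻¹` on the complement of the eigenvectors with eigenvalues
at most `μ`. -/
theorem IsEnergyEmbedding.mul_norm_sq_le (hJ : IsEnergyEmbedding U J) {μ : ℝ} (hμ : 0 < μ)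
    (hess : ∀ ν ≤ μ, ν ∉ essSpec U) {g : V}
    (hg : ∀ f ∈ energyEigenSpan J (Set.Iic μ), inner ℝ f g = 0) :
    μ * ‖J g‖ ^ 2 ≤ ‖g‖ ^ 2 := by
  -- Points `t > μ⁻¹` of the spectrum of `T` correspond to spectral points `t⁻¹ < μ` of `A`, which
  -- are isolated as they are not essential.
  have key := inner_le_of_isolated (energyInv J) (energyInv_symm J)
    (energyEigenSpan J (Set.Iic μ))ᗮ (fun g hg => ?_) μ⁻¹ (fun t ht => ?_) g
    ((Submodule.mem_orthogonal _ _).2 hg)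
  · rwa [inner_energyInv_self, le_inv_mul_iff₀ hμ] at key
  · rw [Submodule.mem_orthogonal] at hg ⊢
    intro f hf
    rw [← energyInv_symm]
    exact hg _ (energyInv_mem_energyEigenSpan J hf)
  · have ht0 : 0 < t := (inv_pos.2 hμ).trans ht
    have htμ : t⁻¹ ≤ μ := by
      rw [inv_le_comm₀ ht0 hμ]; exact ht.le
    by_cases hs : t⁻¹ ∈ spec U
    · right
      have h1 := hess _ htμ
      rw [essSpec, Set.mem_ofPred_eq, not_and, not_not] at h1
      obtain ⟨⟨ε, hε, hiso⟩, -⟩ := h1 hs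
      constructor
      · have hc : ContinuousAt (fun s : ℝ => s⁻¹) t := continuousAt_inv₀ ht0.ne'
        obtain ⟨δ, hδ, hδ'⟩ := Metric.continuousAt_iff.1 hc ε hε
        -- A radius of at most `t` also excludes `s = 0`, where inversion breaks down.
        refine ⟨min δ t, lt_min hδ ht0, fun s hst hs' => ?_⟩
        have hs0 : s ≠ 0 := by
          rintro rfl
          have := hs'.trans_le (min_le_right _ _)
          rw [zero_sub, abs_neg, abs_of_pos ht0] at this
          exact lt_irrefl _ this
        refine hJ.bijective_of_notMem_spec hs0 fun hmem => hst (inv_injective ?_)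
        exact hiso _ hmem (hδ' (hs'.trans_le (min_le_left _ _)))
      · intro x hx g hg
        refine (Submodule.mem_orthogonal _ _).1 hg x (Submodule.subset_span ⟨t⁻¹, htμ, ?_⟩)
        rw [hx, smul_smul, inv_mul_cancel₀ ht0.ne', one_smul]
    · exact Or.inl (hJ.bijective_of_notMem_spec ht0.ne' hs)

/-- A finite count at `μ` rules out essential spectrum up to `μ`, since the count would be `⊤`
otherwise. This is the source of every finite-dimensional eigenspan used below. -/
theorem not_le_specCount (hJ : IsEnergyEmbedding U J) {j : ℕ} {μ : ℝ}
    (h : ¬ (j : ℕ∞) ≤ specCount U μ) : (∀ ν ≤ μ, ν ∉ essSpec U) ∧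
      FiniteDimensional ℝ (energyEigenSpan J (Set.Iic μ)) ∧
      Module.finrank ℝ (energyEigenSpan J (Set.Iic μ)) < j := by
  rw [specCount] at h
  split_ifs at h with hne
  · simp at h
  · have hlt := not_le.1 h
    have hr : Module.rank ℝ (eigenSpan U (Set.Iic μ)) < (j : Cardinal) := by
      by_contra! hc
      exact h (by simpa using Cardinal.toENat.monotone' hc)
    have hfin : FiniteDimensional ℝ (eigenSpan U (Set.Iic μ)) :=
      Module.rank_lt_aleph0_iff.1 (hr.trans (Cardinal.natCast_lt_aleph0))
    have hfin' : FiniteDimensional ℝ (energyEigenSpan J (Set.Iic μ)) :=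
      (hJ.eigenSpanEquiv (Set.Iic μ)).symm.finiteDimensional
    refine ⟨fun ν hν hmem => hne ⟨ν, hmem, hν⟩, hfin', ?_⟩
    rw [(hJ.eigenSpanEquiv (Set.Iic μ)).finrank_eq]
    rw [← Module.finrank_eq_rank] at hr
    exact_mod_cast hr

theorem le_finrank_of_le_specCount (hJ : IsEnergyEmbedding U J) {j : ℕ} {μ : ℝ}
    (h : (j : ℕ∞) ≤ specCount U μ) (hess : ∀ ν ≤ μ, ν ∉ essSpec U)
    [FiniteDimensional ℝ (energyEigenSpan J (Set.Iic μ))] :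
    j ≤ Module.finrank ℝ (energyEigenSpan J (Set.Iic μ)) := by
  have hfin : FiniteDimensional ℝ (eigenSpan U (Set.Iic μ)) :=
    (hJ.eigenSpanEquiv (Set.Iic μ)).finiteDimensional
  rw [specCount, if_neg] at h
  · rw [(hJ.eigenSpanEquiv (Set.Iic μ)).finrank_eq]
    rw [← Module.finrank_eq_rank, Cardinal.natCast_le_toENat] at h
    exact_mod_cast h
  · rintro ⟨ν, hν, hν'⟩
    exact hess ν hν' hν

/-- Below the coercivity constant `1 - ν T` is itself coercive, with constant `1` or `1 - ν / κ`
according to the sign of `ν`. It is then invertible by Lax–Milgram, so there is neither spectrum nor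
an eigenvector. -/
theorem specCount_eq_zero (hJ : IsEnergyEmbedding U J) {κ μ : ℝ}
    (hκ : ∀ v, κ * ‖J v‖ ^ 2 ≤ ‖v‖ ^ 2) (hμ : μ < κ) (hκ0 : 0 < κ) : specCount U μ = 0 := by
  have hspec : ∀ ν ≤ μ, ν ∉ spec U := by
    intro ν hν
    rw [hJ.notMem_spec_iff]
    obtain ⟨c, hc, hc'⟩ : ∃ c : ℝ, 0 < c ∧ ∀ v : V,
        c * ‖v‖ ^ 2 ≤ ‖v‖ ^ 2 - ν * ‖J v‖ ^ 2 := by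
      rcases le_or_gt ν 0 with h0 | h0
      · exact ⟨1, one_pos, fun v => by nlinarith [mul_nonneg (neg_nonneg.2 h0) (sq_nonneg ‖J v‖)]⟩
      · refine ⟨1 - ν / κ, sub_pos.2 ((div_lt_one hκ0).2 (hν.trans_lt hμ)), fun v => ?_⟩
        have h1 := mul_le_mul_of_nonneg_left (hκ v) (div_nonneg h0.le hκ0.le)
        have h2 : ν / κ * (κ * ‖J v‖ ^ 2) = ν * ‖J v‖ ^ 2 := by field_simp
        linarith
    have hu := ContinuousLinearMap.isUnit_of_forall_le_norm_inner_map
      (ContinuousLinearMap.id ℝ V - ν • energyInv J) (c := c.toNNReal) (Real.toNNReal_pos.2 hc) fun v => by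
        refine le_trans ?_ (le_abs_self _)
        simp only [sub_apply, ContinuousLinearMap.id_apply,
          smul_apply, inner_sub_left, inner_smul_left, inner_energyInv_self,
          real_inner_self_eq_norm_sq, conj_trivial]
        have := hc' v
        rw [Real.coe_toNNReal _ hc.le]
        linarith
    obtain ⟨e, he⟩ := (ContinuousLinearMap.isUnit_iff_bijective).1 hu
    exact ⟨e, he⟩
  have hbot : eigenSpan U (Set.Iic μ) = ⊥ := by
    rw [eigenSpan, Submodule.span_eq_bot]
    rintro u ⟨ν, hν, hu⟩
    obtain ⟨v, rfl, hv⟩ := (hJ.solves_zero_iff _ _).1 hu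
    have h1 := (hJ.notMem_spec_iff ν).1 (hspec ν hν)
    have : v = 0 := h1.1 (by simpa [sub_eq_zero] using hv)
    simp [this]
  rw [specCount, if_neg, hbot]
  · simp
  · rintro ⟨ν, hν, hν'⟩
    exact hspec ν hν' hν.1

/-- Bounds from below the set whose infimum defines `orderedEigenvalue`, so that the infimum is a
genuine one. The case `j = 0` is excluded because the set is then all of `ℝ`. -/
theorem le_of_le_specCount (hJ : IsEnergyEmbedding U J) {κ μ : ℝ}
    (hκ : ∀ v, κ * ‖J v‖ ^ 2 ≤ ‖v‖ ^ 2) (hκ0 : 0 < κ) {j : ℕ} (hj : j ≠ 0)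
    (h : (j : ℕ∞) ≤ specCount U μ) : κ ≤ μ := by
  by_contra! hc
  rw [specCount_eq_zero hJ hκ hc hκ0] at h
  simp [hj] at h

theorem not_le_specCount_of_lt (hJ : IsEnergyEmbedding U J) {κ μ : ℝ}
    (hκ : ∀ v, κ * ‖J v‖ ^ 2 ≤ ‖v‖ ^ 2) (hκ0 : 0 < κ) {j : ℕ} (hj : j ≠ 0)
    (h : μ < orderedEigenvalue U j) : ¬ (j : ℕ∞) ≤ specCount U μ := fun hle =>
  absurd (csInf_le ⟨κ, fun _ hν => le_of_le_specCount hJ hκ hκ0 hj hν⟩ hle) (not_le.2 h)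

/-- The upper half of the min-max principle. -/
theorem orderedEigenvalue_le (hJ : IsEnergyEmbedding U J) {κ : ℝ}
    (hκ : ∀ v, κ * ‖J v‖ ^ 2 ≤ ‖v‖ ^ 2) (hκ0 : 0 < κ) {j : ℕ} (hj : j ≠ 0)
    (E : Submodule ℝ V) [FiniteDimensional ℝ E] (hE : j ≤ Module.finrank ℝ E) {ν : ℝ} (hν : 0 < ν)
    (h : ∀ v ∈ E, ‖v‖ ^ 2 ≤ ν * ‖J v‖ ^ 2) : orderedEigenvalue U j ≤ ν := by
  by_contra! hc
  obtain ⟨μ, hνμ, hμ⟩ := exists_between hc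
  obtain ⟨hess, hfin, hrank⟩ := not_le_specCount hJ (not_le_specCount_of_lt hJ hκ hκ0 hj hμ)
  set F := energyEigenSpan J (Set.Iic μ)
  -- As `dim F < j ≤ dim E`, the projection onto `F` kills some nonzero `x` in `E`. For it `μ ‖J x‖²
  -- ≤ ‖x‖² ≤ ν ‖J x‖²`, which contradicts `ν < μ`.
  have hker := LinearMap.ker_ne_bot_of_finrank_lt
    (f := (F.orthogonalProjectionOnto : V →ₗ[ℝ] F) ∘ₗ E.subtype) (hrank.trans_le hE)
  obtain ⟨x, hx, hx0⟩ := Submodule.exists_mem_ne_zero_of_ne_bot hker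
  have hx' : F.orthogonalProjectionOnto (x : V) = 0 := hx
  rw [Submodule.orthogonalProjectionOnto_eq_zero_iff, Submodule.mem_orthogonal] at hx'
  have h1 := hJ.mul_norm_sq_le (hν.trans hνμ) hess hx'
  have h2 := h x x.2
  have h3 : J (x : V) ≠ 0 := fun h0 => hx0 (Subtype.ext (hJ.injective (by simpa using h0)))
  have h4 : 0 < ‖J (x : V)‖ ^ 2 := by have := norm_pos_iff.2 h3; positivity
  nlinarith

end Spectral

end LCAO

namespace LCAO

/-! ### The gap estimate -/

section Gap

variable {d : ℕ} {U : Space d → ℝ} {V : Type*} [NormedAddCommGroup V] [InnerProductSpace ℝ V]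
  [CompleteSpace V] {J : V →L[ℝ] L2 d}

/-- Cauchy–Schwarz for `⟨n T h - h, h⟩`. It replaces the spectral calculus in both residual bounds.
-/
theorem sq_le_residual_mul (n : ℝ) (h : V) :
    (n * ‖J h‖ ^ 2 - ‖h‖ ^ 2) ^ 2 ≤ ‖n • energyInv J h - h‖ ^ 2 * ‖h‖ ^ 2 := by
  have h1 : inner ℝ (n • energyInv J h - h) h = n * ‖J h‖ ^ 2 - ‖h‖ ^ 2 := by
    simp [inner_sub_left, inner_smul_left, inner_energyInv_self]
  rw [← h1, ← mul_pow, sq_le_sq, abs_mul, abs_norm, abs_norm]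
  exact abs_real_inner_le_norm _ _

/-- Residual bounds on a subspace where `A ≥ up > n`. -/
theorem residual_bounds_of_ge {n up : ℝ} (hn : 0 < n) (hup : n < up) {h : V}
    (hh : up * ‖J h‖ ^ 2 ≤ ‖h‖ ^ 2) :
    (1 - n / up) ^ 2 * ‖h‖ ^ 2 ≤ ‖n • energyInv J h - h‖ ^ 2 ∧
      (1 - n / up) ^ 2 * up * ‖J h‖ ^ 2 ≤ ‖n • energyInv J h - h‖ ^ 2 := by
  have hup0 : 0 < up := hn.trans hup
  have h1 : (1 - n / up) ^ 2 * ‖h‖ ^ 2 ≤ ‖n • energyInv J h - h‖ ^ 2 := by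
    rcases eq_or_ne h 0 with rfl | h0
    · simp
    · have hpos : 0 < ‖h‖ ^ 2 := by have := norm_pos_iff.2 h0; positivity
      have key := sq_le_residual_mul (J := J) n h
      have h2 : (1 - n / up) * ‖h‖ ^ 2 ≤ ‖h‖ ^ 2 - n * ‖J h‖ ^ 2 := by
        have := mul_le_mul_of_nonneg_left hh (div_nonneg hn.le hup0.le)
        have h3 : n / up * (up * ‖J h‖ ^ 2) = n * ‖J h‖ ^ 2 := by field_simp
        linarith
      have h4 : 0 ≤ (1 - n / up) * ‖h‖ ^ 2 :=
        mul_nonneg (sub_nonneg.2 ((div_le_one hup0).2 hup.le)) hpos.le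
      have h5 : ((1 - n / up) * ‖h‖ ^ 2) ^ 2 ≤ (‖h‖ ^ 2 - n * ‖J h‖ ^ 2) ^ 2 := by gcongr
      refine le_of_mul_le_mul_right ?_ hpos
      calc (1 - n / up) ^ 2 * ‖h‖ ^ 2 * ‖h‖ ^ 2 = ((1 - n / up) * ‖h‖ ^ 2) ^ 2 := by ring
        _ ≤ (‖h‖ ^ 2 - n * ‖J h‖ ^ 2) ^ 2 := h5
        _ = (n * ‖J h‖ ^ 2 - ‖h‖ ^ 2) ^ 2 := by ring
        _ ≤ _ := key
  refine ⟨h1, le_trans ?_ h1⟩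
  rw [mul_assoc]
  gcongr

/-- Residual bounds on a subspace where `A ≤ low < n`. -/
theorem residual_bounds_of_le {n low : ℝ} (hlow : 0 < low) (hn : low < n) {h : V}
    (hh : ‖h‖ ^ 2 ≤ low * ‖J h‖ ^ 2) :
    (1 - n / low) ^ 2 * ‖h‖ ^ 2 ≤ ‖n • energyInv J h - h‖ ^ 2 ∧
      (1 - n / low) ^ 2 * low * ‖J h‖ ^ 2 ≤ ‖n • energyInv J h - h‖ ^ 2 := by
  -- Here the form is bounded above by the `L²` norm, so `‖J h‖` is estimated first and `‖h‖` is
  -- deduced from it, in the reverse order of the previous lemma.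
  have h1 : (1 - n / low) ^ 2 * low * ‖J h‖ ^ 2 ≤ ‖n • energyInv J h - h‖ ^ 2 := by
    rcases (sq_nonneg ‖J h‖).eq_or_lt' with h0 | h0
    · simp [h0]
    · have key := sq_le_residual_mul (J := J) n h
      have h4 : 0 ≤ (n - low) * ‖J h‖ ^ 2 := mul_nonneg (sub_nonneg.2 hn.le) h0.le
      have h5 : ((n - low) * ‖J h‖ ^ 2) ^ 2 ≤ (n * ‖J h‖ ^ 2 - ‖h‖ ^ 2) ^ 2 :=
        pow_le_pow_left₀ h4 (by linarith) 2
      have h6 : ‖n • energyInv J h - h‖ ^ 2 * ‖h‖ ^ 2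
          ≤ ‖n • energyInv J h - h‖ ^ 2 * (low * ‖J h‖ ^ 2) := by gcongr
      refine le_of_mul_le_mul_right ?_ (mul_pos hlow h0)
      calc (1 - n / low) ^ 2 * low * ‖J h‖ ^ 2 * (low * ‖J h‖ ^ 2)
          = ((n - low) * ‖J h‖ ^ 2) ^ 2 := by field_simp; ring
        _ ≤ _ := h5.trans (key.trans h6)
  refine ⟨le_trans ?_ h1, h1⟩
  rw [mul_assoc]
  gcongr

/-- A dimension count: the eigenspan `F` up to `μ` has dimension at most `i + 1` and contains `v`,
so its part `Y` orthogonal to `v` has dimension at most `i`. For each `m > low ≥ λ_i` it is shown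
that `f` is a combination of eigenvectors with eigenvalues below `m`; then `m` decreases to `low`.
Multiple eigenvalues need no separate treatment. -/
theorem norm_sq_le_of_gap (hJ : IsEnergyEmbedding U J) {κ : ℝ}
    (hκ : ∀ v, κ * ‖J v‖ ^ 2 ≤ ‖v‖ ^ 2) (hκ0 : 0 < κ) {i : ℕ} {lam low μ : ℝ}
    (hlam : lam = orderedEigenvalue U (i + 1))
    (hne : ∀ j ≤ i + 1, {μ : ℝ | (j : ℕ∞) ≤ specCount U μ}.Nonempty)
    (hlow : i ≠ 0 → orderedEigenvalue U i ≤ low ∧ low < μ) (hlamμ : lam ≤ μ)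
    (hμ : ¬ ((i + 2 : ℕ) : ℕ∞) ≤ specCount U μ) {v : V} (hv0 : v ≠ 0)
    (hv : v = lam • energyInv J v)
    {f : V} (hf : f ∈ energyEigenSpan J (Set.Iic μ)) (hfv : inner ℝ f v = 0) :
    (i = 0 → f = 0) ∧ (i ≠ 0 → ‖f‖ ^ 2 ≤ low * ‖J f‖ ^ 2) := by
  obtain ⟨hess, hfin, hrank⟩ := not_le_specCount hJ hμ
  set F := energyEigenSpan J (Set.Iic μ) with hF
  have hvF : v ∈ F := Submodule.subset_span ⟨lam, hlamμ, hv⟩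
  set Y : Submodule ℝ V := F ⊓ (Submodule.span ℝ {v})ᗮ with hY
  have hYmem : ∀ y ∈ F, inner ℝ y v = 0 → y ∈ Y := fun y hy hyv =>
    ⟨hy, Submodule.mem_orthogonal_singleton_iff_inner_left.2 hyv⟩
  have hYF : Y < F := by
    refine lt_of_le_of_ne inf_le_left fun h => hv0 ?_
    have : v ∈ Y := h ▸ hvF
    exact inner_self_eq_zero.1 (Submodule.mem_orthogonal_singleton_iff_inner_left.1 this.2)
  have hYrank : Module.finrank ℝ Y ≤ i := by
    have := Submodule.finrank_lt_finrank_of_lt hYF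
    omega
  have : FiniteDimensional ℝ Y := Submodule.finiteDimensional_of_le hYF.le
  refine ⟨fun hi => ?_, fun hi => ?_⟩
  · have : Y = ⊥ := Submodule.finrank_eq_zero.1 (by omega)
    have hfY := hYmem f hf hfv
    rwa [this, Submodule.mem_bot] at hfY
  · obtain ⟨hlow1, hlow2⟩ := hlow hi
    have hstep : ∀ m, low < m → m < μ → ‖f‖ ^ 2 ≤ m * ‖J f‖ ^ 2 := by
      intro m hm1 hm2
      obtain ⟨μ', hμ', hμ'm⟩ := exists_lt_of_csInf_lt (hne i (by omega)) (hlow1.trans_lt hm1)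
      have hbelow : ∀ μ' < m, f ∈ energyEigenSpan J (Set.Iic μ') → κ ≤ μ' →
          ‖f‖ ^ 2 ≤ m * ‖J f‖ ^ 2 := fun μ' hμ' hf' h0 =>
        (norm_sq_le_of_mem_energyEigenSpan J (hκ0.trans_le h0) hf').trans (by gcongr)
      have hle : ∀ μ' < m, energyEigenSpan J (Set.Iic μ') ≤ F := fun μ' h' =>
        energyEigenSpan_mono J (Set.Iic_subset_Iic.2 (h'.le.trans hm2.le))
      have hfin' : ∀ μ' < m, FiniteDimensional ℝ (energyEigenSpan J (Set.Iic μ')) :=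
        fun μ' h' => Submodule.finiteDimensional_of_le (hle μ' h')
      have hess' : ∀ μ' < m, ∀ ν ≤ μ', ν ∉ essSpec U := fun μ' h' ν hν =>
        hess ν (hν.trans (h'.le.trans hm2.le))
      -- If `μ' < lam`, the eigenspan up to `μ'` is orthogonal to `v` and has dimension at least
      -- `i`, so it is all of `Y`. Otherwise `lam < m`, and a level `μ'' < m` with count at least `i
      -- + 1` already exhausts `F`.
      rcases lt_or_ge μ' lam with hlt | hge
      · have hF' := hfin' μ' hμ'm
        have hr := le_finrank_of_le_specCount hJ hμ' (hess' μ' hμ'm)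
        have hort : energyEigenSpan J (Set.Iic μ') ≤ (Submodule.span ℝ {v})ᗮ := by
          refine Submodule.span_le.2 ?_
          rintro w ⟨ν, hν, hw⟩
          exact Submodule.mem_orthogonal_singleton_iff_inner_left.2
            (inner_eq_zero_of_eigen J hw hv (ne_of_lt (lt_of_le_of_lt hν hlt)))
        have heq := Submodule.eq_of_le_of_finrank_le (le_inf (hle μ' hμ'm) hort)
          (hYrank.trans hr)
        refine hbelow μ' hμ'm ?_ (le_of_le_specCount hJ hκ hκ0 hi hμ')
        rw [heq]
        exact hYmem f hf hfv
      · have hlm : sInf {μ : ℝ | ((i + 1 : ℕ) : ℕ∞) ≤ specCount U μ} < m := by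
          have : sInf {μ : ℝ | ((i + 1 : ℕ) : ℕ∞) ≤ specCount U μ} = lam := hlam.symm
          rw [this]
          exact hge.trans_lt hμ'm
        obtain ⟨μ'', hμ'', hμ''m⟩ := exists_lt_of_csInf_lt (hne (i + 1) le_rfl) hlm
        have hF'' := hfin' μ'' hμ''m
        have hr := le_finrank_of_le_specCount hJ hμ'' (hess' μ'' hμ''m)
        have heq := Submodule.eq_of_le_of_finrank_le (hle μ'' hμ''m) (by omega)
        refine hbelow μ'' hμ''m ?_ (le_of_le_specCount hJ hκ hκ0 (by omega) hμ'')
        rwa [heq]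
    have hlim : Filter.Tendsto (fun m : ℝ => m * ‖J f‖ ^ 2) (nhdsWithin low (Set.Ioi low))
        (nhds (low * ‖J f‖ ^ 2)) :=
      ((continuous_id.mul continuous_const).tendsto low).mono_left nhdsWithin_le_nhds
    refine ge_of_tendsto hlim ?_
    filter_upwards [Ioo_mem_nhdsGT hlow2] with m hm
    exact hstep m hm.1 hm.2

/-- Both `F` and its complement are invariant under `T`, so splitting `w = f + g` along `F` is
orthogonal for the energy norm, for the `L²` norm and for the residual. The part `f` sees `A ≤ low`,
the part `g` sees `A ≥ μ`, and the two bounds add up to the minimum of the two factors. -/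
theorem gap_estimate_aux (hJ : IsEnergyEmbedding U J) {κ : ℝ}
    (hκ : ∀ v, κ * ‖J v‖ ^ 2 ≤ ‖v‖ ^ 2) (hκ0 : 0 < κ) {i : ℕ} {lam low μ n : ℝ}
    (hlam : lam = orderedEigenvalue U (i + 1))
    (hne : ∀ j ≤ i + 1, {μ : ℝ | (j : ℕ∞) ≤ specCount U μ}.Nonempty)
    (hlow : i ≠ 0 → orderedEigenvalue U i ≤ low ∧ low < n) (hlow0 : i ≠ 0 → 0 < low)
    (hlamn : lam ≤ n) (hn0 : 0 < n) (hnμ : n < μ)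
    (hμ : ¬ ((i + 2 : ℕ) : ℕ∞) ≤ specCount U μ) {v : V} (hv0 : v ≠ 0)
    (hv : v = lam • energyInv J v) {w : V} (hwv : inner ℝ w v = 0) :
    gapGamma (i = 0) n low μ * ‖w‖ ^ 2 ≤ ‖n • energyInv J w - w‖ ^ 2 ∧
      gapGammaHat (i = 0) n low μ * ‖J w‖ ^ 2 ≤ ‖n • energyInv J w - w‖ ^ 2 := by
  obtain ⟨hess, hfin, hrank⟩ := not_le_specCount hJ hμ
  set F := energyEigenSpan J (Set.Iic μ) with hF
  have hvF : v ∈ F := Submodule.subset_span ⟨lam, (hlamn.trans hnμ.le), hv⟩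
  set f : V := F.starProjection w with hfdef
  have hf : f ∈ F := F.starProjection_apply_mem w
  set g : V := w - f with hgdef
  have hg : ∀ x ∈ F, inner ℝ x g = 0 :=
    (Submodule.mem_orthogonal _ _).1 (F.sub_starProjection_mem_orthogonal w)
  have hw : w = f + g := by rw [hgdef]; abel
  have hfv : inner ℝ f v = 0 := by
    have h1 := hg v hvF
    rw [hgdef, inner_sub_right, real_inner_comm, hwv, real_inner_comm] at h1
    linarith
  obtain ⟨hi0, hi1⟩ := norm_sq_le_of_gap hJ hκ hκ0 hlam hne
    (fun hi => ⟨(hlow hi).1, (hlow hi).2.trans hnμ⟩) (hlamn.trans hnμ.le) hμ hv0 hv hf hfv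
  obtain ⟨hg1, hg2⟩ := residual_bounds_of_ge (J := J) hn0 hnμ
    (hJ.mul_norm_sq_le (hn0.trans hnμ) hess hg)
  have hTf := energyInv_mem_energyEigenSpan J hf
  have hJfg : inner ℝ (J f) (J g) = 0 := by rw [← inner_energyInv]; exact hg _ hTf
  have e1 : ‖w‖ ^ 2 = ‖f‖ ^ 2 + ‖g‖ ^ 2 := by
    rw [hw, norm_add_sq_real, hg f hf]; ring
  have e2 : ‖J w‖ ^ 2 = ‖J f‖ ^ 2 + ‖J g‖ ^ 2 := by
    rw [hw, map_add, norm_add_sq_real, hJfg]; ring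
  have e3 : ‖n • energyInv J w - w‖ ^ 2
      = ‖n • energyInv J f - f‖ ^ 2 + ‖n • energyInv J g - g‖ ^ 2 := by
    have h1 : n • energyInv J w - w = (n • energyInv J f - f) + (n • energyInv J g - g) := by
      rw [hw, map_add]; module
    have hm : n • energyInv J f - f ∈ F := F.sub_mem (F.smul_mem _ hTf) hf
    rw [h1, norm_add_sq_real, inner_sub_right, inner_smul_right, hg _ hm, ← energyInv_symm,
      hg _ (energyInv_mem_energyEigenSpan J hm)]
    ring
  by_cases hi : i = 0
  · have hf0 := hi0 hi
    rw [e1, e2, e3, hf0, gapGamma, gapGammaHat, if_pos hi, if_pos hi]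
    simpa using ⟨hg1, hg2⟩
  · obtain ⟨hf1, hf2⟩ := residual_bounds_of_le (J := J) (hlow0 hi) (hlow hi).2 (hi1 hi)
    rw [e1, e2, e3, gapGamma, gapGammaHat, if_neg hi, if_neg hi, mul_add, mul_add]
    refine ⟨add_le_add (le_trans ?_ hf1) (le_trans ?_ hg1),
      add_le_add (le_trans ?_ hf2) (le_trans ?_ hg2)⟩
    · gcongr; exact min_le_left _ _
    · gcongr; exact min_le_right _ _
    · gcongr; exact min_le_left _ _
    · gcongr; exact min_le_right _ _

/-- At `up` itself the count may already reach `i + 2`. So the estimate is taken at levels `μ` in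
`(n, up)` and passed to the limit `μ → up` by continuity of the gap constants. -/
theorem gap_estimate (hJ : IsEnergyEmbedding U J) {κ : ℝ}
    (hκ : ∀ v, κ * ‖J v‖ ^ 2 ≤ ‖v‖ ^ 2) (hκ0 : 0 < κ) {i : ℕ} {lam low up n : ℝ}
    (hlam : lam = orderedEigenvalue U (i + 1))
    (hlow : i ≠ 0 → orderedEigenvalue U i ≤ low ∧ low < n)
    (hup : n < up ∧ up ≤ orderedEigenvalue U (i + 2))
    (hlamn : lam ≤ n) (hn0 : 0 < n) {v : V} (hv0 : v ≠ 0)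
    (hv : v = lam • energyInv J v) :
    (0 < gapGamma (i = 0) n low up ∧ 0 < gapGammaHat (i = 0) n low up) ∧
      ∀ w, inner ℝ w v = 0 →
      gapGamma (i = 0) n low up * ‖w‖ ^ 2 ≤ ‖n • energyInv J w - w‖ ^ 2 ∧
      gapGammaHat (i = 0) n low up * ‖J w‖ ^ 2 ≤ ‖n • energyInv J w - w‖ ^ 2 := by
  have hup0 : 0 < up := hn0.trans hup.1
  have hne2 : {μ : ℝ | ((i + 2 : ℕ) : ℕ∞) ≤ specCount U μ}.Nonempty := by
    rw [Set.nonempty_iff_ne_empty]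
    intro h
    -- The infimum of the empty set is `0` by convention, which `0 < up ≤ orderedEigenvalue U (i +
    -- 2)` excludes.
    have h1 : orderedEigenvalue U (i + 2) = 0 := by rw [orderedEigenvalue, h, Real.sInf_empty]
    linarith [hup.2]
  have hne : ∀ j ≤ i + 1, {μ : ℝ | (j : ℕ∞) ≤ specCount U μ}.Nonempty := by
    intro j hj
    obtain ⟨μ, hμ⟩ := hne2
    exact ⟨μ, le_trans (Nat.cast_le.2 (by omega : j ≤ i + 2)) (show ((i + 2 : ℕ) : ℕ∞) ≤ _ from hμ)⟩
  have hlow0 : i ≠ 0 → 0 < low := fun hi => by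
    refine hκ0.trans_le (le_trans ?_ (hlow hi).1)
    exact le_csInf (hne i (by omega)) fun μ hμ => le_of_le_specCount hJ hκ hκ0 hi hμ
  have hγup : 0 < (1 - n / up) ^ 2 := by
    have : 0 < 1 - n / up := sub_pos.2 ((div_lt_one hup0).2 hup.1)
    positivity
  refine ⟨?_, fun w hw => ?_⟩
  · rw [gapGamma, gapGammaHat]
    split_ifs with hi
    · exact ⟨hγup, mul_pos hγup hup0⟩
    · have h1 := hlow0 hi
      have hγlow : 0 < (1 - n / low) ^ 2 := by
        have : 1 - n / low < 0 := sub_neg.2 ((one_lt_div h1).2 (hlow hi).2)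
        exact sq_pos_of_neg this
      exact ⟨lt_min hγlow hγup, lt_min (mul_pos hγlow h1) (mul_pos hγup hup0)⟩
  · have key : ∀ μ, n < μ → μ < up → _ := fun μ h1 h2 =>
      gap_estimate_aux hJ hκ hκ0 hlam hne hlow hlow0 hlamn hn0 h1
        (not_le_specCount_of_lt hJ hκ hκ0 (by omega) (h2.trans_le hup.2)) hv0 hv hw
    have hc : ContinuousAt (fun μ : ℝ => gapGamma (i = 0) n low μ) up := by
      unfold gapGamma
      split_ifs
      · fun_prop (disch := exact hup0.ne')
      · fun_prop (disch := exact hup0.ne')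
    have hc' : ContinuousAt (fun μ : ℝ => gapGammaHat (i = 0) n low μ) up := by
      unfold gapGammaHat
      split_ifs
      · fun_prop (disch := exact hup0.ne')
      · fun_prop (disch := exact hup0.ne')
    constructor
    · refine le_of_tendsto ((hc.mul_const (‖w‖ ^ 2)).tendsto.mono_left
        (nhdsWithin_le_nhds (s := Set.Iio up))) ?_
      filter_upwards [Ioo_mem_nhdsLT hup.1] with μ hμ
      exact (key μ hμ.1 hμ.2).1
    · refine le_of_tendsto ((hc'.mul_const (‖J w‖ ^ 2)).tendsto.mono_left
        (nhdsWithin_le_nhds (s := Set.Iio up))) ?_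
      filter_upwards [Ioo_mem_nhdsLT hup.1] with μ hμ
      exact (key μ hμ.1 hμ.2).2

/-- To be read with `a` the overlap of the two eigenfunctions, `w` and `j` the squared energy and
`L²` norms of the orthogonal remainder. From `0 ≤ a ≤ 1` follows `1 - a ≤ 1 - a² = j`, and
eliminating `a` gives `n - lam = w - lam j`. The sign condition on the eigenfunction is needed only
here. -/
theorem error_bounds_scalar {lam a n w j b₁ b₂ : ℝ} (hlam : 0 ≤ lam) (ha : 0 ≤ a) (hj : 0 ≤ j)
    (e₁ : n = a ^ 2 * lam + w) (e₂ : 1 = a ^ 2 + j) (h₁ : w ≤ b₁) (h₂ : j ≤ b₂) :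
    (1 - a) ^ 2 * lam + w ≤ b₁ + lam * b₂ ^ 2 ∧ n - lam ≤ b₁ := by
  have ha1 : a ≤ 1 := by nlinarith
  have hj' : 1 - a ≤ j := by nlinarith
  have h3 : (1 - a) ^ 2 ≤ b₂ ^ 2 := pow_le_pow_left₀ (by linarith) (hj'.trans h₂) 2
  have h4 := mul_le_mul_of_nonneg_left h3 hlam
  have h5 := mul_nonneg hlam hj
  constructor
  · linarith
  · have : n - lam = w - lam * j := by rw [e₁]; linear_combination (-lam) * e₂
    linarith

/-- The a posteriori error bounds in terms of the dual norm of the global residual. -/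
theorem error_bounds_of_gap (hJ : IsEnergyEmbedding U J) {κ : ℝ}
    (hκ : ∀ v, κ * ‖J v‖ ^ 2 ≤ ‖v‖ ^ 2) (hκ0 : 0 < κ) {i : ℕ} {lam low up n : ℝ}
    (hlam : lam = orderedEigenvalue U (i + 1))
    (hlow : i ≠ 0 → orderedEigenvalue U i ≤ low ∧ low < n)
    (hup : n < up ∧ up ≤ orderedEigenvalue U (i + 2))
    (hlamn : lam ≤ n) {v x : V} (hv : v = lam • energyInv J v) (hv1 : ‖J v‖ = 1)
    (hx1 : ‖J x‖ = 1) (hxn : ‖x‖ ^ 2 = n) (hsign : 0 ≤ inner ℝ (J v) (J x)) {ρ : ℝ}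
    (hρ : ‖n • energyInv J x - x‖ ^ 2 ≤ ρ) :
    ‖v - x‖ ^ 2 ≤ (gapGamma (i = 0) n low up)⁻¹ * ρ
        + lam * (gapGammaHat (i = 0) n low up)⁻¹ ^ 2 * ρ ^ 2 ∧
      n - lam ≤ (gapGamma (i = 0) n low up)⁻¹ * ρ := by
  have hn0 : 0 < n := by
    have := hκ x
    rw [hx1, hxn] at this
    linarith
  have hv0 : v ≠ 0 := by rintro rfl; simp at hv1
  have hvn : ‖v‖ ^ 2 = lam := by
    rw [← real_inner_self_eq_norm_sq]
    conv_lhs => rw [hv]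
    rw [inner_smul_left, ← hv, inner_energyInv_self, hv1]; simp
  have hlam0 : 0 < lam := by rw [← hvn]; have := norm_pos_iff.2 hv0; positivity
  obtain ⟨⟨hγ, hγ'⟩, hgap⟩ := gap_estimate hJ hκ hκ0 hlam hlow hup hlamn hn0 hv0 hv
  set a : ℝ := inner ℝ (J v) (J x) with ha
  set w : V := x - a • v with hw
  have hVJ : ∀ y, inner ℝ v y = lam * inner ℝ (J v) (J y) := fun y => by
    conv_lhs => rw [hv, inner_smul_left, inner_energyInv]
    simp
  have hJvw : inner ℝ (J v) (J w) = 0 := by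
    rw [hw, map_sub, map_smul, inner_sub_right, inner_smul_right, real_inner_self_eq_norm_sq, hv1]
    ring
  have hvw : inner ℝ v w = 0 := by rw [hVJ, hJvw, mul_zero]
  have hx : x = a • v + w := by rw [hw]; abel
  have e1 : ‖x‖ ^ 2 = a ^ 2 * lam + ‖w‖ ^ 2 := by
    rw [hx, norm_add_sq_real, inner_smul_left, hvw, norm_smul, mul_pow, hvn]; simp
  have e2 : ‖J x‖ ^ 2 = a ^ 2 + ‖J w‖ ^ 2 := by
    rw [hx, map_add, map_smul, norm_add_sq_real, inner_smul_left, hJvw, norm_smul, mul_pow, hv1]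
    simp
  have e3 : ‖v - x‖ ^ 2 = (1 - a) ^ 2 * lam + ‖w‖ ^ 2 := by
    have : v - x = (1 - a) • v - w := by rw [hx]; module
    rw [this, norm_sub_sq_real, inner_smul_left, hvw, norm_smul, mul_pow, hvn]; simp
  -- The operator `n T - 1` preserves the line of `v` and its complement, so the residual of `w` is
  -- an orthogonal component of that of `x`.
  have e4 : ‖n • energyInv J w - w‖ ^ 2 ≤ ‖n • energyInv J x - x‖ ^ 2 := by
    have h0 : n • energyInv J x - x
        = a • (n • energyInv J v - v) + (n • energyInv J w - w) := by
      rw [hx, map_add, map_smul]; module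
    have hTv : energyInv J v = lam⁻¹ • v := by
      conv_rhs => rw [hv, smul_smul, inv_mul_cancel₀ hlam0.ne', one_smul]
    have h1 : inner ℝ (a • (n • energyInv J v - v)) (n • energyInv J w - w) = 0 := by
      have : a • (n • energyInv J v - v) = (a * (n * lam⁻¹ - 1)) • v := by rw [hTv]; module
      rw [this, inner_smul_left, inner_sub_right, inner_smul_right, hvw, ← energyInv_symm, hTv,
        inner_smul_left, hvw]
      simp
    rw [h0, norm_add_sq_real, h1, mul_zero, add_zero]
    exact le_add_of_nonneg_left (sq_nonneg _)
  obtain ⟨hb1, hb2⟩ := hgap w (by rw [real_inner_comm]; exact hvw)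
  have f1 : ‖w‖ ^ 2 ≤ (gapGamma (i = 0) n low up)⁻¹ * ρ := by
    rw [le_inv_mul_iff₀ hγ]; exact hb1.trans (e4.trans hρ)
  have f2 : ‖J w‖ ^ 2 ≤ (gapGammaHat (i = 0) n low up)⁻¹ * ρ := by
    rw [le_inv_mul_iff₀ hγ']; exact hb2.trans (e4.trans hρ)
  rw [hx1, one_pow] at e2
  rw [hxn] at e1
  rw [e3]
  have h := error_bounds_scalar hlam0.le hsign (sq_nonneg ‖J w‖) e1 e2 f1 f2
  rwa [mul_pow, ← mul_assoc] at h

end Gap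

end LCAO

namespace LCAO

/-! ### Gradients -/

section Gradient

variable {d : ℕ}

theorem gradient_eq_symm_fderiv (f : Space d → ℝ) (x : Space d) :
    gradient f x = (InnerProductSpace.toDual ℝ (Space d)).symm (fderiv ℝ f x) := rfl

theorem norm_gradient (f : Space d → ℝ) (x : Space d) : ‖gradient f x‖ = ‖fderiv ℝ f x‖ := by
  rw [gradient_eq_symm_fderiv, LinearIsometryEquiv.norm_map]

theorem gradient_fun_mul {f g : Space d → ℝ} {x : Space d} (hf : DifferentiableAt ℝ f x)
    (hg : DifferentiableAt ℝ g x) :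
    gradient (fun y => f y * g y) x = f x • gradient g x + g x • gradient f x := by
  simp only [gradient_eq_symm_fderiv]
  rw [fderiv_fun_mul hf hg]
  simp

theorem gradient_fun_add {f g : Space d → ℝ} {x : Space d} (hf : DifferentiableAt ℝ f x)
    (hg : DifferentiableAt ℝ g x) :
    gradient (fun y => f y + g y) x = gradient f x + gradient g x := by
  simp only [gradient_eq_symm_fderiv]
  rw [fderiv_fun_add hf hg]
  simp

theorem gradient_fun_const_mul {f : Space d → ℝ} {x : Space d} (c : ℝ)
    (hf : DifferentiableAt ℝ f x) :
    gradient (fun y => c * f y) x = c • gradient f x := by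
  simp only [gradient_eq_symm_fderiv]
  rw [fderiv_const_mul hf]
  simp

theorem gradient_comp_of_hasDerivAt {f : Space d → ℝ} {x : Space d} {φ : ℝ → ℝ} {φ' : ℝ}
    (hφ : HasDerivAt φ φ' (f x)) (hf : DifferentiableAt ℝ f x) :
    gradient (fun y => φ (f y)) x = φ' • gradient f x := by
  simp only [gradient_eq_symm_fderiv]
  have : HasFDerivAt (fun y => φ (f y)) (φ' • fderiv ℝ f x) x :=
    hφ.comp_hasFDerivAt x hf.hasFDerivAt
  rw [this.fderiv]
  simp

theorem continuous_gradient {f : Space d → ℝ} (hf : ContDiff ℝ ∞ f) : Continuous (gradient f) :=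
  (InnerProductSpace.toDual ℝ (Space d)).symm.continuous.comp (hf.continuous_fderiv (by simp))

theorem support_gradient_subset (f : Space d → ℝ) :
    Function.support (gradient f) ⊆ tsupport f := by
  intro x hx
  refine support_fderiv_subset ℝ (f := f) ?_
  rw [Function.mem_support] at hx ⊢
  intro h
  exact hx (by rw [gradient_eq_symm_fderiv, h, map_zero])

theorem hasCompactSupport_gradient {f : Space d → ℝ} (hf : HasCompactSupport f) :
    HasCompactSupport (gradient f) :=
  hf.mono' (support_gradient_subset f)

end Gradient

/-! ### Weak gradients -/

section WeakGrad

variable {d : ℕ}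

theorem integrable_smul_gradient {f θ : Space d → ℝ} (hf : LocallyIntegrable f)
    (hθ : ContDiff ℝ ∞ θ) (hc : HasCompactSupport θ) :
    Integrable fun x => f x • gradient θ x :=
  hf.integrable_smul_right_of_hasCompactSupport (continuous_gradient hθ)
    (hasCompactSupport_gradient hc)

theorem integrable_test_smul {g : Space d → Space d} {θ : Space d → ℝ} (hg : LocallyIntegrable g)
    (hθ : Continuous θ) (hc : HasCompactSupport θ) :
    Integrable fun x => θ x • g x :=
  hg.integrable_smul_left_of_hasCompactSupport hθ hc

theorem locallyIntegrable_of_memLp {E : Type*} [NormedAddCommGroup E] {f : Space d → E}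
    (hf : MemLp f 2 volume) : LocallyIntegrable f :=
  hf.locallyIntegrable (by norm_num)

theorem IsWeakGrad.ae_eq {f : Space d → ℝ} {g g' : Space d → Space d} (h : IsWeakGrad f g)
    (h' : IsWeakGrad f g') (hg : LocallyIntegrable g) (hg' : LocallyIntegrable g') :
    g =ᵐ[volume] g' :=
  ae_eq_of_integral_contDiff_smul_eq hg hg' fun θ hθ hc => by
    rw [← neg_inj, ← h θ hθ hc, ← h' θ hθ hc]

theorem IsWeakGrad.congr {f f' : Space d → ℝ} {g g' : Space d → Space d} (h : IsWeakGrad f g)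
    (hf : f =ᵐ[volume] f') (hg : g =ᵐ[volume] g') : IsWeakGrad f' g' := fun θ hθ hc => by
  have h1 : ∫ x, f' x • gradient θ x = ∫ x, f x • gradient θ x :=
    integral_congr_ae (by filter_upwards [hf] with x hx; rw [hx])
  have h2 : ∫ x, θ x • g' x = ∫ x, θ x • g x :=
    integral_congr_ae (by filter_upwards [hg] with x hx; rw [hx])
  rw [h1, h2, h θ hθ hc]

theorem IsWeakGrad.add {f f' : Space d → ℝ} {g g' : Space d → Space d} (h : IsWeakGrad f g)
    (h' : IsWeakGrad f' g') (hf : LocallyIntegrable f) (hf' : LocallyIntegrable f')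
    (hg : LocallyIntegrable g) (hg' : LocallyIntegrable g') :
    IsWeakGrad (fun x => f x + f' x) (fun x => g x + g' x) := fun θ hθ hc => by
  simp only [add_smul, smul_add]
  rw [integral_add (integrable_smul_gradient hf hθ hc) (integrable_smul_gradient hf' hθ hc),
    integral_add (integrable_test_smul hg hθ.continuous hc)
      (integrable_test_smul hg' hθ.continuous hc), h θ hθ hc, h' θ hθ hc, neg_add]

theorem IsWeakGrad.const_smul {f : Space d → ℝ} {g : Space d → Space d} (h : IsWeakGrad f g)
    (c : ℝ) : IsWeakGrad (fun x => c * f x) (fun x => c • g x) := fun θ hθ hc => by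
  simp only [mul_smul, smul_comm _ c]
  rw [integral_smul, integral_smul, h θ hθ hc, smul_neg]

/-- The product rule for a locally integrable weakly differentiable function and a smooth one. -/
theorem IsWeakGrad.mul {f : Space d → ℝ} {g : Space d → Space d} (h : IsWeakGrad f g)
    (hf : LocallyIntegrable f) (hg : LocallyIntegrable g) {η : Space d → ℝ}
    (hη : ContDiff ℝ ∞ η) :
    IsWeakGrad (fun x => η x * f x) (fun x => η x • g x + f x • gradient η x) := fun θ hθ hc => by
  have hηθ : ContDiff ℝ ∞ fun x => η x * θ x := hη.mul hθ
  have hηc : HasCompactSupport fun x => η x * θ x := hc.mul_left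
  have hgr : ∀ x, gradient (fun y => η y * θ y) x = η x • gradient θ x + θ x • gradient η x :=
    fun x => gradient_fun_mul (hη.differentiable (by simp) x) (hθ.differentiable (by simp) x)
  have key := h _ hηθ hηc
  have i1 : Integrable fun x => f x • gradient (fun y => η y * θ y) x :=
    integrable_smul_gradient hf hηθ hηc
  have i2 : Integrable fun x => (θ x * f x) • gradient η x := by
    have : Integrable fun x => f x • (θ x • gradient η x) :=
      hf.integrable_smul_right_of_hasCompactSupport (hθ.continuous.smul (continuous_gradient hη))
        hc.smul_right
    refine this.congr (Filter.Eventually.of_forall fun x => ?_)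
    simp only [smul_smul, mul_comm]
  have i3 : Integrable fun x => (η x * θ x) • g x := integrable_test_smul hg hηθ.continuous hηc
  have e1 : ∀ x, (η x * f x) • gradient θ x
      = f x • gradient (fun y => η y * θ y) x - (θ x * f x) • gradient η x := fun x => by
    rw [hgr]; module
  have e2 : ∀ x, θ x • (η x • g x + f x • gradient η x)
      = (η x * θ x) • g x + (θ x * f x) • gradient η x := fun x => by module
  simp only [e1, e2]
  rw [integral_sub i1 i2, integral_add i3 i2, key]
  abel

theorem integral_gradient_eq_zero {θ : Space d → ℝ} (hθ : ContDiff ℝ ∞ θ)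
    (hc : HasCompactSupport θ) : ∫ x, gradient θ x = 0 := by
  have hi : Integrable (gradient θ) :=
    (continuous_gradient hθ).integrable_of_hasCompactSupport (hasCompactSupport_gradient hc)
  refine ext_inner_left ℝ fun v => ?_
  rw [inner_zero_right, ← integral_inner hi v]
  have h1 : ∀ x, inner ℝ v (gradient θ x) = (1 : ℝ) * fderiv ℝ θ x v := fun x => by
    rw [inner_gradient_right]; simp
  simp only [h1]
  have hf : Integrable fun x => fderiv ℝ θ x v := by
    refine (hi.const_inner v).congr (Filter.Eventually.of_forall fun x => ?_)
    simp only [h1, one_mul]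
  rw [integral_mul_fderiv_eq_neg_fderiv_mul_of_integrable (f := fun _ : Space d => (1 : ℝ))]
  · simp
  · simp
  · simpa using hf
  · simpa using hθ.continuous.integrable_of_hasCompactSupport hc
  · intro x _; fun_prop
  · intro x _; exact hθ.differentiable (by simp) x

/-- The constant `1` has weak gradient `0`, since `∫ ∇θ = 0`; the product rule with the smooth
factor `η` does the rest. -/
theorem isWeakGrad_gradient {η : Space d → ℝ} (hη : ContDiff ℝ ∞ η) :
    IsWeakGrad η (gradient η) := by
  have h1 : IsWeakGrad (fun _ : Space d => (1 : ℝ)) fun _ => 0 := fun θ hθ hc => by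
    simp [integral_gradient_eq_zero hθ hc]
  have := h1.mul (continuous_const.locallyIntegrable) (continuous_const.locallyIntegrable) hη
  simpa using this

theorem memLp_of_test {E : Type*} [NormedAddCommGroup E] {f : Space d → E} (hf : Continuous f)
    (hc : HasCompactSupport f) (p : ℝ≥0∞) : MemLp f p volume :=
  hf.memLp_of_hasCompactSupport hc

/-! ### The class `H¹` -/

theorem MemH1.memLp_weakGrad {f : Space d → ℝ} (h : MemH1 f) : MemLp (weakGrad f) 2 volume := by
  rw [weakGrad, dif_pos h]
  exact h.2.choose_spec.1

theorem MemH1.isWeakGrad {f : Space d → ℝ} (h : MemH1 f) : IsWeakGrad f (weakGrad f) := by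
  rw [weakGrad, dif_pos h]
  exact h.2.choose_spec.2

theorem IsWeakGrad.memH1 {f : Space d → ℝ} {g : Space d → Space d} (h : IsWeakGrad f g)
    (hf : MemLp f 2 volume) (hg : MemLp g 2 volume) : MemH1 f := ⟨hf, g, hg, h⟩

theorem IsWeakGrad.weakGrad_ae_eq {f : Space d → ℝ} {g : Space d → Space d} (h : IsWeakGrad f g)
    (hf : MemLp f 2 volume) (hg : MemLp g 2 volume) : weakGrad f =ᵐ[volume] g :=
  (h.memH1 hf hg).isWeakGrad.ae_eq h
    (locallyIntegrable_of_memLp (h.memH1 hf hg).memLp_weakGrad) (locallyIntegrable_of_memLp hg)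

theorem MemH1.congr {f f' : Space d → ℝ} (h : MemH1 f) (hf : f =ᵐ[volume] f') : MemH1 f' :=
  (h.isWeakGrad.congr hf Filter.EventuallyEq.rfl).memH1 (h.1.ae_eq hf) h.memLp_weakGrad

theorem weakGrad_congr {f f' : Space d → ℝ} (hf : f =ᵐ[volume] f') :
    weakGrad f =ᵐ[volume] weakGrad f' := by
  by_cases h : MemH1 f
  · have h' := h.congr hf
    exact (h'.isWeakGrad.congr hf.symm Filter.EventuallyEq.rfl).weakGrad_ae_eq h.1 h'.memLp_weakGrad
  · have h' : ¬ MemH1 f' := fun h' => h (h'.congr hf.symm)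
    rw [weakGrad, weakGrad, dif_neg h, dif_neg h']

theorem memH1_test {θ : Space d → ℝ} (hθ : ContDiff ℝ ∞ θ) (hc : HasCompactSupport θ) : MemH1 θ :=
  (isWeakGrad_gradient hθ).memH1 (memLp_of_test hθ.continuous hc 2)
    (memLp_of_test (continuous_gradient hθ) (hasCompactSupport_gradient hc) 2)

theorem weakGrad_test {θ : Space d → ℝ} (hθ : ContDiff ℝ ∞ θ) (hc : HasCompactSupport θ) :
    weakGrad θ =ᵐ[volume] gradient θ :=
  (isWeakGrad_gradient hθ).weakGrad_ae_eq (memLp_of_test hθ.continuous hc 2)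
    (memLp_of_test (continuous_gradient hθ) (hasCompactSupport_gradient hc) 2)

end WeakGrad

end LCAO

namespace LCAO

/-! ### Mollification -/

section Mollify

variable {d : ℕ} {E : Type*} [NormedAddCommGroup E]

theorem tendsto_eLpNorm_two_of_dominated {α : Type*} [MeasurableSpace α] {μ : Measure α}
    {F : ℕ → α → E} {b : α → ℝ} (hF : ∀ n, AEStronglyMeasurable (F n) μ) (hb : MemLp b 2 μ)
    (hbd : ∀ n, ∀ᵐ x ∂μ, ‖F n x‖ ≤ b x)
    (hlim : ∀ᵐ x ∂μ, Filter.Tendsto (fun n => F n x) Filter.atTop (nhds 0)) :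
    Filter.Tendsto (fun n => eLpNorm (F n) 2 μ) Filter.atTop (nhds 0) := by
  have h2 : ∀ g : α → E, eLpNorm g 2 μ = (∫⁻ x, ‖g x‖ₑ ^ (2 : ℝ) ∂μ) ^ (1 / 2 : ℝ) := fun g => by
    rw [eLpNorm_eq_lintegral_rpow_enorm_toReal (by norm_num) (by norm_num)]; simp
  have key : Filter.Tendsto (fun n => ∫⁻ x, ‖F n x‖ₑ ^ (2 : ℝ) ∂μ) Filter.atTop (nhds 0) := by
    have h0 : ∫⁻ _ : α, (0 : ℝ≥0∞) ∂μ = 0 := by simp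
    rw [← h0]
    refine tendsto_lintegral_of_dominated_convergence' (fun x => ‖b x‖ₑ ^ (2 : ℝ))
      (fun n => (hF n).enorm.pow_const _) (fun n => ?_) ?_ ?_
    · filter_upwards [hbd n] with x hx
      gcongr
      exact enorm_le_iff_norm_le.2 (hx.trans (le_abs_self _))
    · have := lintegral_rpow_enorm_lt_top_of_eLpNorm_lt_top (by norm_num) (by norm_num) hb.2
      simpa using this.ne
    · filter_upwards [hlim] with x hx
      have h1 := ((ENNReal.continuous_rpow_const (y := 2)).tendsto _).comp hx.enorm
      simpa [Function.comp_def] using h1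
  simp only [h2]
  have := ((ENNReal.continuous_rpow_const (y := (1 / 2 : ℝ))).tendsto 0).comp key
  simpa [Function.comp_def] using this

/-- Translations are continuous in `L²`. -/
theorem exists_translation_lt {f : Space d → E} (hf : MemLp f 2 volume) {ε : ℝ≥0∞} (hε : 0 < ε) :
    ∃ δ : ℝ, 0 < δ ∧ ∀ y, ‖y‖ < δ → eLpNorm (fun x => f (x - y) - f x) 2 volume < ε := by
  have : Fact ((2 : ℝ≥0∞) ≠ ⊤) := ⟨by norm_num⟩
  set F : Lp E 2 (volume : Measure (Space d)) := hf.toLp f with hF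
  have hc : Continuous fun y : Space d => (DomAddAct.mk (-y)) +ᵥ F :=
    Continuous.vadd (DomAddAct.continuous_mk.comp continuous_neg) continuous_const
  have h0 : (DomAddAct.mk (-(0 : Space d))) +ᵥ F = F := by
    rw [neg_zero]; exact zero_vadd _ F
  have ht := hc.tendsto 0
  rw [h0] at ht
  have hev := ht.eventually (Metric.eball_mem_nhds F hε)
  obtain ⟨δ, hδ, hδ'⟩ := Metric.eventually_nhds_iff.1 hev
  refine ⟨δ, hδ, fun y hy => ?_⟩
  have h1 : edist ((DomAddAct.mk (-y)) +ᵥ F) F < ε := hδ' (by simpa using hy)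
  have h2 : (DomAddAct.mk (-y)) +ᵥ F = (hf.comp_measurePreserving
      (measurePreserving_vadd (-y) volume)).toLp _ := DomAddAct.mk_vadd_toLp (-y) hf
  rw [h2, hF, Lp.edist_toLp_toLp] at h1
  refine lt_of_eq_of_lt (congrArg (fun g => eLpNorm g 2 volume) ?_) h1
  ext x
  simp [sub_eq_neg_add]

variable [NormedSpace ℝ E]

/-- Convolution with a kernel `ρ`. -/
noncomputable def mollify (ρ : Space d → ℝ) (f : Space d → E) (x : Space d) : E :=
  ∫ t, ρ (x - t) • f t

theorem mollify_eq (ρ : Space d → ℝ) (f : Space d → E) (x : Space d) :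
    mollify ρ f x = ∫ t, ρ t • f (x - t) := by
  rw [mollify, ← integral_sub_left_eq_self _ volume x]
  simp

theorem integrable_kernel_smul {ρ : Space d → ℝ} (hρ : Continuous ρ) (hc : HasCompactSupport ρ)
    {f : Space d → E} (hf : LocallyIntegrable f) (x : Space d) :
    Integrable fun t => ρ (x - t) • f t :=
  hf.integrable_smul_left_of_hasCompactSupport (by fun_prop)
    (hc.comp_homeomorph (Homeomorph.subLeft x))

/-- The kernel is the density of a probability measure, so the error at `x` is an average of `f (x -
y) - f x`. Jensen's inequality and Tonelli's theorem reduce its `L²` norm to that of single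
translates. -/
theorem eLpNorm_mollify_sub_le [CompleteSpace E] {ρ : Space d → ℝ} (hρ : Continuous ρ) (hρ0 : ∀ x, 0 ≤ ρ x)
    (hc : HasCompactSupport ρ) (hρ1 : ∫ x, ρ x = 1) {f : Space d → E} (hf : MemLp f 2 volume)
    (hfm : StronglyMeasurable f) {η : ℝ≥0∞}
    (hη : ∀ y, ρ y ≠ 0 → eLpNorm (fun x => f (x - y) - f x) 2 volume ≤ η) :
    eLpNorm (fun x => mollify ρ f x - f x) 2 volume ≤ η := by
  set ν : Measure (Space d) := volume.withDensity fun y => ENNReal.ofReal (ρ y) with hν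
  have hρi : Integrable ρ := hρ.integrable_of_hasCompactSupport hc
  have hνp : IsProbabilityMeasure ν := ⟨by
    rw [hν, withDensity_apply _ MeasurableSet.univ, Measure.restrict_univ,
      ← ofReal_integral_eq_lintegral_ofReal hρi (Filter.Eventually.of_forall hρ0), hρ1]
    simp⟩
  have hm2 : StronglyMeasurable fun z : Space d × Space d => f (z.1 - z.2) - f z.1 :=
    (hfm.comp_measurable (by fun_prop)).sub (hfm.comp_measurable (by fun_prop))
  have hpt : ∀ x, ‖mollify ρ f x - f x‖ₑ ^ 2 ≤ ∫⁻ y, ‖f (x - y) - f x‖ₑ ^ 2 ∂ν := fun x => by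
    have hi : Integrable fun t => ρ t • f (x - t) := by
      have := (integrable_kernel_smul hρ hc (locallyIntegrable_of_memLp hf) x).comp_sub_left x
      simpa using this
    have h1 : mollify ρ f x - f x = ∫ y, ρ y • (f (x - y) - f x) := by
      simp only [smul_sub]
      rw [integral_sub hi (hρi.smul_const _), integral_smul_const, hρ1, one_smul, mollify_eq]
    have hm1 : StronglyMeasurable fun y => f (x - y) - f x :=
      hm2.comp_measurable (measurable_const.prodMk measurable_id)
    have h2 : ‖mollify ρ f x - f x‖ₑ ≤ ∫⁻ y, ‖f (x - y) - f x‖ₑ ∂ν := by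
      rw [h1, hν, lintegral_withDensity_eq_lintegral_mul _ (by fun_prop) hm1.enorm]
      refine (enorm_integral_le_lintegral_enorm _).trans (lintegral_mono fun y => ?_)
      rw [enorm_smul, Pi.mul_apply, Real.enorm_eq_ofReal (hρ0 y)]
    have h3 := eLpNorm_le_eLpNorm_of_exponent_le (p := 1) (q := 2) (by norm_num)
      (hm1.aestronglyMeasurable (μ := ν))
    rw [eLpNorm_one_eq_lintegral_enorm] at h3
    calc ‖mollify ρ f x - f x‖ₑ ^ 2 ≤ eLpNorm (fun y => f (x - y) - f x) 2 ν ^ 2 := by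
          gcongr; exact h2.trans h3
      _ = _ := by
          have := eLpNorm_nnreal_pow_eq_lintegral (p := 2) (μ := ν)
            (f := fun y => f (x - y) - f x) (by norm_num)
          simpa using this
  have hsq : ∀ g : Space d → E, eLpNorm g 2 volume ^ 2 = ∫⁻ x, ‖g x‖ₑ ^ 2 := fun g => by
    have := eLpNorm_nnreal_pow_eq_lintegral (p := 2) (μ := (volume : Measure (Space d)))
      (f := g) (by norm_num)
    simpa using this
  refine (ENNReal.pow_le_pow_left_iff (two_ne_zero)).1 ?_
  rw [hsq]
  calc ∫⁻ x, ‖mollify ρ f x - f x‖ₑ ^ 2 ≤ ∫⁻ x, ∫⁻ y, ‖f (x - y) - f x‖ₑ ^ 2 ∂ν :=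
        lintegral_mono hpt
    _ = ∫⁻ y, (∫⁻ x, ‖f (x - y) - f x‖ₑ ^ 2) ∂ν := by
        exact lintegral_lintegral_swap (hm2.enorm.pow_const 2).aemeasurable
    _ ≤ ∫⁻ _, η ^ 2 ∂ν := by
        refine lintegral_mono_ae ?_
        have hae : ∀ᵐ y ∂ν, ENNReal.ofReal (ρ y) ≠ 0 := by
          rw [hν, ae_withDensity_iff (by fun_prop)]
          exact Filter.Eventually.of_forall fun _ h => h
        filter_upwards [hae] with y hy
        rw [← hsq]
        gcongr
        exact hη y fun h => hy (by simp [h])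
    _ = η ^ 2 := by simp

theorem contDiff_mollify {ρ : Space d → ℝ} (hρ : ContDiff ℝ ∞ ρ) (hc : HasCompactSupport ρ)
    {f : Space d → ℝ} (hf : LocallyIntegrable f) : ContDiff ℝ ∞ (mollify ρ f) := by
  have h := hc.contDiff_convolution_right (ContinuousLinearMap.lsmul ℝ ℝ) hf
    (n := ⊤) hρ
  convert h using 1
  ext x
  simp [mollify, convolution_def, mul_comm]

/-- The derivative falls on the kernel, and `t ↦ ρ (x - t)` is an admissible test function for the
weak gradient. -/
theorem gradient_mollify {ρ : Space d → ℝ} (hρ : ContDiff ℝ ∞ ρ) (hc : HasCompactSupport ρ)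
    {f : Space d → ℝ} (hf : LocallyIntegrable f) {g : Space d → Space d} (hg : IsWeakGrad f g) :
    gradient (mollify ρ f) = mollify ρ g := by
  ext1 x
  have h := hc.hasFDerivAt_convolution_right (ContinuousLinearMap.lsmul ℝ ℝ) hf
    (hρ.of_le (by simp)) x
  have h1 : mollify ρ f = MeasureTheory.convolution f ρ (ContinuousLinearMap.lsmul ℝ ℝ) volume := by
    ext x
    simp [mollify, convolution_def, mul_comm]
  have h2 : gradient (mollify ρ f) x = ∫ t, f t • gradient ρ (x - t) := by
    rw [gradient_eq_symm_fderiv, h1, h.fderiv, convolution_def]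
    rw [← LinearIsometryEquiv.coe_toContinuousLinearEquiv,
      ← ContinuousLinearEquiv.integral_comp_comm]
    refine integral_congr_ae (Filter.Eventually.of_forall fun t => ?_)
    simp only [gradient_eq_symm_fderiv]
    rw [← map_smul]
    rfl
  have h3 : ∀ t, gradient (fun t => ρ (x - t)) t = - gradient ρ (x - t) := fun t => by
    simp only [gradient_eq_symm_fderiv]
    have := ((hρ.differentiable (by simp) (x - t)).hasFDerivAt.comp t
      ((hasFDerivAt_const x t).sub (hasFDerivAt_id t))).fderiv
    rw [Function.comp_def] at this
    rw [this, ← map_neg]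
    congr 1
    ext v
    simp
  have h4 := hg (fun t => ρ (x - t)) (by fun_prop) (hc.comp_homeomorph (Homeomorph.subLeft x))
  simp only [h3, smul_neg, integral_neg, neg_inj] at h4
  rw [h2, h4, mollify]

end Mollify

/-! ### Approximation by test functions -/

section Density

variable {d : ℕ}

theorem MemH10.of_tendsto {Ω : Set (Space d)} {u : Space d → ℝ} (hu : MemH1 u)
    {v : ℕ → Space d → ℝ} (hv : ∀ n, MemH10 Ω (v n))
    (h1 : Filter.Tendsto (fun n => eLpNorm (fun x => u x - v n x) 2 volume) Filter.atTop (nhds 0))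
    (h2 : Filter.Tendsto (fun n => eLpNorm (fun x => weakGrad u x - weakGrad (v n) x) 2 volume)
      Filter.atTop (nhds 0)) : MemH10 Ω u := by
  refine ⟨hu, fun ε hε => ?_⟩
  have hε2 : 0 < ε / 2 := ENNReal.half_pos hε.ne'
  obtain ⟨n, hn1, hn2⟩ := ((h1.eventually_lt_const hε2).and (h2.eventually_lt_const hε2)).exists
  obtain ⟨θ, hθ, hc, hs, hd1, hd2⟩ := (hv n).2 (ε / 2) hε2
  refine ⟨θ, hθ, hc, hs, ?_, ?_⟩
  · calc eLpNorm (fun x => u x - θ x) 2 volume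
        = eLpNorm ((fun x => u x - v n x) + fun x => v n x - θ x) 2 volume := by
          congr 1; ext x; simp
      _ ≤ _ := eLpNorm_add_le (hu.1.sub (hv n).1.1).1
          ((hv n).1.1.sub (memLp_of_test hθ.continuous hc 2)).1 (by norm_num)
      _ < ε / 2 + ε / 2 := ENNReal.add_lt_add hn1 hd1
      _ = ε := ENNReal.add_halves ε
  · calc eLpNorm (fun x => weakGrad u x - gradient θ x) 2 volume
        = eLpNorm ((fun x => weakGrad u x - weakGrad (v n) x)
            + fun x => weakGrad (v n) x - gradient θ x) 2 volume := by
          congr 1; ext1 x; simp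
      _ ≤ _ := eLpNorm_add_le (hu.memLp_weakGrad.sub (hv n).1.memLp_weakGrad).1
          ((hv n).1.memLp_weakGrad.sub (memLp_of_test (continuous_gradient hθ)
            (hasCompactSupport_gradient hc) 2)).1 (by norm_num)
      _ < ε / 2 + ε / 2 := ENNReal.add_lt_add hn2 hd2
      _ = ε := ENNReal.add_halves ε

theorem MemH10.congr {Ω : Set (Space d)} {u v : Space d → ℝ} (hu : MemH10 Ω u)
    (h : u =ᵐ[volume] v) : MemH10 Ω v := by
  refine ⟨hu.1.congr h, fun ε hε => ?_⟩
  obtain ⟨θ, hθ, hc, hs, hd1, hd2⟩ := hu.2 ε hε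
  refine ⟨θ, hθ, hc, hs, ?_, ?_⟩
  · rwa [eLpNorm_congr_ae (g := fun x => u x - θ x)]
    filter_upwards [h] with x hx; rw [hx]
  · rwa [eLpNorm_congr_ae (g := fun x => weakGrad u x - gradient θ x)]
    filter_upwards [weakGrad_congr h] with x hx; rw [hx]

/-- A function of `H¹` that vanishes outside a compact subset of an open set `Ω` lies in
`H¹₀(Ω)`. -/
theorem memH10_of_compact {Ω K : Set (Space d)} (hΩ : IsOpen Ω) (hK : IsCompact K) (hKΩ : K ⊆ Ω)
    {u : Space d → ℝ} (hu : MemH1 u) (huK : ∀ x ∉ K, u x = 0) : MemH10 Ω u := by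
  -- A measurable representative that vanishes everywhere off `K`, so that its mollification is
  -- supported near `K`.
  set u' : Space d → ℝ := K.indicator (hu.1.1.mk u) with hu'def
  have huu' : u =ᵐ[volume] u' := by
    filter_upwards [hu.1.1.ae_eq_mk] with x hx
    by_cases hxK : x ∈ K
    · rw [hu'def, Set.indicator_of_mem hxK, hx]
    · rw [hu'def, Set.indicator_of_notMem hxK, huK x hxK]
  have hm : StronglyMeasurable u' := hu.1.1.stronglyMeasurable_mk.indicator hK.measurableSet
  have hu1 : MemLp u' 2 volume := hu.1.ae_eq huu'
  have hgm := hu.memLp_weakGrad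
  set g : Space d → Space d := hgm.1.mk _ with hgdef
  have hgae : weakGrad u =ᵐ[volume] g := hgm.1.ae_eq_mk
  have hg2 : MemLp g 2 volume := hgm.ae_eq hgae
  have hwg : IsWeakGrad u' g := hu.isWeakGrad.congr huu' hgae
  refine ⟨hu, fun ε hε => ?_⟩
  obtain ⟨η, hη0, hηε⟩ := exists_between hε
  obtain ⟨δ₁, hδ₁, hd₁⟩ := hK.exists_cthickening_subset_open hΩ hKΩ
  obtain ⟨δ₂, hδ₂, hd₂⟩ := exists_translation_lt hu1 hη0
  obtain ⟨δ₃, hδ₃, hd₃⟩ := exists_translation_lt hg2 hη0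
  -- The three radii keep the support inside `Ω` and control the `L²` errors of the function and of
  -- its gradient.
  set δ := min δ₁ (min δ₂ δ₃) with hδdef
  have hδ : 0 < δ := lt_min hδ₁ (lt_min hδ₂ hδ₃)
  let b : ContDiffBump (0 : Space d) := ⟨δ / 2, δ, by positivity, by linarith⟩
  set ρ : Space d → ℝ := b.normed volume with hρdef
  have hρ : ContDiff ℝ ∞ ρ := b.contDiff_normed
  have hρc : HasCompactSupport ρ := b.hasCompactSupport_normed
  have hρ0 : ∀ x, 0 ≤ ρ x := b.nonneg_normed
  have hρ1 : ∫ x, ρ x = 1 := b.integral_normed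
  have hρs : ∀ y, ρ y ≠ 0 → ‖y‖ < δ := fun y hy => by
    have : y ∈ Function.support ρ := hy
    rw [hρdef, b.support_normed_eq] at this
    simpa using this
  have hsupp : tsupport (mollify ρ u') ⊆ Metric.cthickening δ₁ K := by
    refine closure_minimal (fun x hx => ?_) Metric.isClosed_cthickening
    by_contra hxK
    refine hx ?_
    rw [mollify]
    refine integral_eq_zero_of_ae (Filter.Eventually.of_forall fun t => ?_)
    by_cases ht : t ∈ K
    · have : ρ (x - t) = 0 := by
        by_contra h0
        refine hxK (Metric.mem_cthickening_of_dist_le x t δ₁ K ht ?_)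
        rw [dist_eq_norm]
        exact (hρs _ h0).le.trans (min_le_left _ _)
      simp [this]
    · simp [hu'def, ht]
  have hcomp : HasCompactSupport (mollify ρ u') :=
    (hK.cthickening).of_isClosed_subset (isClosed_tsupport _) hsupp
  have hu'l := locallyIntegrable_of_memLp hu1
  refine ⟨mollify ρ u', contDiff_mollify hρ hρc hu'l, hcomp, hsupp.trans hd₁, ?_, ?_⟩
  · refine lt_of_le_of_lt ?_ hηε
    refine le_trans (le_of_eq ?_) (eLpNorm_mollify_sub_le hρ.continuous hρ0 hρc hρ1 hu1 hm
      (fun y hy => (hd₂ y ((hρs y hy).trans_le ?_)).le))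
    · rw [← eLpNorm_neg]
      refine eLpNorm_congr_ae ?_
      filter_upwards [huu'] with x hx
      simp [hx]
    · exact (min_le_right _ _).trans (min_le_left _ _)
  · refine lt_of_le_of_lt ?_ hηε
    refine le_trans (le_of_eq ?_) (eLpNorm_mollify_sub_le hρ.continuous hρ0 hρc hρ1 hg2
      hgm.1.stronglyMeasurable_mk (fun y hy => (hd₃ y ((hρs y hy).trans_le ?_)).le))
    · rw [← eLpNorm_neg, gradient_mollify hρ hρc hu'l hwg]
      refine eLpNorm_congr_ae ?_
      filter_upwards [hgae] with x hx
      simp [hx, hgdef]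
    · exact (min_le_right _ _).trans (min_le_right _ _)

end Density

end LCAO

namespace LCAO

/-! ### Cut-offs, density of test functions, and multiplication by square roots. -/

section SqrtMul

variable {d : ℕ}

theorem MemH1.mul_smooth {u η : Space d → ℝ} (hu : MemH1 u) (hη : ContDiff ℝ ∞ η)
    (h1 : MemLp (fun x => η x * u x) 2 volume)
    (h2 : MemLp (fun x => η x • weakGrad u x + u x • gradient η x) 2 volume) :
    MemH1 (fun x => η x * u x) ∧ weakGrad (fun x => η x * u x) =ᵐ[volume]
      fun x => η x • weakGrad u x + u x • gradient η x := by
  have h := hu.isWeakGrad.mul (locallyIntegrable_of_memLp hu.1)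
    (locallyIntegrable_of_memLp hu.memLp_weakGrad) hη
  exact ⟨h.memH1 h1 h2, h.weakGrad_ae_eq h1 h2⟩

theorem exists_bound_of_test {E : Type*} [NormedAddCommGroup E] {f : Space d → E}
    (hf : Continuous f) (hc : HasCompactSupport f) : ∃ M : ℝ, 0 ≤ M ∧ ∀ x, ‖f x‖ ≤ M := by
  obtain ⟨M, hM⟩ := hc.exists_bound_of_continuous hf
  exact ⟨M, (norm_nonneg _).trans (hM 0), hM⟩

/-- `C_c^∞` is dense in `H¹`. -/
theorem memH10_univ {u : Space d → ℝ} (hu : MemH1 u) : MemH10 Set.univ u := by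
  let b : ContDiffBump (0 : Space d) := ⟨1, 2, by norm_num, by norm_num⟩
  have hb : ContDiff ℝ ∞ b := b.contDiff
  obtain ⟨M, hM0, hM⟩ := exists_bound_of_test (continuous_gradient hb)
    (hasCompactSupport_gradient b.hasCompactSupport)
  set a : ℕ → ℝ := fun n => 1 / ((n : ℝ) + 1) with ha
  have ha0 : ∀ n, 0 < a n := fun n => by positivity
  have ha1 : ∀ n, a n ≤ 1 := fun n => by
    rw [ha]; exact (div_le_one (by positivity)).2 (by linarith [n.cast_nonneg (α := ℝ)])
  have hat : Filter.Tendsto a Filter.atTop (nhds 0) := tendsto_one_div_add_atTop_nhds_zero_nat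
  -- Cut-offs at distance of order `n + 1`, whose gradients are of order `1 / (n + 1)`.
  set ζ : ℕ → Space d → ℝ := fun n x => b (a n • x) with hζ
  have hζs : ∀ n, ContDiff ℝ ∞ (ζ n) := fun n => hb.comp (by fun_prop)
  have hζg : ∀ n x, gradient (ζ n) x = a n • gradient b (a n • x) := fun n x => by
    simp only [gradient_eq_symm_fderiv]
    have := ((hb.differentiable (by simp) (a n • x)).hasFDerivAt.comp x
      ((hasFDerivAt_id x).const_smul (a n))).fderiv
    rw [Function.comp_def] at this
    have h2 : fderiv ℝ (ζ n) x = a n • fderiv ℝ b (a n • x) := by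
      refine Eq.trans this ?_
      ext v
      simp
    rw [h2]
    simp
  have hζ1 : ∀ n x, ‖ζ n x‖ ≤ 1 := fun n x => by
    rw [Real.norm_of_nonneg (b.nonneg)]; exact b.le_one
  have hζg1 : ∀ n x, ‖gradient (ζ n) x‖ ≤ a n * M := fun n x => by
    rw [hζg, norm_smul, Real.norm_of_nonneg (ha0 n).le]
    exact mul_le_mul_of_nonneg_left (hM _) (ha0 n).le
  have hgm := hu.memLp_weakGrad
  have hl1 : ∀ n, MemLp (fun x => ζ n x * u x) 2 volume := fun n =>
    hu.1.of_le ((hζs n).continuous.aestronglyMeasurable.mul hu.1.1)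
      (Filter.Eventually.of_forall fun x => by
        rw [norm_mul]; exact mul_le_of_le_one_left (norm_nonneg _) (hζ1 n x))
  have hl2 : ∀ n, MemLp (fun x => ζ n x • weakGrad u x + u x • gradient (ζ n) x) 2 volume :=
    fun n => by
    refine MemLp.add ?_ ?_
    · refine hgm.of_le ((hζs n).continuous.aestronglyMeasurable.smul hgm.1)
        (Filter.Eventually.of_forall fun x => ?_)
      rw [norm_smul]; exact mul_le_of_le_one_left (norm_nonneg _) (hζ1 n x)
    · refine (hu.1.const_mul M).of_le
        (hu.1.1.smul (continuous_gradient (hζs n)).aestronglyMeasurable)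
        (Filter.Eventually.of_forall fun x => ?_)
      rw [norm_smul, norm_mul, Real.norm_of_nonneg hM0, mul_comm]
      gcongr
      exact (hζg1 n x).trans (mul_le_of_le_one_left hM0 (ha1 n))
  have hmul := fun n => hu.mul_smooth (hζs n) (hl1 n) (hl2 n)
  have hev : ∀ x : Space d, ∀ᶠ n in Filter.atTop, ζ n x = 1 := fun x => by
    have h1 : Filter.Tendsto (fun n => a n * ‖x‖) Filter.atTop (nhds (0 * ‖x‖)) :=
      hat.mul_const _
    rw [zero_mul] at h1
    filter_upwards [h1.eventually_lt_const one_pos] with n hn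
    refine b.one_of_mem_closedBall ?_
    rw [mem_closedBall_zero_iff, norm_smul, Real.norm_of_nonneg (ha0 n).le]
    exact hn.le
  refine MemH10.of_tendsto hu (v := fun n x => ζ n x * u x) (fun n => ?_) ?_ ?_
  · refine memH10_of_compact isOpen_univ
      (isCompact_closedBall (0 : Space d) (2 / a n)) (Set.subset_univ _) (hmul n).1 fun x hx => ?_
    have : ζ n x = 0 := by
      refine b.zero_of_le_dist ?_
      rw [dist_zero_right, norm_smul, Real.norm_of_nonneg (ha0 n).le]
      rw [mem_closedBall_zero_iff, not_le, div_lt_iff₀ (ha0 n)] at hx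
      rw [mul_comm]
      exact hx.le
    rw [this, zero_mul]
  · refine tendsto_eLpNorm_two_of_dominated (fun n => (hu.1.sub (hl1 n)).1) (hu.1.norm)
      (b := fun x => ‖u x‖) (fun n => Filter.Eventually.of_forall fun x => ?_)
      (Filter.Eventually.of_forall fun x => ?_)
    · have : u x - ζ n x * u x = (1 - ζ n x) * u x := by ring
      rw [this, norm_mul]
      refine mul_le_of_le_one_left (norm_nonneg _) ?_
      rw [Real.norm_of_nonneg (sub_nonneg.2 b.le_one)]
      linarith [b.nonneg (x := a n • x)]
    · refine tendsto_const_nhds.congr' ?_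
      filter_upwards [hev x] with n hn
      simp [hn]
  · have hb2 : MemLp (fun x => 2 * ‖weakGrad u x‖ + M * ‖u x‖) 2 volume :=
      (hgm.norm.const_mul 2).add (hu.1.norm.const_mul M)
    refine tendsto_eLpNorm_two_of_dominated (fun n => (hgm.sub (hmul n).1.memLp_weakGrad).1) hb2
      (fun n => ?_) ?_
    · filter_upwards [(hmul n).2] with x hx
      rw [hx]
      calc ‖weakGrad u x - (ζ n x • weakGrad u x + u x • gradient (ζ n) x)‖
          ≤ ‖weakGrad u x‖ + (‖ζ n x • weakGrad u x‖ + ‖u x • gradient (ζ n) x‖) :=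
            (norm_sub_le _ _).trans (by gcongr; exact norm_add_le _ _)
        _ ≤ ‖weakGrad u x‖ + (1 * ‖weakGrad u x‖ + ‖u x‖ * (1 * M)) := by
            rw [norm_smul, norm_smul]
            gcongr
            · exact hζ1 n x
            · refine (hζg1 n x).trans ?_
              gcongr
              exact ha1 n
        _ = _ := by ring
    · filter_upwards [ae_all_iff.2 fun n => (hmul n).2] with x hx
      have h1 : Filter.Tendsto (fun n => gradient (ζ n) x) Filter.atTop (nhds 0) := by
        refine squeeze_zero_norm (fun n => hζg1 n x) ?_
        simpa using hat.mul_const M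
      have h2 : Filter.Tendsto (fun n => u x • gradient (ζ n) x) Filter.atTop (nhds 0) := by
        simpa using h1.const_smul (u x)
      have h3 := h2.neg
      rw [neg_zero] at h3
      refine h3.congr' ?_
      filter_upwards [hev x] with n hn
      rw [hx n, hn]
      simp

theorem gradient_eq_zero_of_nonneg {p : Space d → ℝ} (hp0 : ∀ x, 0 ≤ p x) {x : Space d}
    (hx : p x = 0) : gradient p x = 0 := by
  have : IsLocalMin p x := Filter.Eventually.of_forall fun y => by rw [hx]; exact hp0 y
  rw [gradient_eq_symm_fderiv, this.fderiv_eq_zero, map_zero]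

theorem gradient_sqrt {p : Space d → ℝ} {x : Space d} (hp : DifferentiableAt ℝ p x)
    (hx : p x ≠ 0) : gradient (fun y => √(p y)) x = (1 / (2 * √(p x))) • gradient p x :=
  gradient_comp_of_hasDerivAt (Real.hasDerivAt_sqrt hx) hp

/-- After multiplication by `2 √p` the product rule for `√p v` has no singular coefficient. It may
be tested with `θ` supported in `{p > 0}`: there `√p` is smooth, so `2 √p θ` is a test function for
`√p v`. -/
theorem two_sqrt_smul_weakGrad {p v : Space d → ℝ} (hp : ContDiff ℝ ∞ p) (hp0 : ∀ x, 0 ≤ p x)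
    (hv : MemH1 v) (hu : MemH1 fun x => √(p x) * v x) :
    ∀ᵐ x, 0 < p x → (2 * √(p x)) • weakGrad (fun x => √(p x) * v x) x
      = (2 * p x) • weakGrad v x + v x • gradient p x := by
  set u : Space d → ℝ := fun x => √(p x) * v x with hudef
  have hO : IsOpen {x | 0 < p x} := isOpen_lt continuous_const hp.continuous
  have hvl := locallyIntegrable_of_memLp hv.1
  have hgl := locallyIntegrable_of_memLp hv.memLp_weakGrad
  have hul := locallyIntegrable_of_memLp hu.memLp_weakGrad
  have hl1 : LocallyIntegrable fun x => (2 * √(p x)) • weakGrad u x :=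
    hul.continuous_smul (by have := hp.continuous; fun_prop)
  have hl2 : LocallyIntegrable fun x => (2 * p x) • weakGrad v x :=
    hgl.continuous_smul (by have := hp.continuous; fun_prop)
  have hl3 : LocallyIntegrable fun x => v x • gradient p x :=
    hvl.smul_continuous (continuous_gradient hp)
  have key := hO.ae_eq_zero_of_integral_contDiff_smul_eq_zero
    (f := fun x => (2 * √(p x)) • weakGrad u x - ((2 * p x) • weakGrad v x + v x • gradient p x))
    (μ := volume) ((hl1.sub (hl2.add hl3)).locallyIntegrableOn _) fun θ hθ hc hs => by
      have hd := hθ.differentiable (by simp)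
      have hpd := hp.differentiable (by simp)
      set θ' : Space d → ℝ := fun x => (2 * √(p x)) * θ x with hθ'
      have hθ's : ContDiff ℝ ∞ θ' := by
        refine contDiff_iff_contDiffAt.2 fun x => ?_
        by_cases hx : x ∈ tsupport θ
        · have hx' : 0 < p x := hs hx
          exact (contDiffAt_const.mul (hp.contDiffAt.sqrt hx'.ne')).mul hθ.contDiffAt
        · refine (contDiffAt_const (c := (0 : ℝ))).congr_of_eventuallyEq ?_
          filter_upwards [notMem_tsupport_iff_eventuallyEq.1 hx] with y hy
          simp [hθ', hy]
      have hθ'c : HasCompactSupport θ' := hc.mul_left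
      set τ : Space d → ℝ := fun x => (2 * p x) * θ x with hτ
      have hτs : ContDiff ℝ ∞ τ := (contDiff_const.mul hp).mul hθ
      have hτc : HasCompactSupport τ := hc.mul_left
      have hpt : ∀ x, u x • gradient θ' x = v x • gradient τ x - θ x • (v x • gradient p x) := by
        intro x
        have h1 : gradient τ x = (2 * p x) • gradient θ x + θ x • (2 : ℝ) • gradient p x := by
          rw [hτ, gradient_fun_mul ((hpd x).const_mul 2) (hd x), gradient_fun_const_mul 2 (hpd x)]
        rcases (hp0 x).eq_or_lt' with h0 | h0
        · have hθ0 : θ x = 0 := by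
            by_contra h
            have := hs (subset_tsupport θ h)
            rw [Set.mem_ofPred_eq, h0] at this
            exact lt_irrefl _ this
          rw [h1, hudef]
          simp [h0, hθ0]
        · have hq : 0 < √(p x) := Real.sqrt_pos.2 h0
          have h2 : gradient θ' x = (2 * √(p x)) • gradient θ x
              + θ x • (2 : ℝ) • (1 / (2 * √(p x))) • gradient p x := by
            have hqd : DifferentiableAt ℝ (fun y => √(p y)) x := (hpd x).sqrt h0.ne'
            rw [hθ', gradient_fun_mul (hqd.const_mul 2) (hd x), gradient_fun_const_mul 2 hqd,
              gradient_sqrt (hpd x) h0.ne']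
          rw [h1, h2, hudef]
          have hq2 : √(p x) * √(p x) = p x := Real.mul_self_sqrt (hp0 x)
          simp only [smul_add, smul_smul]
          have e1 : √(p x) * v x * (2 * √(p x)) = v x * (2 * p x) := by
            linear_combination (2 * v x) * hq2
          have e2 : √(p x) * v x * (θ x * (2 * (1 / (2 * √(p x))))) = v x * θ x := by
            field_simp
          have e3 : v x * (θ x * 2) = v x * θ x + θ x * v x := by ring
          rw [e1, e2, e3, add_smul]
          abel
      have i1 : Integrable fun x => v x • gradient τ x := integrable_smul_gradient hvl hτs hτc
      have i2 := integrable_test_smul hl3 hθ.continuous hc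
      have i3 := integrable_test_smul hl1 hθ.continuous hc
      have i4 := integrable_test_smul hl2 hθ.continuous hc
      have e1 := hu.isWeakGrad θ' hθ's hθ'c
      have e2 := hv.isWeakGrad τ hτs hτc
      have e3 : ∫ x, u x • gradient θ' x
          = ∫ x, v x • gradient τ x - θ x • (v x • gradient p x) := by simp only [hpt]
      rw [integral_sub i1 i2, e1, e2] at e3
      have e4 : ∀ x, θ' x • weakGrad u x = θ x • (2 * √(p x)) • weakGrad u x := fun x => by
        rw [smul_smul, hθ', mul_comm]
      have e5 : ∀ x, τ x • weakGrad v x = θ x • (2 * p x) • weakGrad v x := fun x => by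
        rw [smul_smul, hτ, mul_comm]
      simp only [e4, e5] at e3
      simp only [smul_sub, smul_add]
      refine (integral_sub i3 (i4.add i2)).trans ?_
      have e6 := integral_add i4 i2
      simp only [Pi.add_apply]
      rw [e6, ← neg_eq_zero, neg_sub', e3]
      abel
  filter_upwards [key] with x hx h0
  exact sub_eq_zero.1 (hx h0)

/-- The product rule for the square root of a smooth nonnegative function. -/
theorem weakGrad_sqrt_mul {p v : Space d → ℝ} (hp : ContDiff ℝ ∞ p) (hp0 : ∀ x, 0 ≤ p x)
    (hp1 : ∀ x, p x ≤ 1) (hv : MemH1 v) (hu : MemH1 fun x => √(p x) * v x) :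
    MemLp (fun x => (v x / (2 * √(p x))) • gradient p x) 2 volume ∧
    weakGrad (fun x => √(p x) * v x) =ᵐ[volume]
      fun x => √(p x) • weakGrad v x + (v x / (2 * √(p x))) • gradient p x := by
  set u : Space d → ℝ := fun x => √(p x) * v x with hudef
  set H : Space d → Space d := fun x => (v x / (2 * √(p x))) • gradient p x with hH
  have hpc := hp.continuous
  have hpd := hp.differentiable (by simp)
  have hsq1 : ∀ x, √(p x) ≤ 1 := fun x => Real.sqrt_le_one.2 (hp1 x)
  have hHm : AEStronglyMeasurable H volume := by
    have h1 : AEStronglyMeasurable (fun x => v x / (2 * √(p x))) volume :=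
      (hv.1.1.aemeasurable.div (continuous_const.mul hpc.sqrt).aemeasurable).aestronglyMeasurable
    exact h1.smul (continuous_gradient hp).aestronglyMeasurable
  have hgm := hv.memLp_weakGrad
  have hsg : MemLp (fun x => √(p x) • weakGrad v x) 2 volume := by
    refine hgm.of_le (hpc.sqrt.aestronglyMeasurable.smul hgm.1)
      (Filter.Eventually.of_forall fun x => ?_)
    rw [norm_smul, Real.norm_of_nonneg (Real.sqrt_nonneg _)]
    exact mul_le_of_le_one_left (norm_nonneg _) (hsq1 x)
  -- The singular term `H` is the difference of two fields in `L²` on `{p > 0}` and vanishes where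
  -- `p = 0`. Its square integrability thus comes from the assumption `√p v ∈ H¹`, not from a bound
  -- on `∇√p`.
  have hHae : ∀ᵐ x, 0 < p x → H x = weakGrad u x - √(p x) • weakGrad v x := by
    filter_upwards [two_sqrt_smul_weakGrad hp hp0 hv hu] with x hx h0
    have hq : 0 < √(p x) := Real.sqrt_pos.2 h0
    have h1 : v x • gradient p x
        = (2 * √(p x)) • weakGrad u x - (2 * p x) • weakGrad v x := by rw [hx h0]; abel
    have hq2 : √(p x) * √(p x) = p x := Real.mul_self_sqrt (hp0 x)
    have h2 : H x = (1 / (2 * √(p x))) • (v x • gradient p x) := by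
      rw [hH, smul_smul, one_div_mul_eq_div]
    rw [h2, h1, smul_sub, smul_smul, smul_smul]
    congr 1
    · rw [one_div_mul_cancel (by positivity), one_smul]
    · congr 1
      rw [one_div_mul_eq_div, div_eq_iff (by positivity)]
      linear_combination (-2) * hq2
  have hH0 : ∀ x, p x = 0 → H x = 0 := fun x hx => by
    rw [hH]; simp [gradient_eq_zero_of_nonneg hp0 hx]
  have hHL : MemLp H 2 volume := by
    refine (hu.memLp_weakGrad.sub hsg).of_le hHm ?_
    filter_upwards [hHae] with x hx
    rcases (hp0 x).eq_or_lt' with h0 | h0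
    · rw [hH0 x h0, norm_zero]; exact norm_nonneg _
    · rw [hx h0]; rfl
  refine ⟨hHL, IsWeakGrad.weakGrad_ae_eq (fun θ hθ hc => ?_) hu.1 (hsg.add hHL)⟩
  -- The roots are regularized to be smooth. As `q n ≥ √p`, the term with `∇(q n)` is dominated by
  -- `|H|`, and dominated convergence applies on both sides.
  set q : ℕ → Space d → ℝ := fun n x => √(p x + 1 / ((n : ℝ) + 1)) with hq
  have hqpos : ∀ (n : ℕ) x, 0 < p x + 1 / ((n : ℝ) + 1) := fun n x =>
    add_pos_of_nonneg_of_pos (hp0 x) (by positivity)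
  have hq2 : ∀ n x, q n x ≤ 2 := fun n x => by
    rw [hq]
    refine (Real.sqrt_le_left (by norm_num)).2 ?_
    have : 1 / ((n : ℝ) + 1) ≤ 1 := (div_le_one (by positivity)).2 (by
      linarith [n.cast_nonneg (α := ℝ)])
    linarith [hp1 x]
  have hq0 : ∀ n x, 0 ≤ q n x := fun n x => Real.sqrt_nonneg _
  have hqs : ∀ n, ContDiff ℝ ∞ (q n) := fun n =>
    ContDiff.sqrt (hp.add contDiff_const) fun x => (hqpos n x).ne'
  have hqg : ∀ n x, gradient (q n) x = (1 / (2 * q n x)) • gradient p x := fun n x => by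
    have h := gradient_comp_of_hasDerivAt (f := fun y => p y + 1 / ((n : ℝ) + 1))
      (Real.hasDerivAt_sqrt (hqpos n x).ne') ((hpd x).add_const _)
    rw [gradient_fun_add (hpd x) (by fun_prop), gradient_fun_const, add_zero] at h
    exact h
  have hqlim : ∀ x, Filter.Tendsto (fun n => q n x) Filter.atTop (nhds (√(p x))) := fun x => by
    have h1 : Filter.Tendsto (fun n : ℕ => p x + 1 / ((n : ℝ) + 1)) Filter.atTop
        (nhds (p x + 0)) := tendsto_const_nhds.add tendsto_one_div_add_atTop_nhds_zero_nat
    rw [add_zero] at h1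
    exact (Real.continuous_sqrt.tendsto _).comp h1
  have hvl := locallyIntegrable_of_memLp hv.1
  have hgl := locallyIntegrable_of_memLp hgm
  have hid := fun n => hv.isWeakGrad.mul hvl hgl (hqs n) θ hθ hc
  have hL : Filter.Tendsto (fun n => ∫ x, (q n x * v x) • gradient θ x) Filter.atTop
      (nhds (∫ x, u x • gradient θ x)) := by
    refine tendsto_integral_of_dominated_convergence (fun x => 2 * ‖v x • gradient θ x‖)
      (fun n => ?_) ((integrable_smul_gradient hvl hθ hc).norm.const_mul 2) (fun n => ?_) ?_
    · exact ((hqs n).continuous.aestronglyMeasurable.mul hv.1.1).smul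
        (continuous_gradient hθ).aestronglyMeasurable
    · refine Filter.Eventually.of_forall fun x => ?_
      rw [mul_smul, norm_smul, Real.norm_of_nonneg (hq0 n x)]
      gcongr
      exact hq2 n x
    · refine Filter.Eventually.of_forall fun x => ?_
      exact ((hqlim x).mul_const (v x)).smul_const _
  have hR : Filter.Tendsto (fun n => ∫ x, θ x • (q n x • weakGrad v x + v x • gradient (q n) x))
      Filter.atTop (nhds (∫ x, θ x • (√(p x) • weakGrad v x + H x))) := by
    refine tendsto_integral_of_dominated_convergence
      (fun x => 2 * ‖θ x • weakGrad v x‖ + ‖θ x • H x‖) (fun n => ?_) ?_ (fun n => ?_) ?_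
    · exact hθ.continuous.aestronglyMeasurable.smul
        (((hqs n).continuous.aestronglyMeasurable.smul hgm.1).add
          (hv.1.1.smul (continuous_gradient (hqs n)).aestronglyMeasurable))
    · exact ((integrable_test_smul hgl hθ.continuous hc).norm.const_mul 2).add
        (integrable_test_smul (locallyIntegrable_of_memLp hHL) hθ.continuous hc).norm
    · refine Filter.Eventually.of_forall fun x => ?_
      rw [smul_add]
      refine (norm_add_le _ _).trans (add_le_add ?_ ?_)
      · rw [smul_comm, norm_smul, Real.norm_of_nonneg (hq0 n x)]
        gcongr
        exact hq2 n x
      · rw [norm_smul, norm_smul (θ x)]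
        gcongr
        rw [hqg, hH]
        rcases (hp0 x).eq_or_lt' with h0 | h0
        · simp [gradient_eq_zero_of_nonneg hp0 h0]
        · have hs : 0 < √(p x) := Real.sqrt_pos.2 h0
          have hsq : √(p x) ≤ q n x := Real.sqrt_le_sqrt (by
            have : 0 < 1 / ((n : ℝ) + 1) := by positivity
            linarith)
          rw [smul_smul, norm_smul, norm_smul, mul_one_div, norm_div, norm_div,
            Real.norm_of_nonneg (mul_nonneg zero_le_two (hq0 n x)),
            Real.norm_of_nonneg (mul_nonneg zero_le_two hs.le)]
          gcongr
    · refine Filter.Eventually.of_forall fun x => ?_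
      refine Filter.Tendsto.const_smul (((hqlim x).smul_const _).add ?_) _
      simp only [hqg, hH]
      rcases (hp0 x).eq_or_lt' with h0 | h0
      · simp [gradient_eq_zero_of_nonneg hp0 h0]
      · have hs : 0 < √(p x) := Real.sqrt_pos.2 h0
        have h1 := Filter.Tendsto.div (tendsto_const_nhds (x := v x)) ((hqlim x).const_mul 2)
          (by positivity : 2 * √(p x) ≠ 0)
        refine (h1.smul_const (gradient p x)).congr fun n => ?_
        rw [smul_smul, mul_one_div]
        rfl
  exact tendsto_nhds_unique hL (hR.neg.congr fun n => (hid n).symm)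

/-- If `p` is supported in a closed ball, then `√p v` lies in `H¹₀` of the open ball. -/
theorem memH10_sqrt_mul {p v : Space d → ℝ} (hp : ContDiff ℝ ∞ p) (hp0 : ∀ x, 0 ≤ p x)
    (hp1 : ∀ x, p x ≤ 1) (hv : MemH1 v) (hu : MemH1 fun x => √(p x) * v x) {R : Space d} {r : ℝ}
    (hr : 0 < r) (hs : tsupport p ⊆ Metric.closedBall R r) :
    MemH10 (Metric.ball R r) fun x => √(p x) * v x := by
  obtain ⟨hHL, hgrad⟩ := weakGrad_sqrt_mul hp hp0 hp1 hv hu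
  set u : Space d → ℝ := fun x => √(p x) * v x with hudef
  set H : Space d → Space d := fun x => (v x / (2 * √(p x))) • gradient p x with hH
  have hpc := hp.continuous
  have hpd := hp.differentiable (by simp)
  have hst : ContDiff ℝ ∞ Real.smoothTransition := Real.smoothTransition.contDiff
  have hd0 : ∀ s, s < 0 → deriv Real.smoothTransition s = 0 := fun s hs => by
    have : Real.smoothTransition =ᶠ[nhds s] fun _ => 0 := by
      filter_upwards [Iio_mem_nhds hs] with t ht
      exact Real.smoothTransition.zero_of_nonpos (le_of_lt ht)
    rw [this.deriv_eq, deriv_const]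
  have hd1 : ∀ s, 1 < s → deriv Real.smoothTransition s = 0 := fun s hs => by
    have : Real.smoothTransition =ᶠ[nhds s] fun _ => 1 := by
      filter_upwards [Ioi_mem_nhds hs] with t ht
      exact Real.smoothTransition.one_of_one_le (le_of_lt ht)
    rw [this.deriv_eq, deriv_const]
  obtain ⟨M, hM0, hM⟩ : ∃ M : ℝ, 0 ≤ M ∧ ∀ s, |deriv Real.smoothTransition s| ≤ M := by
    obtain ⟨M, hM⟩ := (isCompact_Icc (a := (0 : ℝ)) (b := 1)).exists_bound_of_continuousOn
      (hst.continuous_deriv (by simp)).continuousOn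
    refine ⟨max M 0, le_max_right _ _, fun s => ?_⟩
    by_cases h0 : s < 0
    · rw [hd0 s h0, abs_zero]; exact le_max_right _ _
    by_cases h1 : 1 < s
    · rw [hd1 s h1, abs_zero]; exact le_max_right _ _
    · exact (hM s ⟨not_lt.1 h0, not_lt.1 h1⟩).trans (le_max_left _ _)
  set c : ℕ → ℝ := fun n => (n : ℝ) + 1 with hc
  have hc0 : ∀ n, 0 < c n := fun n => by positivity
  -- The cut-off acts on the level sets of `p`: it vanishes where `p ≤ 1 / (n + 1)` and equals `1`
  -- where `p ≥ 2 / (n + 1)`.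
  set η : ℕ → Space d → ℝ := fun n x => Real.smoothTransition (c n * p x - 1) with hη
  have hηs : ∀ n, ContDiff ℝ ∞ (η n) := fun n =>
    hst.comp ((contDiff_const.mul hp).sub contDiff_const)
  have hηg : ∀ n x, gradient (η n) x
      = (deriv Real.smoothTransition (c n * p x - 1) * c n) • gradient p x := fun n x => by
    refine gradient_comp_of_hasDerivAt (φ := fun s => Real.smoothTransition (c n * s - 1)) ?_
      (hpd x)
    have h1 := (hst.differentiable (by simp) (c n * p x - 1)).hasDerivAt
    have h2 : HasDerivAt (fun s : ℝ => c n * s - 1) (c n) (p x) := by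
      simpa using ((hasDerivAt_id (p x)).const_mul (c n)).sub_const 1
    exact h1.comp (p x) h2
  have hη0 : ∀ n x, 0 ≤ η n x := fun n x => Real.smoothTransition.nonneg _
  have hη1 : ∀ n x, η n x ≤ 1 := fun n x => Real.smoothTransition.le_one _
  have hηn : ∀ n x, ‖η n x‖ ≤ 1 := fun n x => by
    rw [Real.norm_of_nonneg (hη0 n x)]; exact hη1 n x
  -- The gradient of the cut-off lives where `(n + 1) p ≤ 2`. There the large factor `n + 1` is
  -- absorbed by `u ∇p = 2 p H`.
  have hugb : ∀ n x, ‖u x • gradient (η n) x‖ ≤ 4 * M * ‖H x‖ := fun n x => by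
    rcases (hp0 x).eq_or_lt' with h0 | h0
    · have : u x = 0 := by rw [hudef]; simp [h0]
      rw [this, zero_smul, norm_zero]; positivity
    · by_cases h2 : 1 < c n * p x - 1
      · rw [hηg, hd1 _ h2]; simp; positivity
      · have hs : 0 < √(p x) := Real.sqrt_pos.2 h0
        have hq2 : √(p x) * √(p x) = p x := Real.mul_self_sqrt (hp0 x)
        have e1 : u x • gradient (η n) x
            = (deriv Real.smoothTransition (c n * p x - 1) * (2 * (c n * p x))) • H x := by
          rw [hηg, hH, smul_smul, smul_smul]
          congr 1
          rw [hudef, mul_div_assoc', eq_div_iff (by positivity)]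
          linear_combination (2 * v x * deriv Real.smoothTransition (c n * p x - 1) * c n) * hq2
        rw [e1, norm_smul, norm_mul, Real.norm_eq_abs, Real.norm_of_nonneg
          (mul_nonneg zero_le_two (mul_nonneg (hc0 n).le (hp0 x)))]
        calc |deriv Real.smoothTransition (c n * p x - 1)| * (2 * (c n * p x)) * ‖H x‖
            ≤ M * (2 * 2) * ‖H x‖ := by
              gcongr
              · exact hM _
              · linarith
          _ = _ := by ring
  have hgm := hu.memLp_weakGrad
  have hl1 : ∀ n, MemLp (fun x => η n x * u x) 2 volume := fun n =>
    hu.1.of_le ((hηs n).continuous.aestronglyMeasurable.mul hu.1.1)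
      (Filter.Eventually.of_forall fun x => by
        rw [norm_mul]; exact mul_le_of_le_one_left (norm_nonneg _) (hηn n x))
  have hl2 : ∀ n, MemLp (fun x => η n x • weakGrad u x + u x • gradient (η n) x) 2 volume :=
    fun n => by
    refine MemLp.add ?_ ?_
    · refine hgm.of_le ((hηs n).continuous.aestronglyMeasurable.smul hgm.1)
        (Filter.Eventually.of_forall fun x => ?_)
      rw [norm_smul]; exact mul_le_of_le_one_left (norm_nonneg _) (hηn n x)
    · refine (hHL.norm.const_mul (4 * M)).of_le
        (hu.1.1.smul (continuous_gradient (hηs n)).aestronglyMeasurable)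
        (Filter.Eventually.of_forall fun x => ?_)
      exact (hugb n x).trans (le_abs_self _)
  have hmul := fun n => hu.mul_smooth (hηs n) (hl1 n) (hl2 n)
  have hct : Filter.Tendsto c Filter.atTop Filter.atTop :=
    Filter.tendsto_atTop_add_const_right _ _ tendsto_natCast_atTop_atTop
  have hev : ∀ x : Space d, 0 < p x → ∀ᶠ n in Filter.atTop, 1 < c n * p x - 1 := fun x hx => by
    filter_upwards [(hct.atTop_mul_const hx).eventually_gt_atTop 2] with n hn
    linarith
  have hev0 : ∀ x : Space d, 0 < p x → ∀ᶠ n in Filter.atTop, η n x = 1 ∧ gradient (η n) x = 0 :=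
    fun x hx => by
    filter_upwards [hev x hx] with n hn
    exact ⟨Real.smoothTransition.one_of_one_le hn.le, by rw [hηg, hd1 _ hn]; simp⟩
  -- The set `{p > 0}` is open inside the closed ball, hence inside its interior. So each superlevel
  -- set of `p` is a compact subset of the open ball.
  have hsub : {x | 0 < p x} ⊆ Metric.ball R r := by
    have h1 : {x | 0 < p x} ⊆ interior (Metric.closedBall R r) :=
      interior_maximal (fun x hx => hs (subset_tsupport p (ne_of_gt hx)))
        (isOpen_lt continuous_const hpc)
    rwa [interior_closedBall R hr.ne'] at h1
  refine MemH10.of_tendsto hu (v := fun n x => η n x * u x) (fun n => ?_) ?_ ?_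
  · have hKc : IsClosed {x | 1 / c n ≤ p x} := isClosed_le continuous_const hpc
    have hKsub : {x | 1 / c n ≤ p x} ⊆ {x | 0 < p x} := fun x hx =>
      lt_of_lt_of_le (one_div_pos.2 (hc0 n)) hx
    refine memH10_of_compact Metric.isOpen_ball ((isCompact_closedBall R r).of_isClosed_subset hKc
      ((hKsub.trans hsub).trans Metric.ball_subset_closedBall)) (hKsub.trans hsub) (hmul n).1
      fun x hx => ?_
    have hx' : p x < 1 / c n := not_le.1 hx
    rw [lt_div_iff₀ (hc0 n)] at hx'
    have : η n x = 0 := Real.smoothTransition.zero_of_nonpos (by linarith)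
    rw [this, zero_mul]
  · refine tendsto_eLpNorm_two_of_dominated (fun n => (hu.1.sub (hl1 n)).1) (hu.1.norm)
      (b := fun x => ‖u x‖) (fun n => Filter.Eventually.of_forall fun x => ?_)
      (Filter.Eventually.of_forall fun x => ?_)
    · have : u x - η n x * u x = (1 - η n x) * u x := by ring
      rw [this, norm_mul]
      refine mul_le_of_le_one_left (norm_nonneg _) ?_
      rw [Real.norm_of_nonneg (sub_nonneg.2 (hη1 n x))]
      linarith [hη0 n x]
    · refine tendsto_const_nhds.congr' ?_
      rcases (hp0 x).eq_or_lt' with h0 | h0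
      · refine Filter.Eventually.of_forall fun n => ?_
        simp [hudef, h0]
      · filter_upwards [hev0 x h0] with n hn
        simp [hn.1]
  · have hb2 : MemLp (fun x => 2 * ‖weakGrad u x‖ + 4 * M * ‖H x‖) 2 volume :=
      (hgm.norm.const_mul 2).add (hHL.norm.const_mul (4 * M))
    refine tendsto_eLpNorm_two_of_dominated (fun n => (hgm.sub (hmul n).1.memLp_weakGrad).1) hb2
      (fun n => ?_) ?_
    · filter_upwards [(hmul n).2] with x hx
      rw [hx]
      calc ‖weakGrad u x - (η n x • weakGrad u x + u x • gradient (η n) x)‖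
          ≤ ‖weakGrad u x‖ + (‖η n x • weakGrad u x‖ + ‖u x • gradient (η n) x‖) :=
            (norm_sub_le _ _).trans (by gcongr; exact norm_add_le _ _)
        _ ≤ ‖weakGrad u x‖ + (1 * ‖weakGrad u x‖ + 4 * M * ‖H x‖) := by
            rw [norm_smul (η n x)]
            gcongr
            · exact hηn n x
            · exact hugb n x
        _ = _ := by ring
    · filter_upwards [ae_all_iff.2 fun n => (hmul n).2, hgrad] with x hx hxg
      refine tendsto_const_nhds.congr' ?_
      rcases (hp0 x).eq_or_lt' with h0 | h0
      · refine Filter.Eventually.of_forall fun n => ?_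
        have hu0 : u x = 0 := by rw [hudef]; simp [h0]
        beta_reduce
        rw [hx n, hxg, gradient_eq_zero_of_nonneg hp0 h0, hu0, h0]
        simp
      · filter_upwards [hev0 x h0] with n hn
        beta_reduce
        rw [hx n, hn.1, hn.2]
        simp

end SqrtMul

end LCAO

namespace LCAO

/-! ### Sobolev inequalities -/

section Sobolev

variable {d : ℕ}

/-- The exponent of the Sobolev inequality used for the potential. -/
noncomputable def sobExponent (d : ℕ) : ℝ≥0∞ := if d = 1 then ⊤ else 6

theorem fderiv_test_pow {θ : Space d → ℝ} (hθ : ContDiff ℝ ∞ θ) (n : ℕ) (x : Space d) :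
    fderiv ℝ (fun y => θ y ^ n) x = ((n : ℝ) * θ x ^ (n - 1)) • fderiv ℝ θ x := by
  exact ((hasDerivAt_pow n (θ x)).comp_hasFDerivAt x
    (hθ.differentiable (by simp) x).hasFDerivAt).fderiv

/-- Chain rule and Cauchy–Schwarz. Powers of `θ` turn `W^{1,1}` inequalities into `H¹` ones in
dimensions one and two. -/
theorem eLpNorm_fderiv_pow_le {θ : Space d → ℝ} (hθ : ContDiff ℝ ∞ θ) (n : ℕ) :
    eLpNorm (fderiv ℝ fun y => θ y ^ n) 1 volume
      ≤ n * (eLpNorm (fun y => θ y ^ (n - 1)) 2 volume * eLpNorm (fderiv ℝ θ) 2 volume) := by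
  have h1 : (fderiv ℝ fun y => θ y ^ n)
      = (n : ℝ) • ((fun y => θ y ^ (n - 1)) • fderiv ℝ θ) := by
    ext1 x
    rw [fderiv_test_pow hθ]
    simp [mul_smul]
  rw [h1]
  refine (eLpNorm_const_smul (n : ℝ) ((fun y => θ y ^ (n - 1)) • fderiv ℝ θ) 1 volume).trans_le ?_
  have h2 : ‖(n : ℝ)‖ₑ = n := by simp
  rw [h2]
  gcongr
  exact eLpNorm_smul_le_mul_eLpNorm (hθ.continuous_fderiv (by simp)).aestronglyMeasurable
    (hθ.continuous.pow _).aestronglyMeasurable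

/-- The fundamental theorem of calculus for `θ²` gives `θ(x)² ≤ ∫ |(θ²)'| ≤ 2 ‖θ‖ ‖θ'‖`. -/
theorem sobolev_one : ∃ K : NNReal, ∀ θ : Space 1 → ℝ, ContDiff ℝ ∞ θ → HasCompactSupport θ →
    eLpNorm θ ⊤ volume
      ≤ K * max (eLpNorm θ 2 volume) (eLpNorm (fderiv ℝ θ) 2 volume) := by
  refine ⟨2, fun θ hθ hc => ?_⟩
  set N := max (eLpNorm θ 2 volume) (eLpNorm (fderiv ℝ θ) 2 volume) with hN
  let e : ℝ ≃ₗᵢ[ℝ] EuclideanSpace ℝ (Fin 1) := (OrthonormalBasis.singleton (Fin 1) ℝ).repr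
  have hsq : ∀ x, ‖θ x‖ₑ ^ 2 ≤ 2 * (N * N) := fun x => by
    set u : Space 1 → ℝ := fun y => θ y ^ 2 with hu
    have hus : ContDiff ℝ ∞ u := hθ.pow 2
    have huc : HasCompactSupport u := hc.comp_left (g := fun t => t ^ 2) (by simp)
    set l : ℝ → Space 1 := fun t => e t + x with hl
    have hls : ContDiff ℝ 1 l := by
      have := e.toContinuousLinearEquiv.contDiff (n := 1)
      exact this.add contDiff_const
    have hle : l = (e.toHomeomorph.trans (Homeomorph.addRight x)) := rfl
    have hlm : MeasurePreserving l volume volume :=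
      (measurePreserving_add_right volume x).comp e.measurePreserving
    have h1 := HasCompactSupport.enorm_le_lintegral_Ici_deriv (f := u ∘ l)
      ((hus.of_le (by simp)).comp hls) (by rw [hle]; exact huc.comp_homeomorph _) 0
    have h2 : (u ∘ l) 0 = θ x ^ 2 := by simp [hl, hu]
    rw [h2, enorm_pow] at h1
    have h3 : ∀ t, ‖deriv (u ∘ l) t‖ₑ ≤ ‖fderiv ℝ u (l t)‖ₑ := fun t => by
      have hd : HasDerivAt l (e 1) t := by
        have h4 := (e.toContinuousLinearEquiv : ℝ →L[ℝ] Space 1).hasDerivAt (x := t)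
        exact h4.add_const x
      have h5 := ((hus.differentiable (by simp) (l t)).hasFDerivAt.comp_hasDerivAt t hd).deriv
      rw [h5]
      refine (ContinuousLinearMap.le_opENorm _ _).trans ?_
      have h6 : ‖e 1‖ₑ = 1 := by rw [← ofReal_norm, e.norm_map]; simp
      rw [h6, mul_one]
    have hfm : Measurable fun y => ‖fderiv ℝ u y‖ₑ :=
      (hus.continuous_fderiv (by simp)).enorm.measurable
    calc ‖θ x‖ₑ ^ 2 ≤ ∫⁻ t in Set.Iic 0, ‖deriv (u ∘ l) t‖ₑ := h1
      _ ≤ ∫⁻ t, ‖deriv (u ∘ l) t‖ₑ := setLIntegral_le_lintegral _ _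
      _ ≤ ∫⁻ t, ‖fderiv ℝ u (l t)‖ₑ := lintegral_mono h3
      _ = ∫⁻ y, ‖fderiv ℝ u y‖ₑ := hlm.lintegral_comp hfm
      _ = eLpNorm (fderiv ℝ u) 1 volume := eLpNorm_one_eq_lintegral_enorm.symm
      _ ≤ _ := eLpNorm_fderiv_pow_le hθ 2
      _ = 2 * (eLpNorm θ 2 volume * eLpNorm (fderiv ℝ θ) 2 volume) := by simp
      _ ≤ _ := by gcongr; exacts [le_max_left _ _, le_max_right _ _]
  refine eLpNormEssSup_le_of_ae_enorm_bound (Filter.Eventually.of_forall fun x => ?_)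
  refine (ENNReal.pow_le_pow_left_iff two_ne_zero).1 ((hsq x).trans ?_)
  calc 2 * (N * N) ≤ 4 * (N * N) := by gcongr; norm_num
    _ = _ := by simp only [ENNReal.coe_ofNat]; ring

/-- In the plane the Gagliardo–Nirenberg inequality bounds the `L²` norm by the `L¹` norm of the
gradient. Applied to `θ³` and then to `θ²` it gives `‖θ‖_6³ = ‖θ³‖_2 ≤ 6 C² N³`. The `+ 1` in the
constant makes it at most its own cube. -/
theorem sobolev_two : ∃ K : NNReal, ∀ θ : Space 2 → ℝ, ContDiff ℝ ∞ θ → HasCompactSupport θ →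
    eLpNorm θ 6 volume
      ≤ K * max (eLpNorm θ 2 volume) (eLpNorm (fderiv ℝ θ) 2 volume) := by
  set C : NNReal := eLpNormLESNormFDerivOneConst (volume : Measure (Space 2)) ((2 : NNReal) : ℝ)
    with hC
  refine ⟨6 * C ^ 2 + 1, fun θ hθ hc => ?_⟩
  set N := max (eLpNorm θ 2 volume) (eLpNorm (fderiv ℝ θ) 2 volume) with hN
  have hA : eLpNorm θ 2 volume ≤ N := le_max_left _ _
  have hB : eLpNorm (fderiv ℝ θ) 2 volume ≤ N := le_max_right _ _
  have hfr : NNReal.HolderConjugate (Module.finrank ℝ (Space 2)) 2 := by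
    rw [finrank_euclideanSpace_fin]
    exact_mod_cast NNReal.HolderConjugate.two_two
  have hgns : ∀ n : ℕ, n ≠ 0 → eLpNorm (fun y => θ y ^ n) 2 volume
      ≤ C * (n * (eLpNorm (fun y => θ y ^ (n - 1)) 2 volume * N)) := fun n hn => by
    have h := eLpNorm_le_eLpNorm_fderiv_one (volume : Measure (Space 2))
      (u := fun y => θ y ^ n) ((hθ.pow n).of_le (by simp))
      (hc.comp_left (g := fun t => t ^ n) (by simp [hn])) hfr
    refine h.trans ?_
    exact mul_le_mul_right ((eLpNorm_fderiv_pow_le hθ n).trans (by gcongr)) _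
  have h2 := hgns 2 (by norm_num)
  have h3 := hgns 3 (by norm_num)
  have h6 : eLpNorm (fun y => θ y ^ 3) 2 volume = eLpNorm θ 6 volume ^ 3 := by
    have h := eLpNorm_norm_rpow (μ := (volume : Measure (Space 2))) (p := 2) (q := 3) θ (by norm_num)
    have e1 : (2 : ℝ≥0∞) * ENNReal.ofReal 3 = 6 := by
      rw [ENNReal.ofReal_ofNat]; norm_num
    rw [e1] at h
    have e2 : eLpNorm (fun y => θ y ^ 3) 2 volume
        = eLpNorm (fun y => ‖θ y‖ ^ (3 : ℝ)) 2 volume := by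
      refine eLpNorm_congr_norm_ae (Filter.Eventually.of_forall fun x => ?_)
      have : (3 : ℝ) = ((3 : ℕ) : ℝ) := by norm_num
      rw [this, Real.rpow_natCast]
      simp
    rw [e2, h]
    have : (3 : ℝ) = ((3 : ℕ) : ℝ) := by norm_num
    rw [this, ENNReal.rpow_natCast]
  refine (ENNReal.pow_le_pow_left_iff three_ne_zero).1 ?_
  rw [← h6]
  simp only [Nat.add_one_sub_one, pow_one, Nat.cast_ofNat] at h2 h3
  have hL : (1 : ℝ≥0∞) ≤ ((6 * C ^ 2 + 1 : NNReal) : ℝ≥0∞) := by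
    exact_mod_cast le_add_of_nonneg_left (zero_le)
  calc eLpNorm (fun y => θ y ^ 3) 2 volume
      ≤ C * (3 * (eLpNorm (fun y => θ y ^ 2) 2 volume * N)) := h3
    _ ≤ C * (3 * ((C * (2 * (N * N))) * N)) := by
        gcongr
        exact h2.trans (by gcongr)
    _ = ((6 * C ^ 2 : NNReal) : ℝ≥0∞) * N ^ 3 := by push_cast; ring
    _ ≤ ((6 * C ^ 2 + 1 : NNReal) : ℝ≥0∞) * N ^ 3 := by gcongr; exact le_self_add
    _ ≤ ((6 * C ^ 2 + 1 : NNReal) : ℝ≥0∞) ^ 3 * N ^ 3 := by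
        gcongr
        exact le_self_pow₀ hL three_ne_zero
    _ = _ := (mul_pow _ _ _).symm

/-- The critical Sobolev inequality, `1/6 = 1/2 - 1/3`. -/
theorem sobolev_three : ∃ K : NNReal, ∀ θ : Space 3 → ℝ, ContDiff ℝ ∞ θ → HasCompactSupport θ →
    eLpNorm θ 6 volume
      ≤ K * max (eLpNorm θ 2 volume) (eLpNorm (fderiv ℝ θ) 2 volume) := by
  refine ⟨SNormLESNormFDerivOfEqConst ℝ (volume : Measure (Space 3)) (2 : NNReal), fun θ hθ hc => ?_⟩
  have h := eLpNorm_le_eLpNorm_fderiv_of_eq (volume : Measure (Space 3)) (u := θ) (p := 2) (p' := 6)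
    (hθ.of_le (by simp)) hc (by norm_num) (by simp) (by simp; norm_num)
  have h' : eLpNorm θ 6 volume ≤ SNormLESNormFDerivOfEqConst ℝ (volume : Measure (Space 3))
      ((2 : NNReal) : ℝ) * eLpNorm (fderiv ℝ θ) 2 volume := by exact_mod_cast h
  exact h'.trans (mul_le_mul_right (le_max_right _ _) _)

theorem sobolev (hd : d = 1 ∨ d = 2 ∨ d = 3) :
    ∃ K : NNReal, ∀ θ : Space d → ℝ, ContDiff ℝ ∞ θ → HasCompactSupport θ →
      eLpNorm θ (sobExponent d) volume
        ≤ K * max (eLpNorm θ 2 volume) (eLpNorm (fderiv ℝ θ) 2 volume) := by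
  rcases hd with rfl | rfl | rfl
  · simpa [sobExponent] using sobolev_one
  · simpa [sobExponent] using sobolev_two
  · simpa [sobExponent] using sobolev_three

/-- Hölder's inequality for the product of a potential and the square of a function. -/
theorem lintegral_mul_sq_le (d : ℕ) {V θ : Space d → ℝ} (hV : AEStronglyMeasurable V volume)
    (hθ : AEStronglyMeasurable θ volume) :
    ∫⁻ x, ‖V x‖ₑ * ‖θ x‖ₑ ^ 2
      ≤ eLpNorm V (potExponent d) volume * eLpNorm θ (sobExponent d) volume ^ 2 := by
  rw [potExponent, sobExponent]
  split_ifs with h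
  · rw [eLpNorm_one_eq_lintegral_enorm, ← lintegral_mul_const'' _ hV.enorm]
    refine lintegral_mono_ae ?_
    filter_upwards [enorm_ae_le_eLpNormEssSup θ volume] with x hx
    rw [eLpNorm_exponent_top]
    gcongr
  · have hpq : Real.HolderConjugate (3 / 2) 3 := by
      rw [Real.holderConjugate_iff]; norm_num
    have h1 := ENNReal.lintegral_mul_le_Lp_mul_Lq (volume : Measure (Space d)) hpq
      hV.enorm (hθ.enorm.pow_const 2)
    have e0 : ((3 : ℝ≥0∞) / 2).toReal = 3 / 2 := by simp
    have e1 : eLpNorm V (3 / 2) volume = (∫⁻ x, ‖V x‖ₑ ^ (3 / 2 : ℝ)) ^ (1 / (3 / 2 : ℝ)) := by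
      rw [eLpNorm_eq_lintegral_rpow_enorm_toReal (by simp) (by
        exact ENNReal.div_ne_top (by norm_num) (by norm_num)), e0]
    have e2 : eLpNorm θ 6 volume ^ 2
        = (∫⁻ x, (‖θ x‖ₑ ^ 2) ^ (3 : ℝ)) ^ (1 / (3 : ℝ)) := by
      rw [eLpNorm_eq_lintegral_rpow_enorm_toReal (by norm_num) (by norm_num), ← ENNReal.rpow_natCast,
        ← ENNReal.rpow_mul]
      have e3 : ∀ x, (‖θ x‖ₑ ^ 2) ^ (3 : ℝ) = ‖θ x‖ₑ ^ (6 : ℝ) := fun x => by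
        rw [← ENNReal.rpow_natCast, ← ENNReal.rpow_mul]; norm_num
      simp only [e3]
      norm_num
    rw [e1, e2]
    exact h1

end Sobolev

end LCAO

namespace LCAO

/-! ### Relative form bounds -/

section FormBound

variable {d : ℕ}

/-- `V` is form bounded relative to `-Δ`, with relative bound zero. -/
def IsFormBounded (V : Space d → ℝ) : Prop :=
  AEStronglyMeasurable V volume ∧ ∀ η : NNReal, 0 < η → ∃ C : NNReal, ∀ u : Space d → ℝ, MemH1 u →
    ∫⁻ x, ‖V x‖ₑ * ‖u x‖ₑ ^ 2
      ≤ η * eLpNorm (weakGrad u) 2 volume ^ 2 + C * eLpNorm u 2 volume ^ 2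

theorem lintegral_enorm_sq_eq {E : Type*} [NormedAddCommGroup E] (u : Space d → E) :
    ∫⁻ x, ‖u x‖ₑ ^ 2 = eLpNorm u 2 volume ^ 2 := by
  rw [eLpNorm_eq_lintegral_rpow_enorm_toReal (by norm_num) (by norm_num), ← ENNReal.rpow_natCast,
    ← ENNReal.rpow_mul]
  have e1 : 1 / (2 : ℝ≥0∞).toReal * ((2 : ℕ) : ℝ) = 1 := by norm_num
  have e2 : (2 : ℝ≥0∞).toReal = ((2 : ℕ) : ℝ) := by norm_num
  rw [e1, ENNReal.rpow_one, e2]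
  simp only [ENNReal.rpow_natCast]

/-- The part of `V_p` where `|V_p| ≥ M` has small `L^p` norm for large `M`; Hölder and Sobolev bound
its contribution by a small multiple of the squared `H¹` norm. What remains of `V` is bounded. One
decomposition of `V` therefore yields relative bound zero. -/
theorem MemLpAddLinftyEps.exists_bound_test (hd : d = 1 ∨ d = 2 ∨ d = 3) {V : Space d → ℝ}
    (hV : MemLpAddLinftyEps (potExponent d) V) {η : NNReal} (hη : 0 < η) :
    ∃ C : NNReal, ∀ θ : Space d → ℝ, ContDiff ℝ ∞ θ → HasCompactSupport θ →
      ∫⁻ x, ‖V x‖ₑ * ‖θ x‖ₑ ^ 2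
        ≤ η * eLpNorm (fderiv ℝ θ) 2 volume ^ 2 + C * eLpNorm θ 2 volume ^ 2 := by
  obtain ⟨K, hK⟩ := sobolev hd
  obtain ⟨Vp, Vinf, hVp, hVinf, -, hVe⟩ := hV 1 one_pos
  set V' : Space d → ℝ := hVp.1.mk Vp with hV'
  have hae : Vp =ᵐ[volume] V' := hVp.1.ae_eq_mk
  have hV'm : StronglyMeasurable V' := hVp.1.stronglyMeasurable_mk
  have hV'L : MemLp V' (potExponent d) volume := hVp.ae_eq hae
  -- Chosen so that `ε K² ≤ η`, with `K` the Sobolev constant.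
  set ε : ℝ := (η : ℝ) / (K ^ 2 + 1) with hε
  have hε0 : 0 < ε := by positivity
  obtain ⟨M, hM0, hM⟩ := hV'L.eLpNorm_indicator_norm_ge_pos_le hV'm hε0
  set T : Space d → ℝ := {x | M ≤ ‖V' x‖₊}.indicator V' with hT
  have hTm : AEStronglyMeasurable T volume :=
    (hV'm.indicator (hV'm.measurable.nnnorm.coe_nnreal_real measurableSet_Ici)).aestronglyMeasurable
  set B : ℝ≥0∞ := eLpNorm Vinf ⊤ volume with hB
  have hBt : B ≠ ⊤ := hVinf.2.ne
  refine ⟨η + M.toNNReal + B.toNNReal, fun θ hθ hc => ?_⟩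
  have hpt : ∀ᵐ x, ‖V x‖ₑ * ‖θ x‖ₑ ^ 2
      ≤ ‖T x‖ₑ * ‖θ x‖ₑ ^ 2 + (ENNReal.ofReal M + B) * ‖θ x‖ₑ ^ 2 := by
    filter_upwards [hVe, hae, enorm_ae_le_eLpNormEssSup Vinf volume] with x h1 h2 h3
    rw [← add_mul, h1, h2]
    gcongr
    refine (enorm_add_le _ _).trans ?_
    rw [← add_assoc]
    gcongr
    · by_cases hx : M ≤ ‖V' x‖₊
      · have : T x = V' x := Set.indicator_of_mem (show x ∈ {x | M ≤ ‖V' x‖₊} from hx) _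
        rw [this]; exact le_self_add
      · refine le_add_left ?_
        rw [← ofReal_norm]
        exact ENNReal.ofReal_le_ofReal (not_le.1 hx).le
    · rwa [hB, eLpNorm_exponent_top]
  have hθm : Measurable fun x => ‖θ x‖ₑ ^ 2 := hθ.continuous.enorm.measurable.pow_const 2
  have hεK : ENNReal.ofReal ε * (K : ℝ≥0∞) ^ 2 ≤ η := by
    have : ε * (K : ℝ) ^ 2 ≤ η := by
      rw [hε, div_mul_eq_mul_div, div_le_iff₀ (by positivity)]
      nlinarith [η.coe_nonneg]
    calc ENNReal.ofReal ε * (K : ℝ≥0∞) ^ 2 = ENNReal.ofReal (ε * (K : ℝ) ^ 2) := by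
          rw [ENNReal.ofReal_mul hε0.le, ENNReal.ofReal_pow K.coe_nonneg, ENNReal.ofReal_coe_nnreal]
      _ ≤ ENNReal.ofReal η := ENNReal.ofReal_le_ofReal this
      _ = η := ENNReal.ofReal_coe_nnreal
  have hmax : max (eLpNorm θ 2 volume) (eLpNorm (fderiv ℝ θ) 2 volume) ^ 2
      ≤ eLpNorm θ 2 volume ^ 2 + eLpNorm (fderiv ℝ θ) 2 volume ^ 2 := by
    rcases max_cases (eLpNorm θ 2 volume) (eLpNorm (fderiv ℝ θ) 2 volume) with h | h
    · rw [h.1]; exact le_self_add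
    · rw [h.1]; exact le_add_self
  calc ∫⁻ x, ‖V x‖ₑ * ‖θ x‖ₑ ^ 2
      ≤ ∫⁻ x, (‖T x‖ₑ * ‖θ x‖ₑ ^ 2 + (ENNReal.ofReal M + B) * ‖θ x‖ₑ ^ 2) := lintegral_mono_ae hpt
    _ = (∫⁻ x, ‖T x‖ₑ * ‖θ x‖ₑ ^ 2) + (ENNReal.ofReal M + B) * eLpNorm θ 2 volume ^ 2 := by
        rw [lintegral_add_right _ (hθm.const_mul _), lintegral_const_mul _ hθm,
          lintegral_enorm_sq_eq]
    _ ≤ ENNReal.ofReal ε * (K * max (eLpNorm θ 2 volume) (eLpNorm (fderiv ℝ θ) 2 volume)) ^ 2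
          + (ENNReal.ofReal M + B) * eLpNorm θ 2 volume ^ 2 := by
        gcongr
        refine (lintegral_mul_sq_le d hTm hθ.continuous.aestronglyMeasurable).trans ?_
        gcongr
        exact hK θ hθ hc
    _ = (ENNReal.ofReal ε * K ^ 2) * max (eLpNorm θ 2 volume) (eLpNorm (fderiv ℝ θ) 2 volume) ^ 2
          + (ENNReal.ofReal M + B) * eLpNorm θ 2 volume ^ 2 := by ring
    _ ≤ η * (eLpNorm θ 2 volume ^ 2 + eLpNorm (fderiv ℝ θ) 2 volume ^ 2)
          + (ENNReal.ofReal M + B) * eLpNorm θ 2 volume ^ 2 := by gcongr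
    _ = _ := by
        have : B = (B.toNNReal : ℝ≥0∞) := (ENNReal.coe_toNNReal hBt).symm
        rw [this, ENNReal.ofReal]
        push_cast
        simp only [ENNReal.toNNReal_coe]
        ring

theorem eLpNorm_gradient (θ : Space d → ℝ) :
    eLpNorm (gradient θ) 2 volume = eLpNorm (fderiv ℝ θ) 2 volume :=
  eLpNorm_congr_norm_ae (Filter.Eventually.of_forall fun x => norm_gradient θ x)

/-- Passes from test functions to `H¹` by density: along an almost everywhere convergent subsequence
Fatou's lemma gives the bound, without knowing beforehand that `V u²` is integrable. -/
theorem MemLpAddLinftyEps.isFormBounded (hd : d = 1 ∨ d = 2 ∨ d = 3) {V : Space d → ℝ}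
    (hV : MemLpAddLinftyEps (potExponent d) V) : IsFormBounded V := by
  have hVm : AEStronglyMeasurable V volume := by
    obtain ⟨Vp, Vinf, hVp, hVinf, -, hVe⟩ := hV 1 one_pos
    exact (hVp.1.add hVinf.1).congr hVe.symm
  refine ⟨hVm, fun η hη => ?_⟩
  obtain ⟨C, hC⟩ := hV.exists_bound_test hd hη
  refine ⟨C, fun u hu => ?_⟩
  have hu' := (memH10_univ hu).2
  have hpos : ∀ n : ℕ, (0 : ℝ≥0∞) < ((n : ℝ≥0∞) + 1)⁻¹ := fun n => by
    rw [ENNReal.inv_pos]; exact ENNReal.add_ne_top.2 ⟨ENNReal.natCast_ne_top n, by simp⟩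
  have hlim : Filter.Tendsto (fun n : ℕ => ((n : ℝ≥0∞) + 1)⁻¹) Filter.atTop (nhds 0) := by
    have := (Filter.tendsto_add_atTop_iff_nat 1).2 ENNReal.tendsto_inv_nat_nhds_zero
    simpa using this
  choose θ hθ hc hs h1 h2 using fun n : ℕ => hu' _ (hpos n)
  have ht1 : Filter.Tendsto (fun n => eLpNorm (θ n - u) 2 volume) Filter.atTop (nhds 0) := by
    refine tendsto_of_tendsto_of_tendsto_of_le_of_le tendsto_const_nhds hlim
      (fun n => zero_le) fun n => ?_
    rw [eLpNorm_sub_comm]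
    exact (h1 n).le
  obtain ⟨ns, hns, hae⟩ := (tendstoInMeasure_of_tendsto_eLpNorm_of_ne_top (by norm_num) (by norm_num)
    (fun n => (hθ n).continuous.aestronglyMeasurable) hu.1.1 ht1).exists_seq_tendsto_ae
  set D : ℕ → ℝ≥0∞ := fun n => η * (eLpNorm (weakGrad u) 2 volume + ((n : ℝ≥0∞) + 1)⁻¹) ^ 2
    + C * (eLpNorm u 2 volume + ((n : ℝ≥0∞) + 1)⁻¹) ^ 2 with hD
  have hDlim : Filter.Tendsto D Filter.atTop (nhds
      (η * eLpNorm (weakGrad u) 2 volume ^ 2 + C * eLpNorm u 2 volume ^ 2)) := by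
    have e : ∀ a : ℝ≥0∞, ∀ c : NNReal, Filter.Tendsto
        (fun n : ℕ => (c : ℝ≥0∞) * (a + ((n : ℝ≥0∞) + 1)⁻¹) ^ 2) Filter.atTop (nhds (c * a ^ 2)) :=
      fun a c => by
        have h := (tendsto_const_nhds (x := a)).add hlim
        rw [add_zero] at h
        exact ENNReal.Tendsto.const_mul (ENNReal.Tendsto.pow h) (Or.inr ENNReal.coe_ne_top)
    exact (e _ _).add (e _ _)
  have hbound : ∀ n, ∫⁻ x, ‖V x‖ₑ * ‖θ n x‖ₑ ^ 2 ≤ D n := fun n => by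
    refine (hC _ (hθ n) (hc n)).trans ?_
    simp only [hD, ← eLpNorm_gradient]
    have a1 : eLpNorm (gradient (θ n)) 2 volume
        ≤ eLpNorm (weakGrad u) 2 volume + ((n : ℝ≥0∞) + 1)⁻¹ := by
      have e : gradient (θ n) = weakGrad u - fun x => weakGrad u x - gradient (θ n) x := by
        ext1 x; simp
      calc eLpNorm (gradient (θ n)) 2 volume
          = eLpNorm (weakGrad u - fun x => weakGrad u x - gradient (θ n) x) 2 volume := by rw [← e]
        _ ≤ _ := eLpNorm_sub_le hu.memLp_weakGrad.1
            (hu.memLp_weakGrad.1.sub (continuous_gradient (hθ n)).aestronglyMeasurable)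
            (by norm_num)
        _ ≤ _ := by gcongr; exact (h2 n).le
    have a2 : eLpNorm (θ n) 2 volume ≤ eLpNorm u 2 volume + ((n : ℝ≥0∞) + 1)⁻¹ := by
      have e : θ n = u - fun x => u x - θ n x := by ext1 x; simp
      calc eLpNorm (θ n) 2 volume = eLpNorm (u - fun x => u x - θ n x) 2 volume := by rw [← e]
        _ ≤ _ := eLpNorm_sub_le hu.1.1
            (hu.1.1.sub (hθ n).continuous.aestronglyMeasurable) (by norm_num)
        _ ≤ _ := by gcongr; exact (h1 n).le
    gcongr
  have hfatou : ∫⁻ x, ‖V x‖ₑ * ‖u x‖ₑ ^ 2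
      ≤ Filter.liminf (fun n => ∫⁻ x, ‖V x‖ₑ * ‖θ (ns n) x‖ₑ ^ 2) Filter.atTop := by
    refine le_trans (lintegral_mono_ae ?_) (lintegral_liminf_le' fun n =>
      hVm.enorm.mul ((hθ (ns n)).continuous.enorm.measurable.pow_const 2).aemeasurable)
    filter_upwards [hae] with x hx
    have h := ENNReal.Tendsto.const_mul (a := ‖V x‖ₑ) (ENNReal.Tendsto.pow (n := 2) hx.enorm) (Or.inr enorm_ne_top)
    exact h.liminf_eq.ge
  refine hfatou.trans ?_
  rw [← (hDlim.comp hns.tendsto_atTop).liminf_eq]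
  exact Filter.liminf_le_liminf (Filter.Eventually.of_forall fun n => hbound (ns n))

theorem MemLpAddLinftyEps.comp_sub_right {p : ℝ≥0∞} {V : Space d → ℝ} (hV : MemLpAddLinftyEps p V)
    (R : Space d) : MemLpAddLinftyEps p fun x => V (x - R) := fun ε hε => by
  obtain ⟨Vp, Vinf, hVp, hVinf, hle, hVe⟩ := hV ε hε
  have hm : MeasurePreserving (fun x : Space d => x - R) volume volume :=
    measurePreserving_sub_right volume R
  refine ⟨fun x => Vp (x - R), fun x => Vinf (x - R), hVp.comp_measurePreserving hm,
    hVinf.comp_measurePreserving hm, ?_, hm.quasiMeasurePreserving.ae hVe⟩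
  exact (eLpNorm_comp_measurePreserving hVinf.1 hm).trans_le hle

theorem isFormBounded_const (c : ℝ) : IsFormBounded fun _ : Space d => c := by
  refine ⟨aestronglyMeasurable_const, fun η hη => ⟨‖c‖₊, fun u hu => ?_⟩⟩
  rw [lintegral_const_mul' _ _ enorm_ne_top, lintegral_enorm_sq_eq]
  exact le_add_self

theorem IsFormBounded.add {V V' : Space d → ℝ} (hV : IsFormBounded V) (hV' : IsFormBounded V') :
    IsFormBounded fun x => V x + V' x := by
  refine ⟨hV.1.add hV'.1, fun η hη => ?_⟩
  obtain ⟨C, hC⟩ := hV.2 (η / 2) (half_pos hη)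
  obtain ⟨C', hC'⟩ := hV'.2 (η / 2) (half_pos hη)
  refine ⟨C + C', fun u hu => ?_⟩
  calc ∫⁻ x, ‖V x + V' x‖ₑ * ‖u x‖ₑ ^ 2
      ≤ ∫⁻ x, (‖V x‖ₑ * ‖u x‖ₑ ^ 2 + ‖V' x‖ₑ * ‖u x‖ₑ ^ 2) := lintegral_mono fun x => by
        rw [← add_mul]; gcongr; exact enorm_add_le _ _
    _ = (∫⁻ x, ‖V x‖ₑ * ‖u x‖ₑ ^ 2) + ∫⁻ x, ‖V' x‖ₑ * ‖u x‖ₑ ^ 2 :=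
        lintegral_add_left' (hV.1.enorm.mul (hu.1.1.enorm.pow_const 2)) _
    _ ≤ _ := add_le_add (hC u hu) (hC' u hu)
    _ = ((η / 2 + η / 2 : NNReal) : ℝ≥0∞) * eLpNorm (weakGrad u) 2 volume ^ 2
          + ((C + C' : NNReal) : ℝ≥0∞) * eLpNorm u 2 volume ^ 2 := by push_cast; ring
    _ = _ := by rw [add_halves]

theorem isFormBounded_sum {ι : Type*} (S : Finset ι) {V : ι → Space d → ℝ}
    (hV : ∀ k, IsFormBounded (V k)) : IsFormBounded fun x => ∑ k ∈ S, V k x := by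
  classical
  induction S using Finset.induction_on with
  | empty => simpa using isFormBounded_const 0
  | insert a S ha ih =>
    simp only [Finset.sum_insert ha]
    exact (hV a).add ih

section Molecule

variable {K : ℕ} {W : ℝ → ℝ}

theorem isFormBounded_atomPot (hd : d = 1 ∨ d = 2 ∨ d = 3)
    (hW : MemLpAddLinftyEps (potExponent d) fun x : Space d => W ‖x‖) (R : Fin K → Space d)
    (k : Fin K) : IsFormBounded (atomPot W R k) :=
  (hW.comp_sub_right (R k)).isFormBounded hd

theorem isFormBounded_molPot (hd : d = 1 ∨ d = 2 ∨ d = 3)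
    (hW : MemLpAddLinftyEps (potExponent d) fun x : Space d => W ‖x‖) (R : Fin K → Space d)
    (s : ℝ) : IsFormBounded (molPot W R s) :=
  (isFormBounded_sum Finset.univ (isFormBounded_atomPot hd hW R)).add (isFormBounded_const s)

end Molecule

theorem IsFormBounded.integrable_mul_sq {V : Space d → ℝ} (hV : IsFormBounded V) {u : Space d → ℝ}
    (hu : MemH1 u) : Integrable fun x => V x * u x ^ 2 := by
  obtain ⟨C, hC⟩ := hV.2 1 one_pos
  refine ⟨hV.1.mul (hu.1.1.pow 2), ?_⟩
  refine lt_of_le_of_lt ?_ (lt_of_le_of_lt (hC u hu) ?_)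
  · exact lintegral_mono fun x => by rw [enorm_mul, enorm_pow]
  · exact ENNReal.add_lt_top.2 ⟨ENNReal.mul_lt_top (by simp) (ENNReal.pow_lt_top hu.memLp_weakGrad.2),
      ENNReal.mul_lt_top (by simp) (ENNReal.pow_lt_top hu.1.2)⟩

theorem IsFormBounded.integrable_mul_mul {V : Space d → ℝ} (hV : IsFormBounded V)
    {u v : Space d → ℝ} (hu : MemH1 u) (hv : MemH1 v) : Integrable fun x => V x * u x * v x := by
  have h := ((hV.integrable_mul_sq hu).norm.add (hV.integrable_mul_sq hv).norm)
  refine h.mono ((hV.1.mul hu.1.1).mul hv.1.1) (Filter.Eventually.of_forall fun x => ?_)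
  simp only [Pi.add_apply, norm_mul, norm_pow, Real.norm_eq_abs]
  refine le_trans ?_ (le_abs_self _)
  rw [← mul_add, mul_assoc]
  gcongr
  nlinarith [sq_nonneg (|u x| - |v x|), sq_nonneg (|u x|), sq_nonneg (|v x|)]

/-- The real form of the relative form bound. -/
theorem IsFormBounded.exists_integral_le {V : Space d → ℝ} (hV : IsFormBounded V) {η : ℝ}
    (hη : 0 < η) : ∃ C : ℝ, 0 ≤ C ∧ ∀ u : Space d → ℝ, MemH1 u →
      ∫ x, |V x| * u x ^ 2
        ≤ η * (eLpNorm (weakGrad u) 2 volume).toReal ^ 2 + C * (eLpNorm u 2 volume).toReal ^ 2 := by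
  obtain ⟨C, hC⟩ := hV.2 η.toNNReal (Real.toNNReal_pos.2 hη)
  refine ⟨C, C.coe_nonneg, fun u hu => ?_⟩
  have hf1 : eLpNorm (weakGrad u) 2 volume ≠ ⊤ := hu.memLp_weakGrad.2.ne
  have hf2 : eLpNorm u 2 volume ≠ ⊤ := hu.1.2.ne
  rw [integral_eq_lintegral_of_nonneg_ae (f := fun x => |V x| * u x ^ 2)
    (Filter.Eventually.of_forall fun x => by simp only [Pi.zero_apply]; positivity)
    ((hV.1.norm).mul (hu.1.1.pow 2))]
  have e : ∀ x, ENNReal.ofReal (|V x| * u x ^ 2) = ‖V x‖ₑ * ‖u x‖ₑ ^ 2 := fun x => by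
    rw [ENNReal.ofReal_mul (abs_nonneg _), ← sq_abs, ENNReal.ofReal_pow (abs_nonneg _),
      ← Real.norm_eq_abs, ← Real.norm_eq_abs, ofReal_norm, ofReal_norm]
  simp only [e]
  have h := ENNReal.toReal_mono ?_ (hC u hu)
  · refine h.trans_eq ?_
    rw [ENNReal.toReal_add, ENNReal.toReal_mul, ENNReal.toReal_mul, ENNReal.toReal_pow,
      ENNReal.toReal_pow]
    · simp [hη.le]
    · exact ENNReal.mul_ne_top (by simp) (ENNReal.pow_ne_top hf1)
    · exact ENNReal.mul_ne_top (by simp) (ENNReal.pow_ne_top hf2)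
  · exact ENNReal.add_ne_top.2 ⟨ENNReal.mul_ne_top (by simp) (ENNReal.pow_ne_top hf1),
      ENNReal.mul_ne_top (by simp) (ENNReal.pow_ne_top hf2)⟩

end FormBound

end LCAO

namespace LCAO

/-! ### The Sobolev space as a Banach space, and the bilinear form on it -/

section SobolevSpace

variable {d : ℕ}

/-- The Hilbert space of square integrable vector fields. -/
noncomputable abbrev L2v (d : ℕ) := Lp (Space d) 2 (volume : Measure (Space d))

theorem locallyIntegrable_coeFn {E : Type*} [NormedAddCommGroup E]
    (f : Lp E 2 (volume : Measure (Space d))) : LocallyIntegrable f volume :=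
  locallyIntegrable_of_memLp (Lp.memLp f)

/-- `H¹(ℝ^d)` as the space of pairs of a function and its weak gradient. -/
noncomputable def H1 (d : ℕ) : Submodule ℝ (L2 d × L2v d) where
  carrier := {z | IsWeakGrad z.1 z.2}
  add_mem' {a b} ha hb := by
    refine (IsWeakGrad.add ha hb (locallyIntegrable_coeFn _) (locallyIntegrable_coeFn _)
      (locallyIntegrable_coeFn _) (locallyIntegrable_coeFn _)).congr ?_ ?_
    · exact (Lp.coeFn_add _ _).symm
    · exact (Lp.coeFn_add _ _).symm
  zero_mem' := by
    have h : IsWeakGrad (fun _ : Space d => (0 : ℝ)) fun _ => 0 := fun θ _ _ => by simp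
    exact h.congr (Lp.coeFn_zero _ _ _).symm (Lp.coeFn_zero _ _ _).symm
  smul_mem' c a ha := by
    refine (IsWeakGrad.const_smul ha c).congr ?_ ?_
    · filter_upwards [Lp.coeFn_smul c a.1] with x hx
      exact hx.symm
    · filter_upwards [Lp.coeFn_smul c a.2] with x hx
      exact hx.symm

theorem memLp_smul_const {θ : Space d → ℝ} (hθ : ContDiff ℝ ∞ θ) (hc : HasCompactSupport θ)
    (e : Space d) : MemLp (fun x => θ x • e) 2 volume :=
  memLp_of_test (f := fun x => θ x • e) (hθ.continuous.smul continuous_const) hc.smul_right 2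

/-- Expresses the weak gradient relation through functionals that are continuous in `(f, g)` for the
`L²` norms, so that it defines a closed subspace. -/
theorem isWeakGrad_iff_inner (f : L2 d) (g : L2v d) :
    IsWeakGrad f g ↔ ∀ (θ : Space d → ℝ) (hθ : ContDiff ℝ ∞ θ) (hc : HasCompactSupport θ)
      (e : Space d),
      inner ℝ ((((memLp_of_test (continuous_gradient hθ) (hasCompactSupport_gradient hc) 2).const_inner
          (𝕜 := ℝ) e).toLp _ : L2 d)) f
        + inner ℝ ((memLp_smul_const hθ hc e).toLp _ : L2v d) g = 0 := by
  have h1 : ∀ (θ : Space d → ℝ) (hθ : ContDiff ℝ ∞ θ) (hc : HasCompactSupport θ) (e : Space d),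
      inner ℝ ((((memLp_of_test (continuous_gradient hθ) (hasCompactSupport_gradient hc) 2).const_inner
        (𝕜 := ℝ) e).toLp _ : L2 d)) f = inner ℝ e (∫ x, f x • gradient θ x) := fun θ hθ hc e => by
    rw [← integral_inner (integrable_smul_gradient (locallyIntegrable_coeFn f) hθ hc), L2.inner_def]
    refine integral_congr_ae ?_
    filter_upwards [((memLp_of_test (continuous_gradient hθ) (hasCompactSupport_gradient hc)
      2).const_inner (𝕜 := ℝ) e).coeFn_toLp] with x hx
    rw [hx, inner_smul_right]
    simp
  have h2 : ∀ (θ : Space d → ℝ) (hθ : ContDiff ℝ ∞ θ) (hc : HasCompactSupport θ) (e : Space d),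
      inner ℝ ((memLp_smul_const hθ hc e).toLp _ : L2v d) g
        = inner ℝ e (∫ x, θ x • g x) := fun θ hθ hc e => by
    rw [← integral_inner (integrable_test_smul (locallyIntegrable_coeFn g) hθ.continuous hc),
      L2.inner_def]
    refine integral_congr_ae ?_
    filter_upwards [(memLp_smul_const hθ hc e).coeFn_toLp] with x hx
    rw [hx, inner_smul_right, real_inner_smul_left]
  constructor
  · intro h θ hθ hc e
    rw [h1 θ hθ hc, h2 θ hθ hc, h θ hθ hc, ← inner_add_right, neg_add_cancel, inner_zero_right]
  · intro h θ hθ hc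
    refine eq_neg_of_add_eq_zero_left (ext_inner_left ℝ fun e => ?_)
    rw [inner_zero_right, inner_add_right, ← h1 θ hθ hc, ← h2 θ hθ hc]
    exact h θ hθ hc e

theorem isClosed_H1 (d : ℕ) : IsClosed (H1 d : Set (L2 d × L2v d)) := by
  have : (H1 d : Set (L2 d × L2v d)) = {z | IsWeakGrad z.1 z.2} := rfl
  rw [this]
  simp only [isWeakGrad_iff_inner, Set.ofPred_forall]
  refine isClosed_iInter fun θ => isClosed_iInter fun hθ => isClosed_iInter fun hc =>
    isClosed_iInter fun e => isClosed_eq ?_ continuous_const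
  fun_prop

instance : CompleteSpace (H1 d) := (isClosed_H1 d).completeSpace_coe

namespace H1

theorem isWeakGrad (x : H1 d) : IsWeakGrad x.1.1 x.1.2 := x.2

theorem memH1 (x : H1 d) : MemH1 x.1.1 := (isWeakGrad x).memH1 (Lp.memLp _) (Lp.memLp _)

theorem weakGrad_ae_eq (x : H1 d) : weakGrad x.1.1 =ᵐ[volume] x.1.2 :=
  (isWeakGrad x).weakGrad_ae_eq (Lp.memLp _) (Lp.memLp _)

/-- The element of `H1 d` given by a function in `H¹`. -/
noncomputable def of {u : Space d → ℝ} (hu : MemH1 u) : H1 d :=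
  ⟨(hu.1.toLp u, hu.memLp_weakGrad.toLp _),
    hu.isWeakGrad.congr hu.1.coeFn_toLp.symm hu.memLp_weakGrad.coeFn_toLp.symm⟩

theorem of_ae_eq {u : Space d → ℝ} (hu : MemH1 u) : (of hu).1.1 =ᵐ[volume] u := hu.1.coeFn_toLp

theorem of_fst (u : L2 d) (hu : MemH1 u) : (of hu).1.1 = u := Lp.toLp_coeFn u (Lp.memLp u)

theorem ext_fst {x y : H1 d} (h : x.1.1 = y.1.1) : x = y := by
  refine Subtype.ext (Prod.ext h (Lp.ext ?_))
  refine (weakGrad_ae_eq x).symm.trans ?_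
  have h' : weakGrad x.1.1 = weakGrad y.1.1 := by rw [h]
  rw [h']
  exact (weakGrad_ae_eq y)

theorem norm_fst_le (x : H1 d) : ‖x.1.1‖ ≤ ‖x‖ := _root_.norm_fst_le x.1

theorem norm_snd_le (x : H1 d) : ‖x.1.2‖ ≤ ‖x‖ := _root_.norm_snd_le x.1

/-- The norm inherited from the product is the maximum of the two `L²` norms. It makes `H1 d` a
Banach space, and the Hilbert structure is supplied later by the energy form. -/
theorem norm_sq_le (x : H1 d) : ‖x‖ ^ 2 ≤ ‖x.1.1‖ ^ 2 + ‖x.1.2‖ ^ 2 := by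
  have : ‖x‖ = max ‖x.1.1‖ ‖x.1.2‖ := rfl
  rw [this]
  rcases max_cases ‖x.1.1‖ ‖x.1.2‖ with h | h <;> rw [h.1] <;> nlinarith [sq_nonneg ‖x.1.1‖, sq_nonneg ‖x.1.2‖]

theorem toReal_eLpNorm_weakGrad (x : H1 d) :
    (eLpNorm (weakGrad x.1.1) 2 volume).toReal = ‖x.1.2‖ := by
  rw [eLpNorm_congr_ae (weakGrad_ae_eq x), ← Lp.norm_def]

end H1

theorem form_congr {U : Space d → ℝ} {u u' v v' : Space d → ℝ} (hu : u =ᵐ[volume] u')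
    (hv : v =ᵐ[volume] v') : form U u v = form U u' v' := by
  rw [form, form]
  congr 1
  · congr 1
    refine integral_congr_ae ?_
    filter_upwards [weakGrad_congr hu, weakGrad_congr hv] with x h1 h2
    rw [h1, h2]
  · refine integral_congr_ae ?_
    filter_upwards [hu, hv] with x h1 h2
    rw [h1, h2]

theorem form_eq_inner (U : Space d → ℝ) (x y : H1 d) :
    form U x.1.1 y.1.1 = (1 / 2) * inner ℝ x.1.2 y.1.2 + ∫ a, U a * x.1.1 a * y.1.1 a := by
  rw [form, L2.inner_def]
  congr 2
  refine integral_congr_ae ?_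
  filter_upwards [H1.weakGrad_ae_eq x, H1.weakGrad_ae_eq y] with a h1 h2
  rw [h1, h2]

theorem form_symm (U : Space d → ℝ) (u v : Space d → ℝ) : form U u v = form U v u := by
  rw [form, form]
  congr 2
  · exact integral_congr_ae (Filter.Eventually.of_forall fun x =>
      real_inner_comm (weakGrad v x) (weakGrad u x))
  · ext1 x
    ring

/-- By homogeneity it is enough to use the bound on unit vectors. -/
theorem abs_le_mul_of_sq_bound {E : Type*} [NormedAddCommGroup E] [NormedSpace ℝ E]
    (b : E →ₗ[ℝ] E →ₗ[ℝ] ℝ) {C : ℝ} (h : ∀ x y, |b x y| ≤ C * (‖x‖ ^ 2 + ‖y‖ ^ 2)) (x y : E) :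
    ‖b x y‖ ≤ 2 * C * ‖x‖ * ‖y‖ := by
  rcases eq_or_ne x 0 with rfl | hx
  · simp
  rcases eq_or_ne y 0 with rfl | hy
  · simp
  have hx0 : 0 < ‖x‖ := norm_pos_iff.2 hx
  have hy0 : 0 < ‖y‖ := norm_pos_iff.2 hy
  have h1 := h (‖x‖⁻¹ • x) (‖y‖⁻¹ • y)
  simp only [map_smul, LinearMap.smul_apply, smul_eq_mul, abs_mul, norm_smul, norm_inv, norm_norm,
    abs_inv, abs_norm, inv_mul_cancel₀ hx0.ne', inv_mul_cancel₀ hy0.ne'] at h1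
  rw [inv_mul_le_iff₀ hy0, inv_mul_le_iff₀ hx0] at h1
  rw [Real.norm_eq_abs]
  linarith

theorem IsFormBounded.exists_form_bound {U : Space d → ℝ} (hU : IsFormBounded U) {η : ℝ}
    (hη : 0 < η) : ∃ C : ℝ, 0 ≤ C ∧ ∀ x : H1 d,
      ∫ a, |U a| * x.1.1 a ^ 2 ≤ η * ‖x.1.2‖ ^ 2 + C * ‖x.1.1‖ ^ 2 := by
  obtain ⟨C, hC0, hC⟩ := hU.exists_integral_le hη
  refine ⟨C, hC0, fun x => (hC _ (H1.memH1 x)).trans_eq ?_⟩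
  rw [H1.toReal_eLpNorm_weakGrad, ← Lp.norm_def]

theorem IsFormBounded.integrable_abs {U : Space d → ℝ} (hU : IsFormBounded U) {u : Space d → ℝ}
    (hu : MemH1 u) : Integrable fun a => |U a| * u a ^ 2 := by
  refine (hU.integrable_mul_sq hu).norm.congr (Filter.Eventually.of_forall fun a => ?_)
  simp

theorem IsFormBounded.abs_integral_mul_le {U : Space d → ℝ} (hU : IsFormBounded U)
    {u v : Space d → ℝ} (hu : MemH1 u) (hv : MemH1 v) :
    |∫ a, U a * u a * v a| ≤ 2⁻¹ * (∫ a, |U a| * u a ^ 2) + 2⁻¹ * ∫ a, |U a| * v a ^ 2 := by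
  have iu := (hU.integrable_abs hu).const_mul 2⁻¹
  have iv := (hU.integrable_abs hv).const_mul 2⁻¹
  rw [← integral_const_mul, ← integral_const_mul, ← integral_add iu iv]
  refine abs_integral_le_integral_abs.trans (integral_mono_ae
    (hU.integrable_mul_mul hu hv).abs (iu.add iv) (Filter.Eventually.of_forall fun a => ?_))
  simp only [abs_mul]
  have h3 : |u a| * |v a| ≤ 2⁻¹ * u a ^ 2 + 2⁻¹ * v a ^ 2 := by
    rw [← sq_abs (u a), ← sq_abs (v a)]
    nlinarith [sq_nonneg (|u a| - |v a|)]
  have h4 := mul_le_mul_of_nonneg_left h3 (abs_nonneg (U a))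
  rw [mul_assoc]
  linarith

theorem integral_mul_add {U : Space d → ℝ} (hU : IsFormBounded U) (x y z : H1 d) :
    ∫ a, U a * (x + y).1.1 a * z.1.1 a
      = (∫ a, U a * x.1.1 a * z.1.1 a) + ∫ a, U a * y.1.1 a * z.1.1 a := by
  rw [← integral_add (hU.integrable_mul_mul (H1.memH1 x) (H1.memH1 z))
    (hU.integrable_mul_mul (H1.memH1 y) (H1.memH1 z))]
  refine integral_congr_ae ?_
  filter_upwards [Lp.coeFn_add x.1.1 y.1.1] with a ha
  have : (x + y).1.1 a = x.1.1 a + y.1.1 a := ha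
  rw [this]
  ring

theorem integral_mul_smul (U : Space d → ℝ) (c : ℝ) (x z : H1 d) :
    ∫ a, U a * (c • x).1.1 a * z.1.1 a = c * ∫ a, U a * x.1.1 a * z.1.1 a := by
  rw [← integral_const_mul]
  refine integral_congr_ae ?_
  filter_upwards [Lp.coeFn_smul c x.1.1] with a ha
  have : (c • x).1.1 a = c * x.1.1 a := ha
  rw [this]
  ring

theorem form_add_left {U : Space d → ℝ} (hU : IsFormBounded U) (x y z : H1 d) :
    form U (x + y).1.1 z.1.1 = form U x.1.1 z.1.1 + form U y.1.1 z.1.1 := by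
  rw [form_eq_inner, form_eq_inner, form_eq_inner, integral_mul_add hU]
  have : inner ℝ (x + y).1.2 z.1.2 = inner ℝ x.1.2 z.1.2 + inner ℝ y.1.2 z.1.2 :=
    inner_add_left _ _ _
  rw [this]
  ring

theorem form_smul_left (U : Space d → ℝ) (c : ℝ) (x z : H1 d) :
    form U (c • x).1.1 z.1.1 = c * form U x.1.1 z.1.1 := by
  rw [form_eq_inner, form_eq_inner, integral_mul_smul]
  have : inner ℝ (c • x).1.2 z.1.2 = c * inner ℝ x.1.2 z.1.2 := real_inner_smul_left _ _ _
  rw [this]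
  ring

theorem IsFormBounded.exists_abs_form_le {U : Space d → ℝ} (hU : IsFormBounded U) :
    ∃ C : ℝ, ∀ x y : H1 d, |form U x.1.1 y.1.1| ≤ C * (‖x‖ ^ 2 + ‖y‖ ^ 2) := by
  obtain ⟨C, hC0, hC⟩ := hU.exists_form_bound one_pos
  refine ⟨1 + C, fun x y => ?_⟩
  have h1 : |form U x.1.1 y.1.1|
      ≤ |(1 / 2) * inner ℝ x.1.2 y.1.2| + |∫ a, U a * x.1.1 a * y.1.1 a| := by
    rw [form_eq_inner]
    exact abs_add_le _ _
  have h2 := hU.abs_integral_mul_le (H1.memH1 x) (H1.memH1 y)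
  have h4 := hC x
  have h5 := hC y
  have h6 : |(1 / 2) * inner ℝ x.1.2 y.1.2| ≤ 2⁻¹ * (‖x.1.2‖ * ‖y.1.2‖) := by
    rw [abs_mul, abs_of_pos (by norm_num : (0 : ℝ) < 1 / 2), one_div]
    gcongr
    exact abs_real_inner_le_norm _ _
  have arith : ∀ {F A B P Q X Y p q s t : ℝ}, F ≤ A + B → B ≤ 2⁻¹ * P + 2⁻¹ * Q →
      P ≤ 1 * s ^ 2 + C * p ^ 2 → Q ≤ 1 * t ^ 2 + C * q ^ 2 → A ≤ 2⁻¹ * (s * t) →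
      p ^ 2 ≤ X ^ 2 → s ^ 2 ≤ X ^ 2 → q ^ 2 ≤ Y ^ 2 → t ^ 2 ≤ Y ^ 2 →
      F ≤ (1 + C) * (X ^ 2 + Y ^ 2) := fun {F A B P Q X Y p q s t} h1 h2 h3 h4 h5 h6 h7 h8 h9 => by
    have x3 := mul_le_mul_of_nonneg_left h6 hC0
    have y3 := mul_le_mul_of_nonneg_left h8 hC0
    have x4 := mul_nonneg hC0 (sq_nonneg X)
    have y4 := mul_nonneg hC0 (sq_nonneg Y)
    have h10 := sq_nonneg (s - t)
    linarith [sq_nonneg X, sq_nonneg Y]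
  exact arith h1 h2 h4 h5 h6
    (pow_le_pow_left₀ (norm_nonneg _) (H1.norm_fst_le x) 2)
    (pow_le_pow_left₀ (norm_nonneg _) (H1.norm_snd_le x) 2)
    (pow_le_pow_left₀ (norm_nonneg _) (H1.norm_fst_le y) 2)
    (pow_le_pow_left₀ (norm_nonneg _) (H1.norm_snd_le y) 2)

/-- The form of a form bounded potential is a bounded bilinear form on `H¹`. -/
theorem IsFormBounded.exists_bilin {U : Space d → ℝ} (hU : IsFormBounded U) :
    ∃ B : H1 d →L[ℝ] H1 d →L[ℝ] ℝ, ∀ x y, B x y = form U x.1.1 y.1.1 := by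
  obtain ⟨C, hC⟩ := hU.exists_abs_form_le
  have h1 : ∀ x y z : H1 d, form U x.1.1 (y + z).1.1 = form U x.1.1 y.1.1 + form U x.1.1 z.1.1 :=
    fun x y z => (form_symm U _ _).trans ((form_add_left hU y z x).trans
      (congrArg₂ (· + ·) (form_symm U _ _) (form_symm U _ _)))
  have h2 : ∀ (c : ℝ) (x y : H1 d), form U x.1.1 (c • y).1.1 = c * form U x.1.1 y.1.1 :=
    fun c x y => (form_symm U _ _).trans ((form_smul_left U c y x).trans
      (congrArg (c * ·) (form_symm U _ _)))
  let b : H1 d →ₗ[ℝ] H1 d →ₗ[ℝ] ℝ := LinearMap.mk₂ ℝ (fun x y => form U x.1.1 y.1.1)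
    (form_add_left hU) (form_smul_left U) h1 h2
  exact ⟨b.mkContinuous₂ (2 * C) (abs_le_mul_of_sq_bound b hC), fun x y => rfl⟩

/-- Gårding's inequality upgrades coercivity with respect to `L²` to coercivity with respect to
`H¹`. -/
theorem IsFormBounded.exists_coercive {U : Space d → ℝ} (hU : IsFormBounded U) {α : ℝ} (hα : 0 < α) :
    ∃ c : ℝ, 0 < c ∧ ∀ x : H1 d, α * ‖x.1.1‖ ^ 2 ≤ form U x.1.1 x.1.1 →
      c * ‖x‖ ^ 2 ≤ form U x.1.1 x.1.1 := by
  -- Half of the kinetic energy `½ ‖∇u‖²` is spent on the potential. The lost multiple `C + 1/4` of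
  -- `‖u‖²` is recovered from `L²` coercivity at the price of the factor `1 + (C + 1/4) / α`.
  obtain ⟨C, hC0, hC⟩ := hU.exists_form_bound (by norm_num : (0 : ℝ) < 1 / 4)
  have hD : 0 < 1 + (C + 1 / 4) / α := by positivity
  refine ⟨(1 / 4) / (1 + (C + 1 / 4) / α), by positivity, fun x hx => ?_⟩
  rw [div_mul_eq_mul_div, div_le_iff₀ hD]
  have h1 : (1 / 4) * ‖x.1.2‖ ^ 2 - C * ‖x.1.1‖ ^ 2 ≤ form U x.1.1 x.1.1 := by
    rw [form_eq_inner, real_inner_self_eq_norm_sq]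
    have h2 : -(∫ a, |U a| * x.1.1 a ^ 2) ≤ ∫ a, U a * x.1.1 a * x.1.1 a := by
      rw [← integral_neg]
      refine integral_mono_ae (hU.integrable_abs (H1.memH1 x)).neg
        (hU.integrable_mul_mul (H1.memH1 x) (H1.memH1 x)) (Filter.Eventually.of_forall fun a => ?_)
      simp only []
      nlinarith [neg_abs_le (U a), sq_nonneg (x.1.1 a)]
    have h3 := hC x
    linarith
  have h4 : (C + 1 / 4) * ‖x.1.1‖ ^ 2 ≤ form U x.1.1 x.1.1 * ((C + 1 / 4) / α) := by
    rw [mul_div_assoc', le_div_iff₀ hα]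
    nlinarith
  have h5 := H1.norm_sq_le x
  nlinarith

end SobolevSpace

end LCAO

namespace LCAO

/-! ### Energy spaces -/

section EnergySpace

universe u

/-- A Banach space with a coercive symmetric bounded bilinear form is isomorphic to a Hilbert space
with this form as scalar product. -/
theorem exists_hilbert_of_coercive {H : Type u} [NormedAddCommGroup H] [NormedSpace ℝ H]
    [CompleteSpace H] (B : H →L[ℝ] H →L[ℝ] ℝ) (hB : ∀ x y, B x y = B y x) {c : ℝ} (hc : 0 < c)
    (hBc : ∀ x, c * ‖x‖ ^ 2 ≤ B x x) :
    ∃ (V : Type u) (_ : NormedAddCommGroup V) (_ : InnerProductSpace ℝ V) (_ : CompleteSpace V)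
      (e : V ≃L[ℝ] H), ∀ v w, inner ℝ v w = B (e v) (e w) := by
  -- The scalar product is placed on a type `F` with only a linear structure, so that its norm does
  -- not clash with that of `H`; at the end `F` is `H` itself.
  let core (F : Type u) (i1 : AddCommGroup F) (i2 : Module ℝ F) (e : F ≃ₗ[ℝ] H) :
      InnerProductSpace.Core ℝ F :=
    { inner := fun v w => B (e v) (e w)
      conj_inner_symm := fun v w => hB _ _
      re_inner_nonneg := fun v => (mul_nonneg hc.le (sq_nonneg _)).trans (hBc (e v))
      add_left := fun x y z => by simp
      smul_left := fun x y r => by simp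
      definite := fun x hx => by
        have h1 := hBc (e x)
        have h2 : B (e x) (e x) = 0 := hx
        have h3 : ‖e x‖ ^ 2 ≤ 0 := by rw [h2] at h1; exact nonpos_of_mul_nonpos_right h1 hc
        have h4 : e x = 0 := by
          rw [← norm_eq_zero]; exact pow_eq_zero_iff two_ne_zero |>.1 (le_antisymm h3 (sq_nonneg _))
        exact (map_eq_zero_iff e e.injective).1 h4 }
  have key : ∀ (F : Type u) (i1 : AddCommGroup F) (i2 : Module ℝ F) (e : F ≃ₗ[ℝ] H),
      ∃ (V : Type u) (_ : NormedAddCommGroup V) (_ : InnerProductSpace ℝ V) (_ : CompleteSpace V)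
        (e : V ≃L[ℝ] H), ∀ v w, inner ℝ v w = B (e v) (e w) := fun F i1 i2 e => by
    let := core F i1 i2 e
    let n1 : NormedAddCommGroup F := InnerProductSpace.Core.toNormedAddCommGroup (𝕜 := ℝ)
    let n2 : InnerProductSpace ℝ F := InnerProductSpace.ofCore (core F i1 i2 e).toCore
    have hin : ∀ v w : F, inner ℝ v w = B (e v) (e w) := fun v w => rfl
    have hsq : ∀ v : F, ‖v‖ ^ 2 = B (e v) (e v) := fun v => by
      rw [← real_inner_self_eq_norm_sq, hin]
    have h1 : ∀ v : F, ‖e v‖ ≤ (√c)⁻¹ * ‖v‖ := fun v => by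
      rw [← div_eq_inv_mul, le_div_iff₀ (Real.sqrt_pos.2 hc)]
      refine (pow_le_pow_iff_left₀ (by positivity) (norm_nonneg _) two_ne_zero).1 ?_
      rw [mul_pow, Real.sq_sqrt hc.le, hsq, mul_comm]
      exact hBc _
    have h2 : ∀ x : H, ‖e.symm x‖ ≤ √‖B‖ * ‖x‖ := fun x => by
      refine (pow_le_pow_iff_left₀ (norm_nonneg _) (by positivity) two_ne_zero).1 ?_
      rw [mul_pow, Real.sq_sqrt (norm_nonneg B), hsq, e.apply_symm_apply, sq ‖x‖, ← mul_assoc]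
      exact (Real.le_norm_self _).trans (B.le_opNorm₂ x x)
    let e' : F ≃L[ℝ] H := e.toContinuousLinearEquivOfBounds _ _ h1 h2
    exact ⟨F, n1, n2, (completeSpace_congr (e := e'.toEquiv) e'.isUniformEmbedding).2 inferInstance, e', hin⟩
  exact key H inferInstance inferInstance (LinearEquiv.refl ℝ H)

/-- A closed subspace on which a symmetric bounded bilinear form is coercive is the image of a
Hilbert space with this form as scalar product. -/
theorem exists_hilbert_of_coercive_on {H : Type u} [NormedAddCommGroup H] [NormedSpace ℝ H]
    [CompleteSpace H] (B : H →L[ℝ] H →L[ℝ] ℝ) (hB : ∀ x y, B x y = B y x) {S : Submodule ℝ H}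
    (hS : IsClosed (S : Set H)) {c : ℝ} (hc : 0 < c) (hBc : ∀ x ∈ S, c * ‖x‖ ^ 2 ≤ B x x) :
    ∃ (V : Type u) (_ : NormedAddCommGroup V) (_ : InnerProductSpace ℝ V) (_ : CompleteSpace V)
      (J : V →L[ℝ] H), Function.Injective J ∧ (∀ x, x ∈ S ↔ ∃ v, J v = x) ∧
        ∀ v w, inner ℝ v w = B (J v) (J w) := by
  have : CompleteSpace S := hS.completeSpace_coe
  let B' : S →L[ℝ] S →L[ℝ] ℝ := (ContinuousLinearMap.compL ℝ S H ℝ).flip S.subtypeL ∘L B ∘L S.subtypeL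
  have hB' : ∀ x y : S, B' x y = B x y := fun x y => rfl
  obtain ⟨V, i1, i2, i3, e, he⟩ := exists_hilbert_of_coercive B'
    (fun x y => by rw [hB', hB', hB]) hc (fun x => by rw [hB']; exact hBc x x.2)
  refine ⟨V, i1, i2, i3, S.subtypeL ∘L (e : V →L[ℝ] S), ?_, fun x => ⟨fun hx => ?_, ?_⟩, fun v w => ?_⟩
  · exact Subtype.val_injective.comp e.injective
  · exact ⟨e.symm ⟨x, hx⟩, by simp⟩
  · rintro ⟨v, rfl⟩
    exact (e v).2
  · rw [he, hB']
    rfl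

/-- The Riesz representation theorem and the Cauchy–Schwarz inequality for a form that is coercive
on a closed subspace. -/
theorem exists_representer_of_coercive_on {H : Type u} [NormedAddCommGroup H] [NormedSpace ℝ H]
    [CompleteSpace H] (B : H →L[ℝ] H →L[ℝ] ℝ) (hB : ∀ x y, B x y = B y x) {S : Submodule ℝ H}
    (hS : IsClosed (S : Set H)) {c : ℝ} (hc : 0 < c) (hBc : ∀ x ∈ S, c * ‖x‖ ^ 2 ≤ B x x)
    (L : H →L[ℝ] ℝ) :
    (∃ u ∈ S, ∀ w ∈ S, B u w = L w) ∧
      ∀ u ∈ S, ∀ w ∈ S, |B u w| ≤ √(B u u) * √(B w w) := by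
  obtain ⟨V, i1, i2, i3, J, -, hJ, hin⟩ := exists_hilbert_of_coercive_on B hB hS hc hBc
  constructor
  · set v := (InnerProductSpace.toDual ℝ V).symm (L ∘L J) with hv
    refine ⟨J v, (hJ _).2 ⟨v, rfl⟩, fun w hw => ?_⟩
    obtain ⟨w, rfl⟩ := (hJ _).1 hw
    rw [← hin, hv, InnerProductSpace.toDual_symm_apply]
    rfl
  · intro u hu w hw
    obtain ⟨u, rfl⟩ := (hJ _).1 hu
    obtain ⟨w, rfl⟩ := (hJ _).1 hw
    rw [← hin, ← hin, ← hin, real_inner_self_eq_norm_sq, real_inner_self_eq_norm_sq,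
      Real.sqrt_sq (norm_nonneg _), Real.sqrt_sq (norm_nonneg _)]
    exact abs_real_inner_le_norm _ _

end EnergySpace

/-! ### The energy space of the operator, `H¹₀`, and dual norms. -/

section FormSpace

variable {d : ℕ}

/-- The inclusion of `H¹` into `L²`. -/
noncomputable def H1.toL2 (d : ℕ) : H1 d →L[ℝ] L2 d :=
  (ContinuousLinearMap.fst ℝ (L2 d) (L2v d)) ∘L (H1 d).subtypeL

theorem H1.toL2_apply (x : H1 d) : H1.toL2 d x = x.1.1 := rfl

set_option maxHeartbeats 800000 in
/-- The energy space of a coercive Schrödinger operator. -/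
theorem IsFormBounded.exists_isEnergyEmbedding {U : Space d → ℝ} (hU : IsFormBounded U)
    (hco : Coercive MemH1 U) :
    ∃ (V : Type) (_ : NormedAddCommGroup V) (_ : InnerProductSpace ℝ V) (_ : CompleteSpace V)
      (J : V →L[ℝ] L2 d) (e : V ≃L[ℝ] H1 d), IsEnergyEmbedding U J ∧ (∀ v, J v = (e v).1.1) ∧
        ∀ v w, inner ℝ v w = form U (J v) (J w) := by
  obtain ⟨B, hB⟩ := hU.exists_bilin
  obtain ⟨α, hα, hα'⟩ := hco
  obtain ⟨c, hc, hcx⟩ := hU.exists_coercive hα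
  have hsymm : ∀ x y, B x y = B y x := fun x y => by rw [hB, hB]; exact form_symm _ _ _
  have hpos : ∀ x, c * ‖x‖ ^ 2 ≤ B x x := fun x => by
    rw [hB]; exact hcx _ (hα' _ (H1.memH1 x))
  obtain ⟨V, i1, i2, i3, e, he⟩ := exists_hilbert_of_coercive B hsymm hc hpos
  obtain ⟨J, hJ⟩ : ∃ J : V →L[ℝ] L2 d, ∀ v, J v = (e v).1.1 :=
    ⟨(H1.toL2 d) ∘L (e : V →L[ℝ] H1 d), fun v => H1.toL2_apply (e v)⟩
  have hin : ∀ v w, inner ℝ v w = form U (J v) (J w) := fun v w => by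
    rw [hJ, hJ]
    exact (he v w).trans (hB _ _)
  have hlift : ∀ u : L2 d, MemH1 u → ∃ v, J v = u := fun u hu =>
    ⟨e.symm (H1.of hu), by rw [hJ, e.apply_symm_apply, H1.of_fst]⟩
  have hmem : ∀ v, MemH1 (J v) := fun v => by rw [hJ]; exact H1.memH1 (e v)
  refine ⟨V, i1, i2, i3, J, e, ⟨fun v w h => ?_, fun μ f u => ⟨?_, ?_⟩⟩, hJ, hin⟩
  · rw [hJ, hJ] at h
    exact e.injective (H1.ext_fst h)
  · rintro ⟨hu, h⟩
    obtain ⟨v, rfl⟩ := hlift u hu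
    refine ⟨v, rfl, fun w => ?_⟩
    rw [hin]
    exact h _ (hmem w)
  · rintro ⟨v, rfl, h⟩
    refine ⟨hmem v, fun w hw => ?_⟩
    obtain ⟨w, rfl⟩ := hlift w hw
    rw [← hin]
    exact h w

/-- The two inequalities with a common `ε` in `MemH10` describe a ball for the maximum norm of `H1
d`, so membership is closure of the test functions in that norm. -/
theorem memH10_iff_mem_closure (Ω : Set (Space d)) (x : H1 d) :
    MemH10 Ω x.1.1 ↔ x ∈ closure {y : H1 d | ∃ θ : Space d → ℝ, ContDiff ℝ ∞ θ ∧
      HasCompactSupport θ ∧ tsupport θ ⊆ Ω ∧ y.1.1 =ᵐ[volume] θ} := by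
  have hdist : ∀ (y : H1 d) (θ : Space d → ℝ), ContDiff ℝ ∞ θ → HasCompactSupport θ →
      y.1.1 =ᵐ[volume] θ → edist x y
        = max (eLpNorm (fun a => x.1.1 a - θ a) 2 volume)
          (eLpNorm (fun a => weakGrad x.1.1 a - gradient θ a) 2 volume) := fun y θ hθ hc hy => by
    have : edist x y = max (edist x.1.1 y.1.1) (edist x.1.2 y.1.2) := rfl
    rw [this, Lp.edist_def, Lp.edist_def]
    congr 1
    · refine eLpNorm_congr_ae ?_
      filter_upwards [hy] with a ha
      simp only [Pi.sub_apply, ha]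
    · refine eLpNorm_congr_ae ?_
      filter_upwards [H1.weakGrad_ae_eq x, H1.weakGrad_ae_eq y, weakGrad_congr hy,
        weakGrad_test hθ hc] with a h1 h2 h3 h4
      simp only [Pi.sub_apply, h1, ← h2, h3, h4]
  rw [EMetric.mem_closure_iff]
  constructor
  · rintro ⟨-, h⟩ ε hε
    obtain ⟨θ, hθ, hc, hs, h1, h2⟩ := h ε hε
    have hy := H1.of_ae_eq (memH1_test hθ hc)
    refine ⟨H1.of (memH1_test hθ hc), ⟨θ, hθ, hc, hs, hy⟩, ?_⟩
    rw [hdist _ θ hθ hc hy]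
    exact max_lt h1 h2
  · intro h
    refine ⟨H1.memH1 x, fun ε hε => ?_⟩
    obtain ⟨y, ⟨θ, hθ, hc, hs, hy⟩, h1⟩ := h ε hε
    rw [hdist _ θ hθ hc hy] at h1
    exact ⟨θ, hθ, hc, hs, (max_lt_iff.1 h1).1, (max_lt_iff.1 h1).2⟩

/-- `H¹₀(Ω)` as a subspace of `H¹`. -/
noncomputable def H10 (Ω : Set (Space d)) : Submodule ℝ (H1 d) := Submodule.topologicalClosure
  { carrier := {y : H1 d | ∃ θ : Space d → ℝ, ContDiff ℝ ∞ θ ∧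
      HasCompactSupport θ ∧ tsupport θ ⊆ Ω ∧ y.1.1 =ᵐ[volume] θ}
    add_mem' := by
      rintro x y ⟨θ, hθ, hc, hs, hx⟩ ⟨η, hη, hd, ht, hy⟩
      refine ⟨θ + η, hθ.add hη, hc.add hd,
        (tsupport_add θ η).trans (Set.union_subset hs ht), ?_⟩
      exact (Lp.coeFn_add x.1.1 y.1.1).trans (hx.add hy)
    zero_mem' := ⟨0, contDiff_const, HasCompactSupport.zero, by simp [tsupport],
      Lp.coeFn_zero _ _ _⟩
    smul_mem' := by
      rintro c x ⟨θ, hθ, hc, hs, hx⟩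
      refine ⟨c • θ, contDiff_const.smul hθ, hc.smul_left (f := fun _ => c),
        (tsupport_smul_subset_right (fun _ => c) θ).trans hs, ?_⟩
      exact (Lp.coeFn_smul c x.1.1).trans (hx.const_smul c) }

theorem mem_H10 {Ω : Set (Space d)} {x : H1 d} : x ∈ H10 Ω ↔ MemH10 Ω x.1.1 :=
  (memH10_iff_mem_closure Ω x).symm

theorem isClosed_H10 (Ω : Set (Space d)) : IsClosed (H10 Ω : Set (H1 d)) :=
  Submodule.isClosed_topologicalClosure _

set_option maxHeartbeats 800000 in
/-- The dual norm of a continuous functional on a closed subspace of `H¹` on which the form is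
coercive. -/
theorem abs_le_dualNormSq {U : Space d → ℝ} (hU : IsFormBounded U)
    {D : (Space d → ℝ) → Prop} (hD : ∀ u : L2 d, D u → MemH1 u) {S : Submodule ℝ (H1 d)}
    (hS : IsClosed (S : Set (H1 d))) (hSD : ∀ x : H1 d, x ∈ S ↔ D x.1.1) (hco : Coercive D U)
    {ℓ : (Space d → ℝ) → ℝ} (L : H1 d →L[ℝ] ℝ) (hL : ∀ x : H1 d, L x = ℓ x.1.1) :
    0 ≤ dualNormSq D U ℓ ∧ ∀ w : L2 d, D w →
      0 ≤ form U w w ∧ |ℓ w| ≤ √(dualNormSq D U ℓ) * √(form U w w) := by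
  obtain ⟨B, hB⟩ := hU.exists_bilin
  obtain ⟨α, hα, hα'⟩ := hco
  obtain ⟨c, hc, hcx⟩ := hU.exists_coercive hα
  have hsymm : ∀ x y, B x y = B y x := fun x y => by rw [hB, hB]; exact form_symm _ _ _
  have hpos : ∀ x ∈ S, c * ‖x‖ ^ 2 ≤ B x x := fun x hx => by
    rw [hB]; exact hcx _ (hα' _ ((hSD x).1 hx))
  obtain ⟨⟨u, hu, hu'⟩, hcs⟩ := exists_representer_of_coercive_on B hsymm hS hc hpos L
  have hlift : ∀ u : L2 d, D u → ∃ x ∈ S, x.1.1 = u := fun u hu =>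
    ⟨H1.of (hD u hu), (hSD _).2 (by rwa [H1.of_fst]), H1.of_fst u (hD u hu)⟩
  have hex : ∃ u : L2 d, D u ∧ ∀ w : L2 d, D w → form U u w = ℓ w := by
    refine ⟨u.1.1, (hSD _).1 hu, fun w hw => ?_⟩
    obtain ⟨x, hx, rfl⟩ := hlift w hw
    rw [← hB, hu' x hx, hL]
  have hval : dualNormSq D U ℓ = ℓ hex.choose := by rw [dualNormSq, dif_pos hex]
  obtain ⟨hv, hv'⟩ := hex.choose_spec
  generalize hex.choose = v at hval hv hv'
  obtain ⟨x, hx, rfl⟩ := hlift v hv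
  have hx0 : ∀ x ∈ S, 0 ≤ B x x := fun x hx => (mul_nonneg hc.le (sq_nonneg _)).trans (hpos x hx)
  -- With `v` representing `ℓ`, the squared dual norm is `ℓ v = ⟨v, A v⟩`, and the claim is
  -- Cauchy–Schwarz for the form.
  rw [← hv' _ hv, ← hB] at hval
  refine ⟨hval ▸ hx0 x hx, fun w hw => ?_⟩
  obtain ⟨y, hy, rfl⟩ := hlift w hw
  rw [← hv' _ hw, hval, ← hB, ← hB]
  exact ⟨hx0 y hy, hcs x hx y hy⟩

end FormSpace

end LCAO

namespace LCAO

/-! ### Localization by a partition of unity -/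

section Partition

variable {d : ℕ}

theorem contDiff_two_of_smooth {f : Space d → ℝ} (hf : ContDiff ℝ ∞ f) : ContDiff ℝ 2 f := by
  exact_mod_cast contDiff_infty.1 hf 2

theorem laplacian_sum {ι : Type*} (S : Finset ι) {p : ι → Space d → ℝ}
    (hp : ∀ k, ContDiff ℝ ∞ (p k)) (x : Space d) :
    Laplacian.laplacian (fun y => ∑ k ∈ S, p k y) x = ∑ k ∈ S, Laplacian.laplacian (p k) x := by
  classical
  induction S using Finset.induction_on with
  | empty => simp
  | insert a S ha ih =>
    have h1 : ContDiffAt ℝ 2 (p a) x := (contDiff_two_of_smooth (hp a)).contDiffAt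
    have h2 : ContDiffAt ℝ 2 (fun y => ∑ k ∈ S, p k y) x :=
      (ContDiff.sum fun k _ => contDiff_two_of_smooth (hp k)).contDiffAt
    simp only [Finset.sum_insert ha]
    rw [← ih]
    exact h1.laplacian_add h2

theorem sum_laplacian_eq_zero {ι : Type*} [Fintype ι] {p : ι → Space d → ℝ}
    (hp : ∀ k, ContDiff ℝ ∞ (p k)) (h1 : ∀ x, ∑ k, p k x = 1) (x : Space d) :
    ∑ k, Laplacian.laplacian (p k) x = 0 := by
  rw [← laplacian_sum _ hp]
  simp [h1]

theorem sum_gradient_eq_zero {ι : Type*} [Fintype ι] {p : ι → Space d → ℝ}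
    (hp : ∀ k, ContDiff ℝ ∞ (p k)) (h1 : ∀ x, ∑ k, p k x = 1) (x : Space d) :
    ∑ k, gradient (p k) x = 0 := by
  have h : ∑ k, fderiv ℝ (p k) x = 0 := by
    rw [← fderiv_fun_sum fun k _ => (hp k).differentiable (by simp) x]
    simp [h1]
  simp only [gradient_eq_symm_fderiv, ← map_sum, h, map_zero]

theorem IsFormBounded.integrable_form {U : Space d → ℝ} (hU : IsFormBounded U) {u : Space d → ℝ}
    (hu : MemH1 u) : Integrable fun x => (1 / 2) * ‖weakGrad u x‖ ^ 2 + U x * u x ^ 2 :=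
  (hu.memLp_weakGrad.norm.integrable_sq.const_mul _).add (hU.integrable_mul_sq hu)

theorem IsFormBounded.form_self_eq {U : Space d → ℝ} (hU : IsFormBounded U) {u : Space d → ℝ}
    (hu : MemH1 u) :
    form U u u = ∫ x, ((1 / 2) * ‖weakGrad u x‖ ^ 2 + U x * u x ^ 2) := by
  rw [integral_add (hu.memLp_weakGrad.norm.integrable_sq.const_mul _) (hU.integrable_mul_sq hu),
    integral_const_mul, form]
  simp only [real_inner_self_eq_norm_sq, mul_assoc, ← sq]

/-- A linear map is continuous if it is bounded for a weaker norm. -/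
theorem continuous_of_norm_le {E F : Type*} [NormedAddCommGroup E] [NormedSpace ℝ E]
    [CompleteSpace E] [NormedAddCommGroup F] [NormedSpace ℝ F] (ι : E →L[ℝ] F)
    (hι : Function.Injective ι) (T : E →ₗ[ℝ] E) (hT : ∀ x, ‖ι (T x)‖ ≤ ‖ι x‖) : Continuous T := by
  refine T.continuous_of_seq_closed_graph fun u x y hu hTu => hι ?_
  have h1 : Filter.Tendsto (fun n => ι (T (u n))) Filter.atTop (nhds (ι y)) :=
    (ι.continuous.tendsto y).comp hTu
  have h2 : Filter.Tendsto (fun n => ι (T (u n))) Filter.atTop (nhds (ι (T x))) := by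
    rw [tendsto_iff_norm_sub_tendsto_zero]
    refine squeeze_zero (fun _ => norm_nonneg _) (fun n => ?_)
      (tendsto_iff_norm_sub_tendsto_zero.1 ((ι.continuous.tendsto x).comp hu))
    rw [← map_sub, ← map_sub, Function.comp_apply, ← map_sub]
    exact hT _
  exact tendsto_nhds_unique h1 h2

set_option maxHeartbeats 800000 in
/-- Multiplication by `√p` as a bounded operator on `H¹`. -/
theorem exists_sqrt_mul {p : Space d → ℝ} (hp1 : ∀ x, p x ≤ 1)
    (hmem : ∀ v : L2 d, MemH1 v → MemH1 fun x => √(p x) * v x) :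
    ∃ T : H1 d →L[ℝ] H1 d, ∀ x : H1 d, (T x).1.1 =ᵐ[volume] fun a => √(p a) * x.1.1 a := by
  have hT : ∀ x : H1 d, (H1.of (hmem _ (H1.memH1 x))).1.1 =ᵐ[volume] fun a => √(p a) * x.1.1 a :=
    fun x => H1.of_ae_eq _
  let T : H1 d →ₗ[ℝ] H1 d :=
    { toFun := fun x => H1.of (hmem _ (H1.memH1 x))
      map_add' := fun x y => H1.ext_fst <| Lp.ext <| by
        filter_upwards [hT x, hT y, hT (x + y), Lp.coeFn_add x.1.1 y.1.1,
          Lp.coeFn_add (H1.of (hmem _ (H1.memH1 x))).1.1 (H1.of (hmem _ (H1.memH1 y))).1.1]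
          with a h1 h2 h3 h4 h5
        refine h3.trans (Eq.trans ?_ h5.symm)
        have h4' : (x + y).1.1 a = x.1.1 a + y.1.1 a := h4
        rw [Pi.add_apply, h1, h2, h4', mul_add]
      map_smul' := fun c x => H1.ext_fst <| Lp.ext <| by
        filter_upwards [hT x, hT (c • x), Lp.coeFn_smul c x.1.1,
          Lp.coeFn_smul c (H1.of (hmem _ (H1.memH1 x))).1.1] with a h1 h3 h4 h5
        refine h3.trans (Eq.trans ?_ h5.symm)
        have h4' : (c • x).1.1 a = c * x.1.1 a := h4
        rw [Pi.smul_apply, h1, h4', smul_eq_mul]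
        ring }
  have hTx : ∀ x, (T x).1.1 =ᵐ[volume] fun a => √(p a) * x.1.1 a := hT
  -- Only membership of `√p v` in `H¹` is assumed, with no bound. Continuity on `H¹` follows from
  -- the closed graph theorem, since multiplication by `√p` is a contraction in `L²`.
  have hnorm : ∀ x, ‖H1.toL2 d (T x)‖ ≤ ‖H1.toL2 d x‖ := fun x => by
    refine Lp.norm_le_norm_of_ae_le ?_
    filter_upwards [hTx x] with a ha
    rw [H1.toL2_apply, H1.toL2_apply, ha, norm_mul, Real.norm_of_nonneg (Real.sqrt_nonneg _)]
    exact mul_le_of_le_one_left (norm_nonneg _) (Real.sqrt_le_one.2 (hp1 a))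
  exact ⟨⟨T, continuous_of_norm_le (H1.toL2 d) (fun x y h => H1.ext_fst h) T hnorm⟩, hTx⟩

/-- The pointwise identity behind the IMS localization formula. -/
theorem half_norm_sq_localized {E : Type*} [NormedAddCommGroup E] [InnerProductSpace ℝ E]
    {p v : ℝ} {g h : E} (hp : 0 ≤ p) (hh : p = 0 → h = 0) :
    (1 / 2) * ‖√p • g + (v / (2 * √p)) • h‖ ^ 2
      = (1 / 2) * p * ‖g‖ ^ 2 + (1 / 2) * v * inner ℝ g h + v ^ 2 * (‖h‖ ^ 2 / (8 * p)) := by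
  rcases hp.eq_or_lt with h0 | h0
  · rw [hh h0.symm, ← h0]
    simp
  · have hs : 0 < √p := Real.sqrt_pos.2 h0
    have hsp : √p ^ 2 = p := Real.sq_sqrt hp
    rw [norm_add_sq_real, norm_smul, norm_smul, inner_smul_left, inner_smul_right, mul_pow, mul_pow,
      Real.norm_eq_abs, Real.norm_eq_abs, sq_abs, sq_abs, hsp, div_pow, mul_pow, hsp]
    simp only [conj_trivial]
    field_simp
    ring

end Partition

/-! ### The IMS localization of the energy. -/

section Localization

variable {d K : ℕ} {W : ℝ → ℝ} {R : Fin K → Space d} {s : ℝ} {sk : Fin (K + 1) → ℝ}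
  {r : Fin K → ℝ} {Ωlast : Set (Space d)} {p : Fin (K + 1) → Space d → ℝ}

/-- The potential of the `k`-th local operator; the last one is free. -/
noncomputable def localPot (W : ℝ → ℝ) (R : Fin K → Space d) (sk : Fin (K + 1) → ℝ) :
    Fin (K + 1) → Space d → ℝ :=
  Fin.snoc (α := fun _ => Space d → ℝ) (fun k x => atomPot W R k x + sk k.castSucc)
    fun _ => sk (Fin.last K)

theorem localPot_castSucc (k : Fin K) :
    localPot W R sk k.castSucc = fun x => atomPot W R k x + sk k.castSucc := by
  simp [localPot]

theorem localPot_last : localPot W R sk (Fin.last K) = fun _ => sk (Fin.last K) := by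
  simp [localPot]

theorem sum_localPot_mul (q : Fin (K + 1) → ℝ) (x : Space d) :
    ∑ k, localPot W R sk k x * q k
      = (∑ k : Fin K, atomPot W R k x * q k.castSucc) + ∑ k, sk k * q k := by
  rw [Fin.sum_univ_castSucc, Fin.sum_univ_castSucc (f := fun k => sk k * q k)]
  simp only [localPot_castSucc, localPot_last, add_mul, Finset.sum_add_distrib, add_assoc]

theorem isFormBounded_localPot (hd : d = 1 ∨ d = 2 ∨ d = 3)
    (hW : MemLpAddLinftyEps (potExponent d) fun x : Space d => W ‖x‖) (k : Fin (K + 1)) :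
    IsFormBounded (localPot W R sk k) := by
  refine Fin.lastCases ?_ (fun k => ?_) k
  · rw [localPot_last]
    exact isFormBounded_const _
  · rw [localPot_castSucc]
    exact (isFormBounded_atomPot hd hW R k).add (isFormBounded_const _)

/-- The energies of the localized functions add up to at most `C` times the energy. -/
theorem sum_form_localized_le (hd : d = 1 ∨ d = 2 ∨ d = 3)
    (hW : MemLpAddLinftyEps (potExponent d) fun x : Space d => W ‖x‖)
    (hp : IsAdaptedPartition R r Ωlast p) (hC : localizationSup W R s sk p ≠ ⊤) {v : L2 d}
    (hv : MemH1 v) :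
    ∑ k, form (localPot W R sk k) (fun x => √(p k x) * v x) (fun x => √(p k x) * v x)
      ≤ form (molPot W R s) v v + (localizationSup W R s sk p).toReal * ‖v‖ ^ 2 := by
  set M := (localizationSup W R s sk p).toReal with hM
  have hmem : ∀ k, MemH1 fun x => √(p k x) * v x := fun k => hp.sqrt_mul_memH1 k v hv
  have hloc : ∀ k, IsFormBounded (localPot W R sk k) := isFormBounded_localPot hd hW
  have hmol := isFormBounded_molPot hd hW R s
  have hsum : ∑ k, form (localPot W R sk k) (fun x => √(p k x) * v x) (fun x => √(p k x) * v x)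
      = ∫ x, ∑ k, ((1 / 2) * ‖weakGrad (fun x => √(p k x) * v x) x‖ ^ 2
          + localPot W R sk k x * (√(p k x) * v x) ^ 2) := by
    rw [integral_finsetSum _ fun k _ => (hloc k).integrable_form (hmem k)]
    exact Finset.sum_congr rfl fun k _ => (hloc k).form_self_eq (hmem k)
  have hnorm : ‖v‖ ^ 2 = ∫ x, v x ^ 2 := by
    rw [← real_inner_self_eq_norm_sq, L2.inner_def]
    simp only [real_inner_self_eq_norm_sq, Real.norm_eq_abs, sq_abs]
  have hv2 : Integrable fun x => v x ^ 2 := hv.1.integrable_sq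
  rw [hsum, hmol.form_self_eq hv, hnorm, ← integral_const_mul,
    ← integral_add (hmol.integrable_form hv) (hv2.const_mul M)]
  refine integral_mono_ae
    (integrable_finsetSum _ fun k _ => (hloc k).integrable_form (hmem k))
    ((hmol.integrable_form hv).add (hv2.const_mul M)) ?_
  have hgrad : ∀ᵐ x, ∀ k, weakGrad (fun x => √(p k x) * v x) x
      = √(p k x) • weakGrad v x + (v x / (2 * √(p k x))) • gradient (p k) x :=
    ae_all_iff.2 fun k =>
      (weakGrad_sqrt_mul (hp.smooth k) (hp.nonneg k) (hp.le_one k) hv (hmem k)).2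
  filter_upwards [hgrad, ENNReal.ae_le_essSup
    (fun x => ENNReal.ofReal (localizationFun W R s sk p x))] with x h1 h2
  have h3 : localizationFun W R s sk p x ≤ M := (ENNReal.ofReal_le_iff_le_toReal hC).1 h2
  have h4 : ∀ k, (1 / 2) * ‖weakGrad (fun x => √(p k x) * v x) x‖ ^ 2
      = (1 / 2) * ‖weakGrad v x‖ ^ 2 * p k x
        + (1 / 2) * v x * inner ℝ (weakGrad v x) (gradient (p k) x)
        + v x ^ 2 * (‖gradient (p k) x‖ ^ 2 / (8 * p k x)) := fun k => by
    rw [h1 k, half_norm_sq_localized (hp.nonneg k x)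
      fun h => gradient_eq_zero_of_nonneg (hp.nonneg k) h]
    ring
  have h5 : ∀ k, localPot W R sk k x * (√(p k x) * v x) ^ 2
      = v x ^ 2 * (localPot W R sk k x * p k x) := fun k => by
    rw [mul_pow, Real.sq_sqrt (hp.nonneg k x)]
    ring
  -- The mixed terms cancel because `∑ ∇p_k = 0`. Only `|∇p_k|² / (8 p_k)` and the change of
  -- potential survive.
  simp only [h4, h5, Finset.sum_add_distrib, ← Finset.mul_sum, ← inner_sum, hp.sum_eq_one x,
    sum_gradient_eq_zero hp.smooth hp.sum_eq_one, sum_localPot_mul, inner_zero_right]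
  -- The Laplacians in `localizationFun` add up to zero, so the function is exactly the coefficient
  -- of `v²` left over.
  have h6 : localizationFun W R s sk p x
      = (∑ k, ‖gradient (p k) x‖ ^ 2 / (8 * p k x)) + ((∑ k, sk k * p k x) - s)
        + ((∑ k : Fin K, atomPot W R k x * p k.castSucc x) - ∑ k : Fin K, atomPot W R k x) := by
    simp only [localizationFun, Finset.sum_add_distrib, sub_mul, Finset.sum_sub_distrib, mul_sub,
      mul_one, ← Finset.mul_sum, hp.sum_eq_one x,
      sum_laplacian_eq_zero hp.smooth hp.sum_eq_one x]
    ring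
  have h7 := mul_le_mul_of_nonneg_left h3 (sq_nonneg (v x))
  rw [h6] at h7
  rw [molPot]
  linarith

end Localization

end LCAO

namespace LCAO

/-! ### The residual and its localized dual norms. -/

section LocalizedResidual

variable {d K : ℕ} {W : ℝ → ℝ} {R : Fin K → Space d} {s : ℝ} {sk : Fin (K + 1) → ℝ}
  {r : Fin K → ℝ} {Ωlast : Set (Space d)} {p : Fin (K + 1) → Space d → ℝ}

/-- The residual as a functional on `H¹`. -/
theorem IsFormBounded.exists_residual {U : Space d → ℝ} (hU : IsFormBounded U) (lam : ℝ) {φ : L2 d}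
    (hφ : MemH1 φ) :
    ∃ L : H1 d →L[ℝ] ℝ, ∀ x : H1 d, L x = lam * inner ℝ φ x.1.1 - form U φ x.1.1 := by
  obtain ⟨B, hB⟩ := hU.exists_bilin
  refine ⟨lam • (innerSL ℝ φ ∘L H1.toL2 d) - B (H1.of hφ), fun x => ?_⟩
  exact congrArg (lam * inner ℝ φ x.1.1 - ·)
    ((hB (H1.of hφ) x).trans (form_congr (H1.of_ae_eq hφ) Filter.EventuallyEq.rfl))

/-- The local contributions to `r_i²`. -/
noncomputable def localDualNormSq (W : ℝ → ℝ) (R : Fin K → Space d) (r : Fin K → ℝ) (s : ℝ)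
    (sk : Fin (K + 1) → ℝ) (p : Fin (K + 1) → Space d → ℝ) (lam : ℝ) (φ : Space d → ℝ) :
    Fin (K + 1) → ℝ :=
  Fin.snoc (α := fun _ => ℝ) (fun k => dualNormSq (MemH10 (Metric.ball (R k) (r k)))
      (fun x => atomPot W R k x + sk k.castSucc)
      (residualPairing (molPot W R s) lam φ fun x => Real.sqrt (p k.castSucc x)))
    (dualNormSq MemH1 (fun _ => sk (Fin.last K))
      (residualPairing (molPot W R s) lam φ fun x => Real.sqrt (p (Fin.last K) x)))

theorem localDualNormSq_castSucc (lam : ℝ) (φ : Space d → ℝ) (k : Fin K) :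
    localDualNormSq W R r s sk p lam φ k.castSucc
      = dualNormSq (MemH10 (Metric.ball (R k) (r k)))
        (fun x => atomPot W R k x + sk k.castSucc)
        (residualPairing (molPot W R s) lam φ fun x => Real.sqrt (p k.castSucc x)) := by
  simp [localDualNormSq]

theorem localDualNormSq_last (lam : ℝ) (φ : Space d → ℝ) :
    localDualNormSq W R r s sk p lam φ (Fin.last K)
      = dualNormSq MemH1 (fun _ => sk (Fin.last K))
        (residualPairing (molPot W R s) lam φ fun x => Real.sqrt (p (Fin.last K) x)) := by
  simp [localDualNormSq]

theorem localizedResidualSq_eq_sum (lam : ℝ) (φ : Space d → ℝ) :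
    localizedResidualSq W R r s sk p lam φ = ∑ k, localDualNormSq W R r s sk p lam φ k := by
  rw [localizedResidualSq, Fin.sum_univ_castSucc, localDualNormSq_last]
  simp only [localDualNormSq_castSucc]

/-- Treats the balls and the whole space alike. On a ball the point is that `√p_k v` is admissible
for the local form domain `H¹₀`, by `memH10_sqrt_mul`. -/
theorem abs_residual_le (hd : d = 1 ∨ d = 2 ∨ d = 3)
    (hW : MemLpAddLinftyEps (potExponent d) fun x : Space d => W ‖x‖)
    (hp : IsAdaptedPartition R r Ωlast p)
    (hAk : ∀ k : Fin K, Coercive (MemH10 (Metric.ball (R k) (r k)))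
      fun x => atomPot W R k x + sk k.castSucc)
    (hAlast : Coercive MemH1 fun _ : Space d => sk (Fin.last K)) {lam : ℝ} {φ : Space d → ℝ}
    (k : Fin (K + 1)) (L : H1 d →L[ℝ] ℝ)
    (hL : ∀ x : H1 d, L x = residualPairing (molPot W R s) lam φ (fun a => √(p k a)) x.1.1)
    {v w : L2 d} (hv : MemH1 v) (hw : w =ᵐ[volume] fun x => √(p k x) * v x) :
    0 ≤ localDualNormSq W R r s sk p lam φ k ∧ 0 ≤ form (localPot W R sk k) w w ∧
      |residualPairing (molPot W R s) lam φ (fun a => √(p k a)) w|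
        ≤ √(localDualNormSq W R r s sk p lam φ k) * √(form (localPot W R sk k) w w) := by
  have hmem := hp.sqrt_mul_memH1 k v hv
  have hU := isFormBounded_localPot (R := R) (sk := sk) hd hW k
  induction k using Fin.lastCases with
  | last =>
    rw [localPot_last] at hU ⊢
    rw [localDualNormSq_last]
    have h := abs_le_dualNormSq hU (fun u hu => hu) (S := ⊤) isClosed_univ
      (fun x => ⟨fun _ => H1.memH1 x, fun _ => Submodule.mem_top⟩) hAlast L hL
    exact ⟨h.1, h.2 w (hmem.congr hw.symm)⟩
  | cast k =>
    rw [localPot_castSucc] at hU ⊢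
    rw [localDualNormSq_castSucc]
    have h := abs_le_dualNormSq hU (fun u hu => hu.1) (isClosed_H10 _) (fun x => mem_H10)
      (hAk k) L hL
    exact ⟨h.1, h.2 w ((memH10_sqrt_mul (hp.smooth _) (hp.nonneg _) (hp.le_one _) hv hmem
      (hp.radius_pos k) (hp.support_ball k)).congr hw.symm)⟩

/-- Cauchy–Schwarz over `k` gives `t² ≤ (∑ D_k)(∑ F_k) ≤ (∑ D_k) C t`, and a factor `t` is
cancelled. In the application `t` is the squared dual norm of the residual, the `ℓ_k` its localized
parts, and the `F_k` the local energies. -/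
theorem le_mul_sum_of_abs_le {ι : Type*} [Fintype ι] {D F ℓ : ι → ℝ} {t C : ℝ} (hC : 0 ≤ C)
    (ht : 0 ≤ t) (hsum : t = ∑ k, ℓ k)
    (h : ∀ k, 0 ≤ D k ∧ 0 ≤ F k ∧ |ℓ k| ≤ √(D k) * √(F k)) (hF : ∑ k, F k ≤ C * t) :
    t ≤ C * ∑ k, D k := by
  have h1 : t ≤ √(∑ k, D k) * √(∑ k, F k) := hsum.trans_le <|
    (Finset.sum_le_sum fun k _ => (le_abs_self _).trans (h k).2.2).trans
      (Real.sum_sqrt_mul_sqrt_le _ (fun k => (h k).1) fun k => (h k).2.1)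
  have hD0 : 0 ≤ ∑ k, D k := Finset.sum_nonneg fun k _ => (h k).1
  have hF0 : 0 ≤ ∑ k, F k := Finset.sum_nonneg fun k _ => (h k).2.1
  rcases ht.eq_or_lt with h0 | h0
  · rw [← h0]
    exact mul_nonneg hC hD0
  · refine le_of_mul_le_mul_right ?_ h0
    calc t * t ≤ (√(∑ k, D k) * √(∑ k, F k)) * (√(∑ k, D k) * √(∑ k, F k)) := by gcongr
      _ = (∑ k, D k) * ∑ k, F k := by
          rw [mul_mul_mul_comm, Real.mul_self_sqrt hD0, Real.mul_self_sqrt hF0]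
      _ ≤ (∑ k, D k) * (C * t) := by gcongr
      _ = _ := by ring

set_option maxHeartbeats 800000 in
/-- The dual norm of the residual is bounded by the localized dual norms. -/
theorem form_le_constC_mul_localizedResidualSq (hd : d = 1 ∨ d = 2 ∨ d = 3)
    (hW : MemLpAddLinftyEps (potExponent d) fun x : Space d => W ‖x‖)
    (hA : Coercive MemH1 (molPot W R s)) (hp : IsAdaptedPartition R r Ωlast p)
    (hAk : ∀ k : Fin K, Coercive (MemH10 (Metric.ball (R k) (r k)))
      fun x => atomPot W R k x + sk k.castSucc)
    (hAlast : Coercive MemH1 fun _ : Space d => sk (Fin.last K)) {cA : ℝ}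
    (hcA' : ∀ v : L2 d, MemH1 v → ‖v‖ ≤ cA * energyNorm (molPot W R s) v)
    (hC : localizationSup W R s sk p ≠ ⊤) {lam : ℝ} {φ v : L2 d} (hφ : MemH1 φ) (hv : MemH1 v)
    (hres : form (molPot W R s) v v = lam * inner ℝ φ v - form (molPot W R s) φ v) :
    form (molPot W R s) v v
      ≤ constC W R s sk p cA * localizedResidualSq W R r s sk p lam φ := by
  have hmol := isFormBounded_molPot hd hW R s
  obtain ⟨L, hL⟩ := hmol.exists_residual lam hφ
  choose T hT using fun k => exists_sqrt_mul (hp.le_one k) (hp.sqrt_mul_memH1 k)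
  have hpair : ∀ k (x : H1 d), L (T k x)
      = residualPairing (molPot W R s) lam φ (fun a => √(p k a)) x.1.1 := fun k x => by
    rw [hL, residualPairing, L2.inner_def]
    congr 1
    · congr 1
      refine integral_congr_ae ?_
      filter_upwards [hT k x] with a ha
      rw [ha]
      simp [mul_comm]
    · exact form_congr Filter.EventuallyEq.rfl (hT k x)
  obtain ⟨x, hx1⟩ : ∃ x : H1 d, x.1.1 = v := ⟨H1.of hv, H1.of_fst v hv⟩
  have hTx : ∀ k, (T k x).1.1 =ᵐ[volume] fun a => √(p k a) * v a := fun k => by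
    have h := hT k x
    rwa [hx1] at h
  -- Applying `√p_k` twice and summing is the identity: one factor goes to the residual, the other
  -- to the test function.
  have hsum : ∑ k, T k (T k x) = x := by
    have h1 : H1.toL2 d (∑ k, T k (T k x)) = H1.toL2 d x := by
      rw [map_sum]
      refine Lp.ext ?_
      have h2 : ∀ᵐ a, ∀ k, H1.toL2 d (T k (T k x)) a = p k a * v a := ae_all_iff.2 fun k => by
        filter_upwards [hT k (T k x), hTx k] with a h3 h4
        rw [H1.toL2_apply, h3, h4, ← mul_assoc, Real.mul_self_sqrt (hp.nonneg k a)]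
      filter_upwards [h2, Lp.coeFn_finsetSum Finset.univ fun k => H1.toL2 d (T k (T k x))]
        with a h5 h6
      rw [h6, Finset.sum_apply, H1.toL2_apply, hx1]
      simp only [h5, ← Finset.sum_mul, hp.sum_eq_one, one_mul]
    exact H1.ext_fst h1
  have ht0 : 0 ≤ form (molPot W R s) v v := by
    obtain ⟨α, hα, h⟩ := hA
    exact (mul_nonneg hα.le (sq_nonneg _)).trans (h v hv)
  have hF : ∑ k, form (localPot W R sk k) (T k x).1.1 (T k x).1.1
      ≤ constC W R s sk p cA * form (molPot W R s) v v := by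
    have h1 : ∑ k, form (localPot W R sk k) (T k x).1.1 (T k x).1.1
        = ∑ k, form (localPot W R sk k) (fun x => √(p k x) * v x) fun x => √(p k x) * v x :=
      Finset.sum_congr rfl fun k _ => form_congr (hTx k) (hTx k)
    rw [h1]
    refine (sum_form_localized_le hd hW hp hC hv).trans ?_
    have h2 : ‖v‖ ^ 2 ≤ cA ^ 2 * form (molPot W R s) v v := by
      have h3 := pow_le_pow_left₀ (norm_nonneg _) (hcA' v hv) 2
      rwa [mul_pow, energyNorm, Real.sq_sqrt ht0] at h3
    have h4 := mul_le_mul_of_nonneg_left h2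
      (ENNReal.toReal_nonneg (a := localizationSup W R s sk p))
    rw [constC]
    linarith
  have hC0 : 0 ≤ constC W R s sk p cA := by
    rw [constC]
    positivity
  have hLx : form (molPot W R s) v v = ∑ k, L (T k (T k x)) := by
    rw [hres, ← map_sum, hsum, hL, hx1]
  rw [localizedResidualSq_eq_sum]
  refine le_mul_sum_of_abs_le hC0 ht0 hLx (fun k => ?_) hF
  rw [hpair k]
  exact abs_residual_le hd hW hp hAk hAlast k (L ∘L T k) (fun y => hpair k y) hv (hTx k)

end LocalizedResidual

end LCAO

namespace LCAO

/-! ### Galerkin eigenpairs in the energy space -/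

section Galerkin

variable {d N : ℕ} {U : Space d → ℝ} {V : Type*} [NormedAddCommGroup V] [InnerProductSpace ℝ V]
  {J : V →L[ℝ] L2 d}

/-- Each row of the matrix equation is the Galerkin equation against one basis function; linearity
extends it to the whole trial space. -/
theorem IsGalerkinPair.inner_eq (hin : ∀ v w, inner ℝ v w = form U (J v) (J w)) {χ : Fin N → L2 d}
    {g : Fin N → V} (hg : ∀ a, J (g a) = χ a) {lam : ℝ} {c : Fin N → ℝ}
    (hc : IsGalerkinPair U χ lam c) (b : Fin N → ℝ) :
    inner ℝ (∑ a, c a • g a) (∑ a, b a • g a)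
      = lam * inner ℝ (J (∑ a, c a • g a)) (J (∑ a, b a • g a)) := by
  have h1 : ∀ a, inner ℝ (∑ k, c k • g k) (g a)
      = lam * inner ℝ (J (∑ k, c k • g k)) (J (g a)) := fun a => by
    have h := congrFun hc a
    simp only [Matrix.mulVec, dotProduct, hamiltonianMatrix, overlapMatrix, Matrix.of_apply,
      Pi.smul_apply, smul_eq_mul] at h
    rw [real_inner_comm, real_inner_comm (J (g a))]
    simp only [inner_sum, inner_smul_right, map_sum, map_smul]
    simp only [hin, hg, mul_comm (c _), h]
  simp only [inner_sum, inner_smul_right, h1, map_sum, map_smul, Finset.mul_sum]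
  exact Finset.sum_congr rfl fun a _ => by ring

/-- Vectors with different `μ_j` are orthogonal in `L²` by symmetry, so `sum_mul_inner_nonneg`
applies with the weights `n - μ_j`. Nothing is needed inside a multiple eigenvalue. -/
theorem norm_sq_le_of_mem_span {ι : Type*} [Fintype ι] {ψ : ι → V} {μ : ι → ℝ}
    (hψ : ∀ j l, inner ℝ (ψ j) (ψ l) = μ j * inner ℝ (J (ψ j)) (J (ψ l))) {n : ℝ}
    (hn : ∀ j, μ j ≤ n) {v : V} (hv : v ∈ Submodule.span ℝ (Set.range ψ)) :
    ‖v‖ ^ 2 ≤ n * ‖J v‖ ^ 2 := by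
  obtain ⟨t, rfl⟩ := (Submodule.mem_span_range_iff_exists_fun ℝ).1 hv
  have horth : ∀ j l, n - μ j ≠ n - μ l → inner ℝ (t j • J (ψ j)) (t l • J (ψ l)) = 0 :=
    fun j l hjl => by
      have h1 := hψ j l
      have h2 := hψ l j
      rw [real_inner_comm, real_inner_comm (J (ψ j)), h1] at h2
      have h3 : (μ j - μ l) * inner ℝ (J (ψ j)) (J (ψ l)) = 0 := by linarith
      have h4 : μ j - μ l ≠ 0 := fun h => hjl (by linarith)
      rw [inner_smul_left, inner_smul_right, (mul_eq_zero_iff_left h4).1 h3]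
      simp
  have key := sum_mul_inner_nonneg (fun j => t j • J (ψ j)) (fun j => n - μ j) horth
    fun j => sub_nonneg.2 (hn j)
  have e1 : ‖∑ j, t j • ψ j‖ ^ 2
      = ∑ j, ∑ l, μ j * inner ℝ (t j • J (ψ j)) (t l • J (ψ l)) := by
    rw [← real_inner_self_eq_norm_sq, sum_inner]
    refine Finset.sum_congr rfl fun j _ => ?_
    rw [inner_sum]
    refine Finset.sum_congr rfl fun l _ => ?_
    rw [inner_smul_left, inner_smul_right, inner_smul_left, inner_smul_right, hψ]
    simp only [conj_trivial]
    ring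
  have e2 : n * ‖J (∑ j, t j • ψ j)‖ ^ 2
      = ∑ j, ∑ l, n * inner ℝ (t j • J (ψ j)) (t l • J (ψ l)) := by
    simp only [← Finset.mul_sum, ← inner_sum, ← sum_inner]
    rw [map_sum, ← real_inner_self_eq_norm_sq]
    simp only [map_smul]
  rw [← sub_nonneg, e1, e2, ← Finset.sum_sub_distrib]
  simpa only [← Finset.sum_sub_distrib, ← sub_mul] using key

/-- The min-max principle: Galerkin eigenvalues are upper bounds. -/
theorem orderedEigenvalue_le_galerkin [CompleteSpace V] (hJ : IsEnergyEmbedding U J)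
    (hin : ∀ v w, inner ℝ v w = form U (J v) (J w)) {κ : ℝ}
    (hκ : ∀ v, κ * ‖J v‖ ^ 2 ≤ ‖v‖ ^ 2) (hκ0 : 0 < κ) {χ : Fin N → L2 d}
    (hχ : LinearIndependent ℝ χ) {g : Fin N → V} (hg : ∀ a, J (g a) = χ a) {lamN : Fin N → ℝ}
    (hlamN : IsGalerkinSpectrum U χ lamN) (i : Fin N) (hpos : 0 < lamN i) :
    orderedEigenvalue U ((i : ℕ) + 1) ≤ lamN i := by
  obtain ⟨hmono, C, hC, hpair⟩ := hlamN
  have hgi : LinearIndependent ℝ g := by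
    refine LinearIndependent.of_comp (J : V →ₗ[ℝ] L2 d) ?_
    have : (J : V →ₗ[ℝ] L2 d) ∘ g = χ := funext hg
    rwa [this]
  have hle : (i : ℕ) + 1 ≤ N := i.2
  -- The Galerkin eigenvectors of index `0, …, i` span a trial space of dimension `i + 1` on which
  -- the form is at most `lamN i`.
  let ψ : Fin ((i : ℕ) + 1) → V := fun j => ∑ a, C (Fin.castLE hle j) a • g a
  have hψ : LinearIndependent ℝ ψ := by
    have h1 : LinearIndependent ℝ fun j => Fintype.linearCombination ℝ g (C j) :=
      hC.map' _ (LinearMap.ker_eq_bot.2 (linearIndependent_iff_injective_fintypeLinearCombination.1 hgi))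
    have h2 := h1.comp _ (Fin.castLE_injective hle)
    exact h2
  have : FiniteDimensional ℝ (Submodule.span ℝ (Set.range ψ)) :=
    FiniteDimensional.span_of_finite ℝ (Set.finite_range ψ)
  refine orderedEigenvalue_le hJ hκ hκ0 (Nat.succ_ne_zero _)
    (Submodule.span ℝ (Set.range ψ)) ?_ hpos fun v hv => ?_
  · rw [finrank_span_eq_card hψ, Fintype.card_fin]
  · exact norm_sq_le_of_mem_span (fun j l => (hpair (Fin.castLE hle j)).inner_eq hin hg
      (C (Fin.castLE hle l))) (fun j => hmono (Nat.lt_succ_iff.1 j.2)) hv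

end Galerkin

end LCAO

/-! ### The a posteriori error bounds. -/

theorem theorem3p2 {d K N : ℕ} (hd : d = 1 ∨ d = 2 ∨ d = 3)
    -- the potential, the atomic positions and the shifts
    (W : ℝ → ℝ)
    (hW : LCAO.MemLpAddLinftyEps (LCAO.potExponent d) fun x : LCAO.Space d => W ‖x‖)
    (R : Fin K → LCAO.Space d) (s : ℝ) (sk : Fin (K + 1) → ℝ)
    (hA : LCAO.Coercive LCAO.MemH1 (LCAO.molPot W R s))
    -- the cover and the partition of unity
    (r : Fin K → ℝ) (Ωlast : Set (LCAO.Space d)) (p : Fin (K + 1) → LCAO.Space d → ℝ)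
    (hp : LCAO.IsAdaptedPartition R r Ωlast p)
    (hAk : ∀ k : Fin K, LCAO.Coercive (LCAO.MemH10 (Metric.ball (R k) (r k)))
      fun x => LCAO.atomPot W R k x + sk k.castSucc)
    (hAlast : LCAO.Coercive LCAO.MemH1 fun _ : LCAO.Space d => sk (Fin.last K))
    -- the constants entering `C`
    (cA : ℝ) (hcA : 0 < cA)
    (hcA' : ∀ v : LCAO.L2 d, LCAO.MemH1 v →
      ‖v‖ ≤ cA * LCAO.energyNorm (LCAO.molPot W R s) v)
    (hC : LCAO.localizationSup W R s sk p ≠ ⊤)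
    -- the basis, the Galerkin eigenvalues and a normalized Galerkin eigenpair
    (χ : Fin N → LCAO.L2 d) (hχ : ∀ a, LCAO.MemH1 (χ a)) (hχ' : LinearIndependent ℝ χ)
    (lamN : Fin N → ℝ) (hlamN : LCAO.IsGalerkinSpectrum (LCAO.molPot W R s) χ lamN)
    (i : Fin N) (c : Fin N → ℝ) (φN : LCAO.L2 d)
    (hc : LCAO.IsGalerkinPair (LCAO.molPot W R s) χ (lamN i) c)
    (hφN : φN = ∑ a, c a • χ a) (hφN' : ‖φN‖ = 1)
    -- the exact eigenpair (the index `i` counts from zero)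
    (lam : ℝ) (hlam : lam = LCAO.orderedEigenvalue (LCAO.molPot W R s) ((i : ℕ) + 1))
    (φ : LCAO.L2 d) (hφ : LCAO.Solves (LCAO.molPot W R s) lam 0 φ) (hφ' : ‖φ‖ = 1)
    -- the gap condition and the sign condition
    (low up : ℝ)
    (hlow : (i : ℕ) ≠ 0 →
      LCAO.orderedEigenvalue (LCAO.molPot W R s) (i : ℕ) ≤ low ∧ low < lamN i)
    (hup : lamN i < up ∧ up ≤ LCAO.orderedEigenvalue (LCAO.molPot W R s) ((i : ℕ) + 2))
    (hsign : 0 ≤ inner ℝ φ φN) :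
    LCAO.energyNorm (LCAO.molPot W R s) (φ - φN : LCAO.L2 d) ^ 2
        ≤ LCAO.constC W R s sk p cA * (LCAO.gapGamma ((i : ℕ) = 0) (lamN i) low up)⁻¹
            * LCAO.localizedResidualSq W R r s sk p (lamN i) φN
          + lam * LCAO.constC W R s sk p cA ^ 2
            * (LCAO.gapGammaHat ((i : ℕ) = 0) (lamN i) low up)⁻¹ ^ 2
            * LCAO.localizedResidualSq W R r s sk p (lamN i) φN ^ 2 ∧
      0 ≤ lamN i - lam ∧
      lamN i - lam
        ≤ LCAO.constC W R s sk p cA * (LCAO.gapGamma ((i : ℕ) = 0) (lamN i) low up)⁻¹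
            * LCAO.localizedResidualSq W R r s sk p (lamN i) φN := by
  have hmol := LCAO.isFormBounded_molPot hd hW R s
  obtain ⟨V, _, _, _, J, e, hJ, hJe, hin⟩ := hmol.exists_isEnergyEmbedding hA
  have hmem : ∀ v, LCAO.MemH1 (J v) := fun v => by
    rw [hJe]
    exact LCAO.H1.memH1 (e v)
  have hlift : ∀ u : LCAO.L2 d, LCAO.MemH1 u → ∃ v, J v = u := fun u hu =>
    ⟨e.symm (LCAO.H1.of hu), by rw [hJe, e.apply_symm_apply, LCAO.H1.of_fst u hu]⟩
  obtain ⟨α, hα, hα'⟩ := id hA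
  have hsq : ∀ v, ‖v‖ ^ 2 = LCAO.form (LCAO.molPot W R s) (J v) (J v) := fun v => by
    rw [← real_inner_self_eq_norm_sq, hin]
  have hκ : ∀ v, α * ‖J v‖ ^ 2 ≤ ‖v‖ ^ 2 := fun v => by
    rw [hsq]
    exact hα' _ (hmem v)
  choose g hg using fun a => hlift (χ a) (hχ a)
  obtain ⟨x, hxdef⟩ : ∃ x, x = ∑ a, c a • g a := ⟨_, rfl⟩
  have hJx : J x = φN := by
    rw [hxdef, hφN, map_sum]
    simp only [map_smul, hg]
  -- The Galerkin equation tested with its own solution: `lamN i` is the Rayleigh quotient of `φN`.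
  have hxn : ‖x‖ ^ 2 = lamN i := by
    have h := hc.inner_eq hin hg c
    rwa [← hxdef, real_inner_self_eq_norm_sq, real_inner_self_eq_norm_sq, hJx, hφN', one_pow,
      mul_one] at h
  have hx1 : ‖J x‖ = 1 := by rw [hJx, hφN']
  have hpos : 0 < lamN i := by
    have h := hκ x
    rw [hx1, hxn] at h
    linarith
  have hlamn : lam ≤ lamN i := by
    rw [hlam]
    exact LCAO.orderedEigenvalue_le_galerkin hJ hin hκ hα hχ' hg hlamN i hpos
  obtain ⟨v, hJv, hv⟩ := (hJ.solves_zero_iff lam φ).1 hφ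
  -- The vector `lamN i • T x - x` represents the residual in the energy scalar product. Pairing it
  -- with itself is the identity that the localization bound requires.
  have hρ : ‖lamN i • LCAO.energyInv J x - x‖ ^ 2 ≤ LCAO.constC W R s sk p cA
      * LCAO.localizedResidualSq W R r s sk p (lamN i) φN := by
    rw [hsq]
    refine LCAO.form_le_constC_mul_localizedResidualSq hd hW hA hp hAk hAlast hcA' hC
      (hJx ▸ hmem x) (hmem _) ?_
    rw [← hJx, ← hin, ← hin]
    conv_lhs => rw [inner_sub_left, real_inner_smul_left, LCAO.inner_energyInv]
  have hbounds := LCAO.error_bounds_of_gap hJ hκ hα hlam hlow hup hlamn hv (by rw [hJv, hφ']) hx1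
    hxn (by rwa [hJv, hJx]) hρ
  have hnorm : LCAO.energyNorm (LCAO.molPot W R s) (φ - φN : LCAO.L2 d) ^ 2 = ‖v - x‖ ^ 2 := by
    have h : φ - φN = J (v - x) := by rw [map_sub, hJv, hJx]
    rw [h, LCAO.energyNorm, ← hsq, Real.sq_sqrt (sq_nonneg _)]
  refine ⟨?_, sub_nonneg.2 hlamn, ?_⟩
  · rw [hnorm]
    refine hbounds.1.trans_eq ?_
    ring
  · refine hbounds.2.trans_eq ?_
    ring
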